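/- Let $n\ge 1$ and let $(M,g)$ be a smooth (Hausdorff) Lorentzian manifold of dimension $n+2$, with $g$ of signature $(-,+,\dots,+)$. Let $\Sigma\subset TM$ be the set of nonzero null vectors and let $\mathcal N$ be the space of unparametrized null geodesics, that is, the quotient of $\Sigma$ that identifies $v$ and $w$ when, up to nonzero factors, they are velocities of one and the same affinely parametrized null geodesic. Assume that $\mathcal N$, with its quotient topology, is a smooth $(2n+1)$-manifold for which the projection $\Sigma\to\mathcal N$ is a smooth submersion (this always holds locally). For $q\in\mathcal N$ let $\mathcal C_q\subset T_q\mathcal N$ be the span of the velocities $\frac{d}{ds}\big|_{s=0}[\gamma_s]$ of smooth variations of $q=[\gamma_0]$ through null geodesics whose variation field $J=\partial_s\gamma_s|_{s=0}$ is abreast, i.e. $g(J,\dot\gamma_0)=0$. This is the canonical contact distribution of $\mathcal N$. The Heisenberg algebra $\mathfrak h_{2n+1}=\mathfrak h_{-1}\oplus\mathfrak h_{-2}$ has basis $e_{x^i},e_{p_i}$ $(1\le i\le n)$ of $\mathfrak h_{-1}$ and $e_v$ of $\mathfrak h_{-2}$, and its only nonzero brackets of basis vectors are $[e_{x^i},e_{p_i}]=e_v=-[e_{p_i},e_{x^i}]$.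 **Theorem.** Let $q\in\mathcal N$. 1. (Nilpotent approximation.) $\mathcal C$ is bracket generating of step two at $q$: $\mathcal C_q+[\mathcal C,\mathcal C]_q=T_q\mathcal N$. Every vector of $\mathcal C_q$ extends to a smooth local section of $\mathcal C$, and the class of $[X,Y](q)$ in $T_q\mathcal N/\mathcal C_q$, for local sections $X,Y$ of $\mathcal C$ near $q$, depends only on $X(q)$ and $Y(q)$. With the bracket so induced, the associated graded space $$\operatorname{gr}(T_q\mathcal N)=\mathcal C_q\oplus\bigl(T_q\mathcal N/\mathcal C_q\bigr)$$ is isomorphic to $\mathfrak h_{2n+1}$ as a graded Lie algebra, $\mathcal C_q$ corresponding to $\mathfrak h_{-1}$ and $T_q\mathcal N/\mathcal C_q$ to $\mathfrak h_{-2}$. 2. (Darboux coordinates.) Let $\theta$ be a local contact form near $q$ (a smooth $1$-form with kernel $\mathcal C$) and let $(v,x,p)=(v,x^1,\dots,x^n,p_1,\dots,p_n)$ be smooth coordinates centred at $q$ in which $\theta=dv+\sum_i p_i\,dx^i$. Then: * the maps $\xi\mapsto\sum_i\bigl(dx^i(\xi)\,e_{x^i}+dp_i(\xi)\,e_{p_i}\bigr)$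 on $\mathcal C_q$ and $[\eta]\mapsto dv(\eta)\,e_v$ on $T_q\mathcal N/\mathcal C_q$ define an isomorphism of graded Lie algebras $\operatorname{gr}(T_q\mathcal N)\cong\mathfrak h_{2n+1}$, which carries the grading derivation (multiplication by $1$ on $\mathcal C_q$ and by $2$ on $T_q\mathcal N/\mathcal C_q$) to the derivation $(v,x,p)\mapsto(2v,x,p)$ of $\mathfrak h_{2n+1}$; * the functions $x^i$ and $p_i$ have weight exactly $1$ at $q$ and $v$ has weight exactly $2$, where $f$ has weight at least $w$ at $q$ if $(X_1\cdots X_kf)(q)=0$ for all $0\le k<w$ and all local sections $X_1,\dots,X_k$ of $\mathcal C$; * the vector field $D=2v\,\partial_v+\sum_i\bigl(x^i\partial_{x^i}+p_i\partial_{p_i}\bigr)$ vanishes at $q$, its linearization $X(q)\mapsto[X,D](q)$ at $q$ preserves $\mathcal C_q$, and the endomorphism that it induces on $\operatorname{gr}(T_q\mathcal N)$ is the grading derivation. -/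

import Mathlib

open scoped Manifold ContDiff Bundle
open Bundle

noncomputable section

/-! ## Lorentzian metrics, null geodesics and the space of null geodesics -/

section Spacetime

variable {n : ℕ} {M : Type*} [TopologicalSpace M]
  [ChartedSpace (EuclideanSpace ℝ (Fin (n + 2))) M] [IsManifold (𝓡 (n + 2)) ∞ M]

variable (n M) in
/-- A smooth Lorentzian metric, of signature `(-, +, …, +)`, on the `(n + 2)`-manifold `M`. -/
structure LorentzianMetric where
  /-- The bilinear form on each tangent space. -/
  form (x : M) :
    TangentSpace (𝓡 (n + 2)) x →L[ℝ] TangentSpace (𝓡 (n + 2)) x →L[ℝ] ℝ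
  symm (x : M) (a b : TangentSpace (𝓡 (n + 2)) x) : form x a b = form x b a
  /-- There is a timelike vector on whose orthogonal complement the form is positive definite. -/
  lorentzian (x : M) : ∃ a : TangentSpace (𝓡 (n + 2)) x, form x a a < 0 ∧
    ∀ b : TangentSpace (𝓡 (n + 2)) x, form x a b = 0 → b ≠ 0 → 0 < form x b b
  contMDiff : ContMDiff (𝓡 (n + 2))
    ((𝓡 (n + 2)).prod 𝓘(ℝ, EuclideanSpace ℝ (Fin (n + 2)) →L[ℝ]
      EuclideanSpace ℝ (Fin (n + 2)) →L[ℝ] ℝ)) ∞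
    (fun x ↦ TotalSpace.mk' (EuclideanSpace ℝ (Fin (n + 2)) →L[ℝ]
      EuclideanSpace ℝ (Fin (n + 2)) →L[ℝ] ℝ) x (form x))

namespace LorentzianMetric

variable (g : LorentzianMetric n M)

/-- The components of the metric in the preferred chart at `x₀`, as a function on the model
space with values in bilinear forms. -/
def inChart (x₀ : M) (y : EuclideanSpace ℝ (Fin (n + 2))) :
    EuclideanSpace ℝ (Fin (n + 2)) →L[ℝ] EuclideanSpace ℝ (Fin (n + 2)) →L[ℝ] ℝ :=
  let A : EuclideanSpace ℝ (Fin (n + 2)) →L[ℝ] EuclideanSpace ℝ (Fin (n + 2)) :=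
    mfderiv (𝓡 (n + 2)) (𝓡 (n + 2)) (extChartAt (𝓡 (n + 2)) x₀).symm y
  let B : EuclideanSpace ℝ (Fin (n + 2)) →L[ℝ] EuclideanSpace ℝ (Fin (n + 2)) →L[ℝ] ℝ :=
    g.form ((extChartAt (𝓡 (n + 2)) x₀).symm y)
  B.bilinearComp A A

/-- The Christoffel symbols of the first kind `Γ(a, b; w) = g(∇_a b, w)`, for constant vectors
`a`, `b`, `w` in the preferred chart at `x₀`, `∇` being the Levi-Civita connection. -/
def christoffel (x₀ : M) (y a b w : EuclideanSpace ℝ (Fin (n + 2))) : ℝ :=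
  (fderiv ℝ (g.inChart x₀) y a b w + fderiv ℝ (g.inChart x₀) y b a w
    - fderiv ℝ (g.inChart x₀) y w a b) / 2

/-- `γ` is a smooth affinely parametrized geodesic on the parameter set `J`. At each parameter
the equation `∇_γ' γ' = 0` is written in the preferred chart at the point reached, with its index
lowered: `g(c'', w) + Γ(c', c'; w) = 0` for every `w`, where `c` is `γ` in the chart. -/
def IsGeodesicOn (γ : ℝ → M) (J : Set ℝ) : Prop :=
  ContMDiffOn 𝓘(ℝ, ℝ) (𝓡 (n + 2)) ∞ γ J ∧
  ∀ t ∈ J, ∀ w : EuclideanSpace ℝ (Fin (n + 2)),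
    g.inChart (γ t) (extChartAt (𝓡 (n + 2)) (γ t) (γ t))
        (deriv (deriv fun s ↦ extChartAt (𝓡 (n + 2)) (γ t) (γ s)) t) w
      + g.christoffel (γ t) (extChartAt (𝓡 (n + 2)) (γ t) (γ t))
        (deriv (fun s ↦ extChartAt (𝓡 (n + 2)) (γ t) (γ s)) t)
        (deriv (fun s ↦ extChartAt (𝓡 (n + 2)) (γ t) (γ s)) t) w = 0

/-- The nonzero null vectors, as a subset of the tangent bundle. -/
def nullCone : Set (TangentBundle (𝓡 (n + 2)) M) :=
  {v | v.2 ≠ 0 ∧ g.form v.1 v.2 v.2 = 0}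

/-- Two nonzero null vectors are tangent to the same unparametrized null geodesic: up to nonzero
factors, both are velocities of one geodesic defined on an open interval. -/
def TangentToSameGeodesic (v w : g.nullCone) : Prop :=
  ∃ (γ : ℝ → M) (J : Set ℝ), IsOpen J ∧ J.OrdConnected ∧ g.IsGeodesicOn γ J ∧
    ∃ s ∈ J, ∃ t ∈ J, ∃ a b : ℝ, a ≠ 0 ∧ b ≠ 0 ∧
      tangentMap 𝓘(ℝ, ℝ) (𝓡 (n + 2)) γ ⟨s, (1 : ℝ)⟩ = ⟨v.1.1, a • v.1.2⟩ ∧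
      tangentMap 𝓘(ℝ, ℝ) (𝓡 (n + 2)) γ ⟨t, (1 : ℝ)⟩ = ⟨w.1.1, b • w.1.2⟩

/-- The space `𝒩` of unparametrized null geodesics: the nonzero null cone modulo the geodesic
flow and rescaling. -/
def NullGeodesicSpace : Type _ := Quot g.TangentToSameGeodesic

/-- The projection `v ↦ [γ_v]` from the nonzero null cone to the null-geodesic space. -/
def toNullGeodesic (v : g.nullCone) : g.NullGeodesicSpace := Quot.mk _ v

/-- The null-geodesic space carries the quotient topology. -/
instance : TopologicalSpace g.NullGeodesicSpace :=
  inferInstanceAs (TopologicalSpace (Quot g.TangentToSameGeodesic))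

variable [ChartedSpace (EuclideanSpace ℝ (Fin (2 * n + 1))) g.NullGeodesicSpace]

/-- The charts on the null-geodesic space make it the quotient manifold of the null cone: the
projection is a smooth submersion. The nonzero null cone is an embedded hypersurface of the
tangent bundle, so smoothness is local extendability to the tangent bundle, and the tangent space
of the null cone at `v` is the kernel of the differential of `w ↦ g(w, w)`. -/
def IsQuotientManifold : Prop :=
  ∀ v : g.nullCone, ∃ (U : Set (TangentBundle (𝓡 (n + 2)) M))
    (P : TangentBundle (𝓡 (n + 2)) M → g.NullGeodesicSpace),
    IsOpen U ∧ v.1 ∈ U ∧ ContMDiffOn (𝓡 (n + 2)).tangent (𝓡 (2 * n + 1)) ∞ P U ∧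
    (∀ w : g.nullCone, w.1 ∈ U → P w.1 = g.toNullGeodesic w) ∧
    ∀ η : TangentSpace (𝓡 (2 * n + 1)) (P v.1),
      ∃ ξ : TangentSpace (𝓡 (n + 2)).tangent v.1,
        mfderiv (𝓡 (n + 2)).tangent 𝓘(ℝ, ℝ)
          (fun w : TangentBundle (𝓡 (n + 2)) M ↦ g.form w.1 w.2 w.2) v.1 ξ = 0 ∧
        mfderiv (𝓡 (n + 2)).tangent (𝓡 (2 * n + 1)) P v.1 ξ = η

/-- The canonical distribution `𝒞` on the null-geodesic space. The hyperplane at `q` is made of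
the velocities of the abreast variations of the null geodesic `q`. A variation `s ↦ [γ_s]` is
given by a curve `c` of tangent vectors `c s = γ_s'(u₀)` in the null cone; its Jacobi field at
`u₀` is the velocity of the foot point of `c`, and it is abreast when `g(J, k) = 0` for
`k = c 0`. -/
def contactDistribution (q : g.NullGeodesicSpace) :
    Submodule ℝ (TangentSpace (𝓡 (2 * n + 1)) q) :=
  Submodule.span ℝ {η | ∃ (c : ℝ → g.nullCone) (ε : ℝ), 0 < ε ∧
    ContMDiffOn 𝓘(ℝ, ℝ) (𝓡 (n + 2)).tangent ∞
      (fun s ↦ (c s : TangentBundle (𝓡 (n + 2)) M)) (Set.Ioo (-ε) ε) ∧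
    g.form (c 0).1.1 (mfderiv 𝓘(ℝ, ℝ) (𝓡 (n + 2)) (fun s ↦ (c s).1.1) 0 (1 : ℝ))
      (c 0).1.2 = 0 ∧
    tangentMap 𝓘(ℝ, ℝ) (𝓡 (2 * n + 1)) (fun s ↦ g.toNullGeodesic (c s)) ⟨0, (1 : ℝ)⟩
      = (⟨q, η⟩ : TangentBundle (𝓡 (2 * n + 1)) g.NullGeodesicSpace)}

end LorentzianMetric

end Spacetime

/-! ## Distributions and their nilpotent approximation -/

section Distribution

variable {F : Type*} [NormedAddCommGroup F] [NormedSpace ℝ F]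
  {N : Type*} [TopologicalSpace N] [ChartedSpace F N]

/-- The vector field `X` restricts to a smooth section of the distribution `D` on a neighbourhood
of `q`. With `D = fun _ ↦ ⊤` these are the vector fields smooth near `q`. -/
def IsLocalSection [IsManifold 𝓘(ℝ, F) 1 N]
    (D : (y : N) → Submodule ℝ (TangentSpace 𝓘(ℝ, F) y)) (q : N)
    (X : (y : N) → TangentSpace 𝓘(ℝ, F) y) : Prop :=
  ∃ U : Set N, IsOpen U ∧ q ∈ U ∧
    ContMDiffOn 𝓘(ℝ, F) 𝓘(ℝ, F).tangent ∞
      (fun y ↦ (⟨y, X y⟩ : TangentBundle 𝓘(ℝ, F) N)) U ∧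
    ∀ y ∈ U, X y ∈ D y

variable [IsManifold 𝓘(ℝ, F) 1 N]
  (D : (y : N) → Submodule ℝ (TangentSpace 𝓘(ℝ, F) y)) (q : N)

/-- The second layer `D + [D, D]` of the flag generated by `D`, at the point `q`. -/
def derivedLayer : Submodule ℝ (TangentSpace 𝓘(ℝ, F) q) :=
  D q ⊔ Submodule.span ℝ {ζ | ∃ X Y : (y : N) → TangentSpace 𝓘(ℝ, F) y,
    IsLocalSection D q X ∧ IsLocalSection D q Y ∧ ζ = VectorField.mlieBracket 𝓘(ℝ, F) X Y q}

/-- The associated graded space `gr(T_q N) = D_q ⊕ T_q N / D_q` of the filtration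
`D_q ⊆ T_q N`. The first summand has degree `-1` and the second has degree `-2`. -/
abbrev OsculatingSpace : Type _ := D q × (TangentSpace 𝓘(ℝ, F) q ⧸ D q)

/-- The degree `-1` part `D_q` of the associated graded space. -/
def OsculatingSpace.degreeNegOne : Submodule ℝ (OsculatingSpace D q) :=
  Submodule.prod ⊤ ⊥

/-- The degree `-2` part `T_q N / D_q` of the associated graded space. -/
def OsculatingSpace.degreeNegTwo : Submodule ℝ (OsculatingSpace D q) :=
  Submodule.prod ⊥ ⊤

open Classical in
/-- The Levi bracket `D_q × D_q → T_q N / D_q`: extend the two vectors to local sections `X`, `Y`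
of `D`, and take the class of `[X, Y]` at `q`. -/
def leviBracket (ξ η : D q) : TangentSpace 𝓘(ℝ, F) q ⧸ D q :=
  if h : ∃ XY : ((y : N) → TangentSpace 𝓘(ℝ, F) y) × ((y : N) → TangentSpace 𝓘(ℝ, F) y),
      IsLocalSection D q XY.1 ∧ IsLocalSection D q XY.2 ∧ XY.1 q = ξ ∧ XY.2 q = η then
    Submodule.Quotient.mk (VectorField.mlieBracket 𝓘(ℝ, F) h.choose.1 h.choose.2 q)
  else 0

/-- The Levi bracket is well defined: every vector of `D_q` extends to a local section of `D`, and
the class of `[X, Y]` at `q` depends only on the values of the sections `X`, `Y` at `q`. -/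
def LeviBracketWellDefined : Prop :=
  (∀ ξ : D q, ∃ X : (y : N) → TangentSpace 𝓘(ℝ, F) y, IsLocalSection D q X ∧ X q = ξ) ∧
  ∀ X Y : (y : N) → TangentSpace 𝓘(ℝ, F) y, IsLocalSection D q X → IsLocalSection D q Y →
    ∀ (hX : X q ∈ D q) (hY : Y q ∈ D q),
      leviBracket D q ⟨X q, hX⟩ ⟨Y q, hY⟩
        = Submodule.Quotient.mk (VectorField.mlieBracket 𝓘(ℝ, F) X Y q)

/-- The bracket of the nilpotent approximation of `D` at `q`: the bracket on
`D_q ⊕ T_q N / D_q` induced by the Lie bracket of vector fields. -/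
def osculatingBracket (a b : OsculatingSpace D q) : OsculatingSpace D q :=
  (0, leviBracket D q a.1 b.1)

/-- The grading derivation of the associated graded space: multiplication by the weight, `1` on
`D_q` and `2` on `T_q N / D_q`. -/
def osculatingGradingDerivation : OsculatingSpace D q →ₗ[ℝ] OsculatingSpace D q :=
  LinearMap.prodMap LinearMap.id ((2 : ℝ) • LinearMap.id)

/-- The vector field `Z` vanishes at `q`, and its linearization `X(q) ↦ [X, Z](q)` at `q`
preserves `D_q` and induces the endomorphism `T` of the associated graded space. -/
structure InducesOnOsculating (Z : (y : N) → TangentSpace 𝓘(ℝ, F) y)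
    (T : OsculatingSpace D q →ₗ[ℝ] OsculatingSpace D q) : Prop where
  zero : Z q = 0
  degreeNegOne : ∀ X : (y : N) → TangentSpace 𝓘(ℝ, F) y, IsLocalSection D q X →
    ∀ hX : X q ∈ D q, ∃ h : VectorField.mlieBracket 𝓘(ℝ, F) X Z q ∈ D q,
      T (⟨X q, hX⟩, 0) = (⟨VectorField.mlieBracket 𝓘(ℝ, F) X Z q, h⟩, 0)
  degreeNegTwo : ∀ X : (y : N) → TangentSpace 𝓘(ℝ, F) y, IsLocalSection (fun _ ↦ ⊤) q X →
    T (0, Submodule.Quotient.mk (X q))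
      = (0, Submodule.Quotient.mk (VectorField.mlieBracket 𝓘(ℝ, F) X Z q))

/-- The function `f` has weight at least `w` at `q` with respect to `D`: every derivative
`X₁ ⋯ X_k f` along local sections of `D` with `k < w` vanishes at `q`. -/
def WeightAtLeast : ℕ → (N → ℝ) → Prop
  | 0, _ => True
  | w + 1, f => f q = 0 ∧ ∀ X : (y : N) → TangentSpace 𝓘(ℝ, F) y, IsLocalSection D q X →
      WeightAtLeast w (fun y ↦ mfderiv 𝓘(ℝ, F) 𝓘(ℝ, ℝ) f y (X y))

/-- The function `f` has weight exactly `w` at `q` with respect to `D`. -/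
def HasWeight (w : ℕ) (f : N → ℝ) : Prop :=
  WeightAtLeast D q w f ∧ ¬ WeightAtLeast D q (w + 1) f

/-- `θ` is a contact form for `D` on the open set `U`: a smooth `1`-form with kernel `D`. -/
def IsContactFormOn (θ : (y : N) → TangentSpace 𝓘(ℝ, F) y →L[ℝ] ℝ) (U : Set N) : Prop :=
  IsOpen U ∧
  ContMDiffOn 𝓘(ℝ, F) (𝓘(ℝ, F).prod 𝓘(ℝ, F →L[ℝ] ℝ)) ∞
    (fun y ↦ TotalSpace.mk' (F →L[ℝ] ℝ) (E := fun y : N ↦ TangentSpace 𝓘(ℝ, F) y →L[ℝ] ℝ)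
      y (θ y)) U ∧
  ∀ y ∈ U, LinearMap.ker (θ y : TangentSpace 𝓘(ℝ, F) y →ₗ[ℝ] ℝ) = D y

end Distribution

/-! ## The Heisenberg algebra and Darboux coordinates -/

/-- The Heisenberg algebra `𝔥_{2n+1}`, with elements `(x, p, v)`. -/
@[ext]
structure HeisenbergAlgebra (n : ℕ) where
  x : Fin n → ℝ
  p : Fin n → ℝ
  v : ℝ

namespace HeisenbergAlgebra

variable (n : ℕ)

/-- The underlying vector space is `ℝⁿ × ℝⁿ × ℝ`. -/
def toProd : HeisenbergAlgebra n ≃ (Fin n → ℝ) × (Fin n → ℝ) × ℝ where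
  toFun a := (a.x, a.p, a.v)
  invFun b := ⟨b.1, b.2.1, b.2.2⟩
  left_inv _ := rfl
  right_inv _ := rfl

instance : AddCommGroup (HeisenbergAlgebra n) := (toProd n).addCommGroup

instance : Module ℝ (HeisenbergAlgebra n) := (toProd n).module ℝ

/-- The only nonzero brackets of basis vectors are `[e_{x^i}, e_{p_i}] = e_v` and
`[e_{p_i}, e_{x^i}] = -e_v`. -/
instance : Bracket (HeisenbergAlgebra n) (HeisenbergAlgebra n) where
  bracket a b := ⟨0, 0, ∑ i, (a.x i * b.p i - a.p i * b.x i)⟩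

variable {n}

@[simp] theorem add_x (a b : HeisenbergAlgebra n) : (a + b).x = a.x + b.x := rfl
@[simp] theorem add_p (a b : HeisenbergAlgebra n) : (a + b).p = a.p + b.p := rfl
@[simp] theorem add_v (a b : HeisenbergAlgebra n) : (a + b).v = a.v + b.v := rfl
@[simp] theorem sub_x (a b : HeisenbergAlgebra n) : (a - b).x = a.x - b.x := rfl
@[simp] theorem sub_p (a b : HeisenbergAlgebra n) : (a - b).p = a.p - b.p := rfl
@[simp] theorem sub_v (a b : HeisenbergAlgebra n) : (a - b).v = a.v - b.v := rfl
@[simp] theorem smul_x (c : ℝ) (a : HeisenbergAlgebra n) : (c • a).x = c • a.x := rfl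
@[simp] theorem smul_p (c : ℝ) (a : HeisenbergAlgebra n) : (c • a).p = c • a.p := rfl
@[simp] theorem smul_v (c : ℝ) (a : HeisenbergAlgebra n) : (c • a).v = c * a.v := rfl
@[simp] theorem zero_x : (0 : HeisenbergAlgebra n).x = 0 := rfl
@[simp] theorem zero_p : (0 : HeisenbergAlgebra n).p = 0 := rfl
@[simp] theorem zero_v : (0 : HeisenbergAlgebra n).v = 0 := rfl
@[simp] theorem bracket_x (a b : HeisenbergAlgebra n) : ⁅a, b⁆.x = 0 := rfl
@[simp] theorem bracket_p (a b : HeisenbergAlgebra n) : ⁅a, b⁆.p = 0 := rfl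
@[simp] theorem bracket_v (a b : HeisenbergAlgebra n) :
    ⁅a, b⁆.v = ∑ i, (a.x i * b.p i - a.p i * b.x i) := rfl

instance : LieRing (HeisenbergAlgebra n) where
  add_lie a b c := by
    apply HeisenbergAlgebra.ext
    · simp
    · simp
    · simp only [bracket_v, add_v, add_x, add_p, Pi.add_apply]
      rw [← Finset.sum_add_distrib]
      exact Finset.sum_congr rfl fun i _ ↦ by ring
  lie_add a b c := by
    apply HeisenbergAlgebra.ext
    · simp
    · simp
    · simp only [bracket_v, add_v, add_x, add_p, Pi.add_apply]
      rw [← Finset.sum_add_distrib]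
      exact Finset.sum_congr rfl fun i _ ↦ by ring
  lie_self a := by
    apply HeisenbergAlgebra.ext
    · simp
    · simp
    · rw [bracket_v, zero_v]
      exact Finset.sum_eq_zero fun i _ ↦ by ring
  leibniz_lie a b c := by
    apply HeisenbergAlgebra.ext <;> simp

instance : LieAlgebra ℝ (HeisenbergAlgebra n) where
  lie_smul c a b := by
    apply HeisenbergAlgebra.ext
    · simp
    · simp
    · simp only [bracket_v, smul_v, smul_x, smul_p, Pi.smul_apply, smul_eq_mul, Finset.mul_sum]
      exact Finset.sum_congr rfl fun i _ ↦ by ring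

variable (n)

/-- The degree `-1` part, spanned by the `e_{x^i}` and `e_{p_i}`. -/
def degreeNegOne : Submodule ℝ (HeisenbergAlgebra n) where
  carrier := {a | a.v = 0}
  add_mem' {a b} ha hb := by simp_all
  zero_mem' := rfl
  smul_mem' c a ha := by simp_all

/-- The degree `-2` part, spanned by `e_v`. -/
def degreeNegTwo : Submodule ℝ (HeisenbergAlgebra n) where
  carrier := {a | a.x = 0 ∧ a.p = 0}
  add_mem' {a b} ha hb := by simp_all
  zero_mem' := ⟨rfl, rfl⟩
  smul_mem' c a ha := by simp_all

/-- The linear map `(x, p, v) ↦ (x, p, 2v)` is a derivation of the Heisenberg algebra: its grading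
derivation, with weight `1` in degree `-1` and weight `2` in degree `-2`. -/
def gradingDerivation : LieDerivation ℝ (HeisenbergAlgebra n) (HeisenbergAlgebra n) where
  toFun a := ⟨a.x, a.p, 2 * a.v⟩
  map_add' a b := by
    apply HeisenbergAlgebra.ext
    · rfl
    · rfl
    · exact mul_add _ _ _
  map_smul' c a := by
    apply HeisenbergAlgebra.ext
    · rfl
    · rfl
    · exact mul_left_comm _ _ _
  leibniz' a b := by
    apply HeisenbergAlgebra.ext
    · simp
    · simp
    · simp only [LinearMap.coe_mk, AddHom.coe_mk, bracket_v, sub_v, Finset.mul_sum]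
      rw [← Finset.sum_sub_distrib]
      exact Finset.sum_congr rfl fun i _ ↦ by ring

end HeisenbergAlgebra

/-- An isomorphism of graded Lie algebras from the nilpotent approximation of `D` at `q` onto the
Heisenberg algebra. -/
structure IsGradedLieIso {F : Type*} [NormedAddCommGroup F] [NormedSpace ℝ F]
    {N : Type*} [TopologicalSpace N] [ChartedSpace F N] [IsManifold 𝓘(ℝ, F) 1 N]
    (D : (y : N) → Submodule ℝ (TangentSpace 𝓘(ℝ, F) y)) (q : N) {n : ℕ}
    (e : OsculatingSpace D q ≃ₗ[ℝ] HeisenbergAlgebra n) : Prop where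
  map_bracket : ∀ a b, e (osculatingBracket D q a b) = ⁅e a, e b⁆
  map_degreeNegOne : (OsculatingSpace.degreeNegOne D q).map e.toLinearMap
    = HeisenbergAlgebra.degreeNegOne n
  map_degreeNegTwo : (OsculatingSpace.degreeNegTwo D q).map e.toLinearMap
    = HeisenbergAlgebra.degreeNegTwo n

/-- The coordinate space with coordinates `(v, x, p)`. -/
abbrev DarbouxSpace (n : ℕ) : Type := ℝ × (Fin n → ℝ) × (Fin n → ℝ)

/-- The standard contact form `dv + ∑ p_i dx^i`, evaluated at the point `z = (v, x, p)`. -/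
def darbouxForm (n : ℕ) (z : DarbouxSpace n) : DarbouxSpace n →L[ℝ] ℝ :=
  ContinuousLinearMap.fst ℝ ℝ ((Fin n → ℝ) × (Fin n → ℝ)) +
    ∑ i, z.2.2 i • ((ContinuousLinearMap.proj (R := ℝ) (φ := fun _ : Fin n ↦ ℝ) i).comp
      ((ContinuousLinearMap.fst ℝ (Fin n → ℝ) (Fin n → ℝ)).comp
        (ContinuousLinearMap.snd ℝ ℝ ((Fin n → ℝ) × (Fin n → ℝ)))))

/-- The vector field `2v ∂_v + x^i ∂_{x^i} + p_i ∂_{p_i}` on the coordinate space. -/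
def darbouxEuler (n : ℕ) (z : DarbouxSpace n) : TangentSpace 𝓘(ℝ, DarbouxSpace n) z :=
  ((2 * z.1, z.2.1, z.2.2) : DarbouxSpace n)

/-- The chart `φ = (v, x, p)` is a smooth Darboux chart, centred at `q`, for the `1`-form `θ`:
`θ = dv + ∑ p_i dx^i` on the domain of `φ`. -/
structure IsDarbouxChart {F : Type*} [NormedAddCommGroup F] [NormedSpace ℝ F]
    {N : Type*} [TopologicalSpace N] [ChartedSpace F N]
    (θ : (y : N) → TangentSpace 𝓘(ℝ, F) y →L[ℝ] ℝ) (q : N) {n : ℕ}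
    (φ : OpenPartialHomeomorph N (DarbouxSpace n)) : Prop where
  mem_source : q ∈ φ.source
  centred : φ q = 0
  contMDiffOn : ContMDiffOn 𝓘(ℝ, F) 𝓘(ℝ, DarbouxSpace n) ∞ φ φ.source
  contMDiffOn_symm : ContMDiffOn 𝓘(ℝ, DarbouxSpace n) 𝓘(ℝ, F) ∞ φ.symm φ.target
  form_eq : ∀ y ∈ φ.source, ∀ ξ : TangentSpace 𝓘(ℝ, F) y,
    θ y ξ = darbouxForm n (φ y) (mfderiv 𝓘(ℝ, F) 𝓘(ℝ, DarbouxSpace n) φ y ξ)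

end

/-! Part 1 is a symplectic reduction. On the tangent bundle the Liouville form α(ξ) = g(u, dπ ξ) has
a symplectic differential. With E(u) = g(u, u), the geodesic spray X and the Euler field R = u ∂_u
satisfy ι_X dα = -dE/2 and ι_R dα = α. On the null cone E = 0 both are tangent to the fibres of the
projection to 𝒩, a dimension count shows that they span the fibre directions, and α vanishes on
them. Pull α back under a local section of the projection to a form ϑ on 𝒩. If η in ker ϑ is
dϑ-orthogonal to ker ϑ and ξ is its lift, then ι_ξ dα is a combination of dE and α. By nondegeneracy
ξ is a combination of X and R, so η = 0, and ϑ is a contact form (`pulledBackForm_spec`).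

It remains to identify ker ϑ with 𝒞, which is defined by all representatives of a null geodesic at
once. Rescaling a representative is harmless. For the geodesic flow, let V be tangent to the cone
and project to a constant vector. Then [V, X] is tangent to the fibres, so α([V, X]) = 0, and L_X α
= dE/2 vanishes on V; hence α(V) is constant along the geodesic (`fderiv_liouvilleForm_eq_zero`).
Connectedness of the parameter interval makes this global
(`contactVelocities_eq_of_toNullGeodesic_eq`), and `exists_isPfaffChart` collects the result.

For sections of ker ϑ, Cartan's formula reads ϑ([X, Y]) = -dϑ(X, Y) (`apply_lieBracket_eq`). The
Levi bracket is therefore tensorial and is the symplectic form -dϑ on the hyperplane, for which a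
symplectic basis (`exists_symplectic_coordinates`) gives the Heisenberg algebra. In Part 2 the form
is dv + ∑ p_i dx^i, the coordinates are already symplectic, and everything is explicit. -/

open Filter Topology

noncomputable section

/-! ## Vector fields in a chart -/

section ChartRep

variable {F : Type*} [NormedAddCommGroup F] [NormedSpace ℝ F]
  {N : Type*} [TopologicalSpace N] [ChartedSpace F N]
  {H : Type*} [NormedAddCommGroup H] [NormedSpace ℝ H]

theorem mlieBracket_vectorSpace (V W : (z : H) → TangentSpace 𝓘(ℝ, H) z) (z : H) :
    VectorField.mlieBracket 𝓘(ℝ, H) V W z = VectorField.lieBracket ℝ (E := H) V W z :=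
  (congrFun (VectorField.mlieBracketWithin_eq_lieBracketWithin (V := V) (W := W)
    (s := Set.univ)) z).trans (congrFun VectorField.lieBracketWithin_univ z)

/-- A homeomorphism between open sets is a smooth chart if it is smooth in both directions. -/
structure IsSmoothChart (φ : OpenPartialHomeomorph N H) : Prop where
  contMDiffOn : ContMDiffOn 𝓘(ℝ, F) 𝓘(ℝ, H) ∞ φ φ.source
  contMDiffOn_symm : ContMDiffOn 𝓘(ℝ, H) 𝓘(ℝ, F) ∞ φ.symm φ.target

/-- The differential of a chart, with values in the model space. -/
def chartDiff (φ : OpenPartialHomeomorph N H) (y : N) : TangentSpace 𝓘(ℝ, F) y →L[ℝ] H :=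
  mfderiv 𝓘(ℝ, F) 𝓘(ℝ, H) φ y

/-- The representation of a vector field in the chart `φ`. -/
def chartRep (φ : OpenPartialHomeomorph N H) (X : (y : N) → TangentSpace 𝓘(ℝ, F) y) (z : H) : H :=
  chartDiff φ (φ.symm z) (X (φ.symm z))

namespace IsSmoothChart

variable {φ : OpenPartialHomeomorph N H} (hφ : IsSmoothChart (F := F) φ)
include hφ

theorem mdifferentiable : φ.MDifferentiable 𝓘(ℝ, F) 𝓘(ℝ, H) :=
  ⟨hφ.contMDiffOn.mdifferentiableOn (by simp), hφ.contMDiffOn_symm.mdifferentiableOn (by simp)⟩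

theorem contMDiffAt {y : N} (hy : y ∈ φ.source) : ContMDiffAt 𝓘(ℝ, F) 𝓘(ℝ, H) ∞ φ y :=
  hφ.contMDiffOn.contMDiffAt (φ.open_source.mem_nhds hy)

theorem contMDiffAt_symm {z : H} (hz : z ∈ φ.target) :
    ContMDiffAt 𝓘(ℝ, H) 𝓘(ℝ, F) ∞ φ.symm z :=
  hφ.contMDiffOn_symm.contMDiffAt (φ.open_target.mem_nhds hz)

theorem isInvertible_mfderiv {y : N} (hy : y ∈ φ.source) :
    (mfderiv 𝓘(ℝ, F) 𝓘(ℝ, H) φ y).IsInvertible :=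
  ⟨hφ.mdifferentiable.mfderiv hy, rfl⟩

theorem isInvertible_chartDiff {y : N} (hy : y ∈ φ.source) :
    (chartDiff (F := F) φ y).IsInvertible :=
  ⟨hφ.mdifferentiable.mfderiv hy, rfl⟩

theorem isInvertible_mfderiv_symm {z : H} (hz : z ∈ φ.target) :
    (mfderiv 𝓘(ℝ, H) 𝓘(ℝ, F) φ.symm z).IsInvertible :=
  ⟨hφ.mdifferentiable.symm.mfderiv hz, rfl⟩

theorem inverse_mfderiv_symm {z : H} (hz : z ∈ φ.target) :
    (mfderiv 𝓘(ℝ, H) 𝓘(ℝ, F) φ.symm z).inverse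
      = mfderiv 𝓘(ℝ, F) 𝓘(ℝ, H) φ (φ.symm z) := by
  apply ContinuousLinearMap.inverse_eq
  · have h := hφ.mdifferentiable.symm_comp_deriv (φ.map_target hz)
    rwa [φ.right_inv hz] at h
  · exact hφ.mdifferentiable.comp_symm_deriv hz

/-- Pulling back under `φ.symm` applies the inverse of its differential, which is the differential
of `φ`. Results on pullbacks of vector fields thus apply to chart representatives. -/
theorem chartRep_eq_mpullback (X : (y : N) → TangentSpace 𝓘(ℝ, F) y) {z : H} (hz : z ∈ φ.target) :
    chartRep φ X z = VectorField.mpullback 𝓘(ℝ, H) 𝓘(ℝ, F) φ.symm X z := by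
  rw [VectorField.mpullback_apply, hφ.inverse_mfderiv_symm hz]
  rfl

theorem chartDiff_mpullback (V : (z : H) → TangentSpace 𝓘(ℝ, H) z) {y : N} (hy : y ∈ φ.source) :
    chartDiff φ y (VectorField.mpullback 𝓘(ℝ, F) 𝓘(ℝ, H) φ V y) = V (φ y) := by
  rw [VectorField.mpullback_apply]
  exact (hφ.isInvertible_chartDiff hy).self_apply_inverse _

theorem chartRep_mpullback (V : (z : H) → TangentSpace 𝓘(ℝ, H) z) {z : H} (hz : z ∈ φ.target) :
    chartRep φ (VectorField.mpullback 𝓘(ℝ, F) 𝓘(ℝ, H) φ V) z = V z := by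
  rw [chartRep, hφ.chartDiff_mpullback V (φ.map_target hz), φ.right_inv hz]

variable [IsManifold 𝓘(ℝ, F) ∞ N]

theorem contDiffAt_chartRep [CompleteSpace H] {X : (y : N) → TangentSpace 𝓘(ℝ, F) y} {z : H}
    (hz : z ∈ φ.target)
    (hX : ContMDiffAt 𝓘(ℝ, F) 𝓘(ℝ, F).tangent ∞
      (fun y ↦ (⟨y, X y⟩ : TangentBundle 𝓘(ℝ, F) N)) (φ.symm z)) :
    ContDiffAt ℝ ∞ (chartRep φ X) z := by
  have h := ContMDiffAt.mpullback_vectorField_preimage (I := 𝓘(ℝ, H)) hX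
    (hφ.contMDiffAt_symm hz) (hφ.isInvertible_mfderiv_symm hz) (by simp)
  refine (contMDiffAt_vectorSpace_iff_contDiffAt.1 h).congr_of_eventuallyEq ?_
  filter_upwards [φ.open_target.mem_nhds hz] with w hw
  exact hφ.chartRep_eq_mpullback X hw

theorem contMDiffAt_mpullback [CompleteSpace F] {V : (z : H) → TangentSpace 𝓘(ℝ, H) z} {y : N}
    (hy : y ∈ φ.source)
    (hV : ContDiffAt ℝ ∞ V (φ y)) :
    ContMDiffAt 𝓘(ℝ, F) 𝓘(ℝ, F).tangent ∞
      (fun y ↦ (⟨y, VectorField.mpullback 𝓘(ℝ, F) 𝓘(ℝ, H) φ V y⟩ : TangentBundle 𝓘(ℝ, F) N))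
      y :=
  ContMDiffAt.mpullback_vectorField_preimage (contMDiffAt_vectorSpace_iff_contDiffAt.2 hV)
    (hφ.contMDiffAt hy) (hφ.isInvertible_mfderiv hy) (by simp)

/-- The Lie bracket of vector fields may be computed in any smooth chart. -/
theorem chartDiff_mlieBracket [CompleteSpace F] [CompleteSpace H]
    {X Y : (y : N) → TangentSpace 𝓘(ℝ, F) y} {q : N} (hq : q ∈ φ.source)
    (hX : ContMDiffAt 𝓘(ℝ, F) 𝓘(ℝ, F).tangent ∞
      (fun y ↦ (⟨y, X y⟩ : TangentBundle 𝓘(ℝ, F) N)) q)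
    (hY : ContMDiffAt 𝓘(ℝ, F) 𝓘(ℝ, F).tangent ∞
      (fun y ↦ (⟨y, Y y⟩ : TangentBundle 𝓘(ℝ, F) N)) q) :
    chartDiff φ q (VectorField.mlieBracket 𝓘(ℝ, F) X Y q)
      = VectorField.lieBracket ℝ (chartRep φ X) (chartRep φ Y) (φ q) := by
  have hz := φ.map_source hq
  have : IsManifold 𝓘(ℝ, F) (minSmoothness ℝ 2) N := by
    rw [minSmoothness_of_isRCLikeNormedField]
    infer_instance
  -- Pullback under `φ.symm` commutes with brackets, and chart representatives are such pullbacks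
  -- near `φ q`.
  have key := VectorField.mpullback_mlieBracket (I := 𝓘(ℝ, H)) (I' := 𝓘(ℝ, F)) (f := φ.symm)
    (V := X) (W := Y) (x₀ := φ q) (n := ∞)
    (by rw [φ.left_inv hq]; exact hX.mdifferentiableAt (by simp))
    (by rw [φ.left_inv hq]; exact hY.mdifferentiableAt (by simp))
    (hφ.contMDiffAt_symm hz)
    (by rw [minSmoothness_of_isRCLikeNormedField]; exact WithTop.coe_le_coe.2 le_top)
  rw [mlieBracket_vectorSpace] at key
  have hc : ∀ Z : (y : N) → TangentSpace 𝓘(ℝ, F) y,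
      chartRep φ Z =ᶠ[𝓝 (φ q)] VectorField.mpullback 𝓘(ℝ, H) 𝓘(ℝ, F) φ.symm Z := fun Z ↦ by
    filter_upwards [φ.open_target.mem_nhds hz] with w hw
    exact hφ.chartRep_eq_mpullback Z hw
  have h2 := Filter.EventuallyEq.lieBracket_vectorField_eq (𝕜 := ℝ) (E := H) (hc X) (hc Y)
  refine Eq.trans ?_ (key.trans h2.symm)
  rw [← hφ.chartRep_eq_mpullback _ hz, chartRep, φ.left_inv hq]

end IsSmoothChart

/-! ## Distributions given by a `1`-form in a chart -/

/-- The exterior derivative `dϑ(a, b)` of a `1`-form at the point `z`. -/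
def exteriorDerivative (ϑ : H → H →L[ℝ] ℝ) (z a b : H) : ℝ :=
  fderiv ℝ ϑ z a b - fderiv ℝ ϑ z b a

/-- Cartan's formula for dϑ(V, W), where only the bracket term survives because ϑ(V) and ϑ(W) vanish
near the point. Differentiating ϑ(U) = 0 trades the derivative of U for that of ϑ. -/
theorem apply_lieBracket_eq {ϑ : H → H →L[ℝ] ℝ} {V W : H → H} {z : H}
    (hϑ : DifferentiableAt ℝ ϑ z) (hV : DifferentiableAt ℝ V z) (hW : DifferentiableAt ℝ W z)
    (hV0 : ∀ᶠ w in 𝓝 z, ϑ w (V w) = 0) (hW0 : ∀ᶠ w in 𝓝 z, ϑ w (W w) = 0) :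
    ϑ z (VectorField.lieBracket ℝ V W z) = -exteriorDerivative ϑ z (V z) (W z) := by
  have key : ∀ U : H → H, DifferentiableAt ℝ U z → (∀ᶠ w in 𝓝 z, ϑ w (U w) = 0) →
      ∀ a, ϑ z (fderiv ℝ U z a) = -fderiv ℝ ϑ z a (U z) := by
    intro U hU hU0 a
    have h1 := hϑ.hasFDerivAt.clm_apply hU.hasFDerivAt
    have h2 : HasFDerivAt (fun w ↦ ϑ w (U w)) (0 : H →L[ℝ] ℝ) z :=
      (hasFDerivAt_const (0 : ℝ) z).congr_of_eventuallyEq hU0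
    have h3 := congrArg (fun L : H →L[ℝ] ℝ ↦ L a) (h1.unique h2)
    simp at h3
    linarith
  rw [VectorField.lieBracket, map_sub, key W hW hW0, key V hV hV0, exteriorDerivative]
  ring

/-- In the smooth chart `φ` around `q`, the distribution `D` is the kernel of the `1`-form `ϑ`. -/
structure IsPfaffChart [IsManifold 𝓘(ℝ, F) 1 N]
    (D : (y : N) → Submodule ℝ (TangentSpace 𝓘(ℝ, F) y)) (q : N)
    (φ : OpenPartialHomeomorph N H) (ϑ : H → H →L[ℝ] ℝ) : Prop extends
    IsSmoothChart (F := F) φ where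
  mem_source : q ∈ φ.source
  contDiffAt : ∀ᶠ z in 𝓝 (φ q), ContDiffAt ℝ ∞ ϑ z
  mem_iff : ∀ᶠ y in 𝓝 q, ∀ ξ : TangentSpace 𝓘(ℝ, F) y,
    ξ ∈ D y ↔ ϑ (φ y) (chartDiff φ y ξ) = 0

namespace IsPfaffChart

variable [IsManifold 𝓘(ℝ, F) ∞ N]
  {D : (y : N) → Submodule ℝ (TangentSpace 𝓘(ℝ, F) y)} {q : N}
  {φ : OpenPartialHomeomorph N H} {ϑ : H → H →L[ℝ] ℝ} (h : IsPfaffChart D q φ ϑ)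
  {X Y : (y : N) → TangentSpace 𝓘(ℝ, F) y}

theorem _root_.IsLocalSection.contMDiffAt (hX : IsLocalSection D q X) :
    ContMDiffAt 𝓘(ℝ, F) 𝓘(ℝ, F).tangent ∞
      (fun y ↦ (⟨y, X y⟩ : TangentBundle 𝓘(ℝ, F) N)) q := by
  obtain ⟨U, hU, hq, hs, -⟩ := hX
  exact hs.contMDiffAt (hU.mem_nhds hq)

theorem _root_.IsLocalSection.eventually_mem (hX : IsLocalSection D q X) :
    ∀ᶠ y in 𝓝 q, X y ∈ D y := by
  obtain ⟨U, hU, hq, -, hm⟩ := hX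
  filter_upwards [hU.mem_nhds hq] with y hy using hm y hy

include h

theorem mem_iff_self (ξ : TangentSpace 𝓘(ℝ, F) q) :
    ξ ∈ D q ↔ ϑ (φ q) (chartDiff φ q ξ) = 0 :=
  h.mem_iff.self_of_nhds ξ

theorem chartRep_self (X : (y : N) → TangentSpace 𝓘(ℝ, F) y) :
    chartRep φ X (φ q) = chartDiff φ q (X q) := by
  rw [chartRep, φ.left_inv h.mem_source]

theorem contDiffAt_chartRep_self [CompleteSpace H] (hX : IsLocalSection D q X) :
    ContDiffAt ℝ ∞ (chartRep φ X) (φ q) := by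
  apply h.contDiffAt_chartRep (φ.map_source h.mem_source)
  rw [φ.left_inv h.mem_source]
  exact hX.contMDiffAt

theorem form_chartRep (hX : IsLocalSection D q X) :
    ∀ᶠ z in 𝓝 (φ q), ϑ z (chartRep φ X z) = 0 := by
  have hz := φ.map_source h.mem_source
  have ht : Tendsto φ.symm (𝓝 (φ q)) (𝓝 q) := by
    have := φ.continuousAt_symm hz
    rwa [ContinuousAt, φ.left_inv h.mem_source] at this
  filter_upwards [ht.eventually h.mem_iff, ht.eventually hX.eventually_mem,
    φ.open_target.mem_nhds hz] with z h1 h2 h3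
  have := (h1 _).1 h2
  rwa [φ.right_inv h3] at this

/-- The right-hand side involves only the values of the sections at `q`: this is the tensoriality of
the Levi bracket. -/
theorem form_mlieBracket [CompleteSpace F] [CompleteSpace H]
    (hX : IsLocalSection D q X) (hY : IsLocalSection D q Y) :
    ϑ (φ q) (chartDiff φ q (VectorField.mlieBracket 𝓘(ℝ, F) X Y q))
      = -exteriorDerivative ϑ (φ q) (chartDiff φ q (X q))
          (chartDiff φ q (Y q)) := by
  rw [h.chartDiff_mlieBracket h.mem_source hX.contMDiffAt hY.contMDiffAt,
    apply_lieBracket_eq (h.contDiffAt.self_of_nhds.differentiableAt (by simp))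
      ((h.contDiffAt_chartRep_self hX).differentiableAt (by simp))
      ((h.contDiffAt_chartRep_self hY).differentiableAt (by simp))
      (h.form_chartRep hX) (h.form_chartRep hY), h.chartRep_self, h.chartRep_self]

theorem isLocalSection_mpullback [CompleteSpace F] {V : (z : H) → TangentSpace 𝓘(ℝ, H) z}
    (hV : ∀ᶠ z in 𝓝 (φ q), ContDiffAt ℝ ∞ V z) (hV0 : ∀ᶠ z in 𝓝 (φ q), ϑ z (V z) = 0) :
    IsLocalSection D q (VectorField.mpullback 𝓘(ℝ, F) 𝓘(ℝ, H) φ V) := by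
  have ht : Tendsto φ (𝓝 q) (𝓝 (φ q)) := φ.continuousAt h.mem_source
  have hev := ((ht.eventually hV).and (ht.eventually hV0)).and
    (h.mem_iff.and (φ.open_source.mem_nhds h.mem_source))
  obtain ⟨U, hU, hUo, hqU⟩ := eventually_nhds_iff.1 hev
  refine ⟨U, hUo, hqU, fun y hy ↦ ?_, fun y hy ↦ ?_⟩
  · exact (h.contMDiffAt_mpullback (hU y hy).2.2 (hU y hy).1.1).contMDiffWithinAt
  · rw [(hU y hy).2.1, h.chartDiff_mpullback V (hU y hy).2.2]
    exact (hU y hy).1.2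

/-- Extend the vector to a constant field in the chart and project it to the kernel along a constant
transverse vector R. The correction vanishes at `q`, where the vector is already in the kernel. -/
theorem exists_isLocalSection [CompleteSpace F] (hne : ϑ (φ q) ≠ 0)
    {ξ : TangentSpace 𝓘(ℝ, F) q} (hξ : ξ ∈ D q) :
    ∃ X : (y : N) → TangentSpace 𝓘(ℝ, F) y, IsLocalSection D q X ∧ X q = ξ := by
  obtain ⟨R, hR⟩ : ∃ R, ϑ (φ q) R ≠ 0 := by
    by_contra! hcon
    exact hne (ContinuousLinearMap.ext hcon)
  have hR' : ∀ᶠ z in 𝓝 (φ q), ϑ z R ≠ 0 :=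
    (h.contDiffAt.self_of_nhds.continuousAt.clm_apply continuousAt_const).eventually_ne hR
  set a : H := chartDiff φ q ξ with ha
  have ha0 : ϑ (φ q) a = 0 := (h.mem_iff_self ξ).1 hξ
  let V : H → H := fun z ↦ a - (ϑ z a / ϑ z R) • R
  refine ⟨VectorField.mpullback 𝓘(ℝ, F) 𝓘(ℝ, H) φ V, h.isLocalSection_mpullback ?_ ?_, ?_⟩
  · filter_upwards [h.contDiffAt, hR'] with z hz hz'
    exact contDiffAt_const.sub (((hz.clm_apply contDiffAt_const).div
      (hz.clm_apply contDiffAt_const) hz').smul contDiffAt_const)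
  · filter_upwards [hR'] with z hz
    change ϑ z (a - (ϑ z a / ϑ z R) • R) = 0
    rw [map_sub, map_smul, smul_eq_mul, div_mul_cancel₀ _ hz, sub_self]
  · apply (h.isInvertible_chartDiff h.mem_source).injective
    rw [h.chartDiff_mpullback V h.mem_source, ← ha]
    change a - (ϑ (φ q) a / ϑ (φ q) R) • R = a
    simp [ha0]

/-- Vectors at `q` agree modulo the distribution exactly when `ϑ` takes the same value on them, and
`ϑ` of a bracket sees only the values of the two sections. So the chosen extensions in `leviBracket`
do not matter. -/
theorem leviBracketWellDefined [CompleteSpace F] [CompleteSpace H] (hne : ϑ (φ q) ≠ 0) :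
    LeviBracketWellDefined D q := by
  classical
  refine ⟨fun ξ ↦ h.exists_isLocalSection hne ξ.2, fun X Y hX hY hXq hYq ↦ ?_⟩
  have hex : ∃ XY : ((y : N) → TangentSpace 𝓘(ℝ, F) y) × ((y : N) → TangentSpace 𝓘(ℝ, F) y),
      IsLocalSection D q XY.1 ∧ IsLocalSection D q XY.2 ∧ XY.1 q = X q ∧ XY.2 q = Y q :=
    ⟨(X, Y), hX, hY, rfl, rfl⟩
  rw [leviBracket, dif_pos hex, Submodule.Quotient.eq, h.mem_iff_self, map_sub, map_sub,
    sub_eq_zero]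
  obtain ⟨h1, h2, h3, h4⟩ := hex.choose_spec
  rw [h.form_mlieBracket h1 h2, h.form_mlieBracket hX hY, h3, h4]

end IsPfaffChart
end ChartRep

/-! ### Graded isomorphisms and weights read off from a Pfaffian form. -/

section Pfaff

variable {F : Type*} [NormedAddCommGroup F] [NormedSpace ℝ F]
  {N : Type*} [TopologicalSpace N] [ChartedSpace F N]
  {H : Type*} [NormedAddCommGroup H] [NormedSpace ℝ H]

/-- The Heisenberg algebra as a product of its graded pieces. -/
def HeisenbergAlgebra.ofProd (n : ℕ) :
    (((Fin n → ℝ) × (Fin n → ℝ)) × ℝ) ≃ₗ[ℝ] HeisenbergAlgebra n where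
  toFun a := ⟨a.1.1, a.1.2, a.2⟩
  invFun b := ((b.x, b.p), b.v)
  map_add' _ _ := rfl
  map_smul' _ _ := rfl
  left_inv _ := rfl
  right_inv _ := rfl

namespace IsPfaffChart

variable [IsManifold 𝓘(ℝ, F) ∞ N] [CompleteSpace F] [CompleteSpace H]
  {D : (y : N) → Submodule ℝ (TangentSpace 𝓘(ℝ, F) y)} {q : N}
  {φ : OpenPartialHomeomorph N H} {ϑ : H → H →L[ℝ] ℝ} (h : IsPfaffChart D q φ ϑ)
include h

/-- The distribution is a hyperplane at `q`, so one bracket outside it suffices. -/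
theorem derivedLayer_eq_top (hne : ϑ (φ q) ≠ 0) {a b : H} (ha : ϑ (φ q) a = 0)
    (hb : ϑ (φ q) b = 0) (hab : exteriorDerivative ϑ (φ q) a b ≠ 0) :
    derivedLayer D q = ⊤ := by
  have hinv := h.isInvertible_chartDiff h.mem_source
  obtain ⟨ξ, rfl⟩ := hinv.surjective a
  obtain ⟨η, rfl⟩ := hinv.surjective b
  obtain ⟨X, hX, rfl⟩ := h.exists_isLocalSection hne ((h.mem_iff_self ξ).2 ha)
  obtain ⟨Y, hY, rfl⟩ := h.exists_isLocalSection hne ((h.mem_iff_self η).2 hb)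
  have hXY := h.form_mlieBracket hX hY
  set ζ₀ := VectorField.mlieBracket 𝓘(ℝ, F) X Y q with hζ₀
  have h0 : ϑ (φ q) (chartDiff φ q ζ₀) ≠ 0 := by rw [hXY]; exact neg_ne_zero.2 hab
  rw [eq_top_iff]
  intro ζ _
  set t := ϑ (φ q) (chartDiff φ q ζ) / ϑ (φ q) (chartDiff φ q ζ₀) with ht
  refine Submodule.mem_sup.2 ⟨ζ - t • ζ₀, ?_, t • ζ₀, ?_, sub_add_cancel _ _⟩
  · rw [h.mem_iff_self, map_sub, map_sub, map_smul, map_smul, smul_eq_mul, ht,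
      div_mul_cancel₀ _ h0, sub_self]
  · exact Submodule.smul_mem _ _ (Submodule.subset_span ⟨X, Y, hX, hY, hζ₀⟩)

/-- Symplectic coordinates on the kernel of the form identify the nilpotent approximation with the
Heisenberg algebra. -/
theorem exists_isGradedLieIso (hne : ϑ (φ q) ≠ 0) {n : ℕ}
    (κ : LinearMap.ker (ϑ (φ q) : H →ₗ[ℝ] ℝ) ≃ₗ[ℝ] (Fin n → ℝ) × (Fin n → ℝ))
    (hκ : ∀ a b : LinearMap.ker (ϑ (φ q) : H →ₗ[ℝ] ℝ), exteriorDerivative ϑ (φ q) a b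
      = -∑ i, ((κ a).1 i * (κ b).2 i - (κ a).2 i * (κ b).1 i)) :
    ∃ e : OsculatingSpace D q ≃ₗ[ℝ] HeisenbergAlgebra n, IsGradedLieIso D q e ∧
      (∀ (ξ : D q) (a : LinearMap.ker (ϑ (φ q) : H →ₗ[ℝ] ℝ)), (a : H) = chartDiff φ q ξ.1 →
        e (ξ, 0) = ⟨(κ a).1, (κ a).2, 0⟩) ∧
      ∀ η : TangentSpace 𝓘(ℝ, F) q,
        e (0, Submodule.Quotient.mk η) = ⟨0, 0, ϑ (φ q) (chartDiff φ q η)⟩ := by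
  have hinv := h.isInvertible_chartDiff h.mem_source
  let c : TangentSpace 𝓘(ℝ, F) q →ₗ[ℝ] H := (chartDiff φ q).toLinearMap
  let A : D q ≃ₗ[ℝ] LinearMap.ker (ϑ (φ q) : H →ₗ[ℝ] ℝ) := LinearEquiv.ofBijective
    ((c.comp (D q).subtype).codRestrict _
      fun ξ ↦ (h.mem_iff_self ξ.1).1 ξ.2) <| by
    refine ⟨fun ξ η hξη ↦ Subtype.ext (hinv.injective (congrArg Subtype.val hξη)), fun a ↦ ?_⟩
    obtain ⟨ξ, hξ⟩ := hinv.surjective a.1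
    exact ⟨⟨ξ, (h.mem_iff_self ξ).2 (hξ ▸ a.2)⟩, Subtype.ext hξ⟩
  have hA : ∀ ξ : D q, (A ξ : H) = chartDiff φ q ξ.1 := fun ξ ↦ rfl
  let β : TangentSpace 𝓘(ℝ, F) q →ₗ[ℝ] ℝ :=
    (ϑ (φ q) : H →ₗ[ℝ] ℝ).comp c
  have hβ : D q = LinearMap.ker β := by
    ext ξ
    exact h.mem_iff_self ξ
  have hβs : Function.Surjective β := by
    apply LinearMap.surjective
    intro h0
    apply hne
    ext a
    obtain ⟨ξ, rfl⟩ := hinv.surjective a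
    exact congrArg (fun L : TangentSpace 𝓘(ℝ, F) q →ₗ[ℝ] ℝ ↦ L ξ) h0
  let B : (TangentSpace 𝓘(ℝ, F) q ⧸ D q) ≃ₗ[ℝ] ℝ :=
    (Submodule.quotEquivOfEq _ _ hβ).trans (β.quotKerEquivOfSurjective hβs)
  have hB : ∀ η, B (Submodule.Quotient.mk η) = ϑ (φ q) (chartDiff φ q η) := fun η ↦ rfl
  let e : OsculatingSpace D q ≃ₗ[ℝ] HeisenbergAlgebra n :=
    ((A.trans κ).prodCongr B).trans (HeisenbergAlgebra.ofProd n)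
  have he : ∀ a, e a = ⟨(κ (A a.1)).1, (κ (A a.1)).2, B a.2⟩ := fun a ↦ rfl
  refine ⟨e, ⟨fun a b ↦ ?_, ?_, ?_⟩, fun ξ a ha ↦ ?_, fun η ↦ ?_⟩
  -- Extend both vectors to sections. The minus sign of Cartan's formula cancels the one in `hκ`.
  · obtain ⟨X, hX, hXq⟩ := h.exists_isLocalSection hne a.1.2
    obtain ⟨Y, hY, hYq⟩ := h.exists_isLocalSection hne b.1.2
    have hXD : X q ∈ D q := hXq ▸ a.1.2
    have hYD : Y q ∈ D q := hYq ▸ b.1.2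
    have hl := (h.leviBracketWellDefined hne).2 X Y hX hY hXD hYD
    have ea : (⟨X q, hXD⟩ : D q) = a.1 := Subtype.ext hXq
    have eb : (⟨Y q, hYD⟩ : D q) = b.1 := Subtype.ext hYq
    rw [ea, eb] at hl
    rw [he, osculatingBracket]
    apply HeisenbergAlgebra.ext
    · simp
    · simp
    · simp only [HeisenbergAlgebra.bracket_v, he]
      rw [hl, hB, h.form_mlieBracket hX hY, hXq, hYq, ← hA, ← hA, hκ, neg_neg]
  · ext c
    constructor
    · rintro ⟨a, ha, rfl⟩
      have : a.2 = 0 := (Submodule.mem_prod.1 ha).2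
      change B a.2 = 0
      rw [this, map_zero]
    · intro hc
      refine ⟨(A.symm (κ.symm (c.x, c.p)), 0), Submodule.mem_prod.2 ⟨trivial, rfl⟩, ?_⟩
      have hc' : c.v = 0 := hc
      change e _ = c
      rw [he]
      apply HeisenbergAlgebra.ext <;> simp [hc']
  · ext c
    constructor
    · rintro ⟨a, ha, rfl⟩
      have : a.1 = 0 := (Submodule.mem_prod.1 ha).1
      change (κ (A a.1)).1 = 0 ∧ (κ (A a.1)).2 = 0
      rw [this]
      simp
    · rintro ⟨hx, hp⟩
      refine ⟨(0, B.symm c.v), Submodule.mem_prod.2 ⟨rfl, trivial⟩, ?_⟩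
      change e _ = c
      rw [he]
      apply HeisenbergAlgebra.ext <;> simp [hx, hp]
  · have : A ξ = a := Subtype.ext ((hA ξ).trans ha.symm)
    rw [he, this]
    simp
  · rw [he]
    apply HeisenbergAlgebra.ext <;> simp [hB]

omit [CompleteSpace F] [CompleteSpace H] [IsManifold 𝓘(ℝ, F) ∞ N] h in
-- Derivatives at `q` see only germs. This allows formulas for derivatives that hold merely near `q`
-- to be iterated.
theorem _root_.WeightAtLeast.congr [IsManifold 𝓘(ℝ, F) 1 N]
    {D : (y : N) → Submodule ℝ (TangentSpace 𝓘(ℝ, F) y)} {w : ℕ} {f f' : N → ℝ}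
    (hf : WeightAtLeast D q w f) (hff' : f =ᶠ[𝓝 q] f') : WeightAtLeast D q w f' := by
  induction w generalizing f f' with
  | zero => trivial
  | succ w ih =>
    refine ⟨hff'.self_of_nhds ▸ hf.1, fun X hX ↦ ih (hf.2 X hX) ?_⟩
    filter_upwards [hff'.eventuallyEq_nhds] with y hy
    exact congrArg (fun L : TangentSpace 𝓘(ℝ, F) y →L[ℝ] ℝ ↦ L (X y)) hy.mfderiv_eq

omit [CompleteSpace F] [CompleteSpace H] in
theorem eventually_mfderiv_comp (u : H →L[ℝ] ℝ) (X : (y : N) → TangentSpace 𝓘(ℝ, F) y) :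
    (fun y ↦ (mfderiv 𝓘(ℝ, F) 𝓘(ℝ, ℝ) (fun y ↦ u (φ y)) y (X y) : ℝ))
      =ᶠ[𝓝 q] fun y ↦ u (chartDiff φ y (X y)) := by
  filter_upwards [φ.open_source.mem_nhds h.mem_source] with y hy
  have h1 := (h.contMDiffAt hy).mdifferentiableAt (by simp) |>.hasMFDerivAt
  have h2 := (u.hasFDerivAt (x := φ y)).hasMFDerivAt.comp y h1
  exact congrArg (fun L : TangentSpace 𝓘(ℝ, F) y →L[ℝ] ℝ ↦ L (X y)) h2.mfderiv

omit [CompleteSpace H] in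
-- A section of the distribution through a vector on which `u` is nonzero has a nonzero derivative
-- of `u ∘ φ` at `q`.
theorem hasWeight_one (hne : ϑ (φ q) ≠ 0) (u : H →L[ℝ] ℝ) (hu : u (φ q) = 0) {a : H}
    (ha : ϑ (φ q) a = 0) (hua : u a ≠ 0) : HasWeight D q 1 (fun y ↦ u (φ y)) := by
  refine ⟨⟨hu, fun _ _ ↦ trivial⟩, fun hw ↦ hua ?_⟩
  obtain ⟨ξ, rfl⟩ := (h.isInvertible_chartDiff h.mem_source).surjective a
  obtain ⟨X, hX, rfl⟩ := h.exists_isLocalSection hne ((h.mem_iff_self ξ).2 ha)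
  exact ((h.eventually_mfderiv_comp u X).self_of_nhds).symm.trans (hw.2 X hX).1

end IsPfaffChart

end Pfaff

/-! ## Symplectic coordinates on a symplectic vector space -/

/-- Adjoining a first coordinate to both halves of `ℝⁿ × ℝⁿ`. -/
def consProdEquiv (n : ℕ) :
    (((Fin n → ℝ) × (Fin n → ℝ)) × (ℝ × ℝ)) ≃ₗ[ℝ] (Fin (n + 1) → ℝ) × (Fin (n + 1) → ℝ) where
  toFun a := (Fin.cons a.2.1 a.1.1, Fin.cons a.2.2 a.1.2)
  invFun b := ((Fin.tail b.1, Fin.tail b.2), (b.1 0, b.2 0))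
  map_add' a b := by
    ext i <;> refine Fin.cases ?_ (fun j ↦ ?_) i <;> simp
  map_smul' c a := by
    ext i <;> refine Fin.cases ?_ (fun j ↦ ?_) i <;> simp
  left_inv a := by simp
  right_inv b := by simp

/-- Induction on `n`, splitting off a hyperbolic plane spanned by e, f with Ω(e, f) = 1. Its
Ω-orthogonal complement W is again symplectic, of dimension two less. -/
theorem exists_symplectic_coordinates (n : ℕ) {V : Type*} [AddCommGroup V] [Module ℝ V]
    [FiniteDimensional ℝ V] (Ω : V →ₗ[ℝ] V →ₗ[ℝ] ℝ) (halt : ∀ a, Ω a a = 0)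
    (hnd : ∀ a, (∀ b, Ω a b = 0) → a = 0) (hdim : Module.finrank ℝ V = 2 * n) :
    ∃ κ : V ≃ₗ[ℝ] (Fin n → ℝ) × (Fin n → ℝ), ∀ a b,
      Ω a b = ∑ i, ((κ a).1 i * (κ b).2 i - (κ a).2 i * (κ b).1 i) := by
  have hskew : ∀ a b, Ω a b = -Ω b a := fun a b ↦ by
    have := halt (a + b)
    simp only [map_add, LinearMap.add_apply, halt] at this
    linarith
  induction n generalizing V with
  | zero =>
    have : Subsingleton V := Module.finrank_zero_iff.1 (by simpa using hdim)
    refine ⟨LinearEquiv.ofFinrankEq _ _ (by simp [hdim]), fun a b ↦ ?_⟩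
    simp [Subsingleton.elim a 0]
  | succ n ih =>
    have : Nontrivial V := Module.nontrivial_of_finrank_pos (R := ℝ) (by omega)
    obtain ⟨e, he⟩ := exists_ne (0 : V)
    obtain ⟨f', hf'⟩ : ∃ f, Ω e f ≠ 0 := by
      by_contra! hcon
      exact he (hnd e hcon)
    set f := (Ω e f')⁻¹ • f' with hf
    have hef : Ω e f = 1 := by simp [hf, hf']
    have hfe : Ω f e = -1 := by rw [hskew, hef]
    let W : Submodule ℝ V := LinearMap.ker (Ω e) ⊓ LinearMap.ker (Ω f)
    have hW : ∀ w : W, Ω e w = 0 ∧ Ω f w = 0 := fun w ↦ w.2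
    have hW' : ∀ w : W, Ω w e = 0 ∧ Ω w f = 0 := fun w ↦ by
      rw [hskew w.1 e, hskew w.1 f, (hW w).1, (hW w).2]; simp
    -- The projection onto W along the plane: the coefficients of e and f in x are Ω(x, f) and Ω(e,
    -- x).
    let P : V →ₗ[ℝ] V := LinearMap.id - (Ω.flip f).smulRight e - (Ω e).smulRight f
    have hP : ∀ x, P x = x - Ω x f • e - Ω e x • f := fun x ↦ rfl
    have hPW : ∀ x, P x ∈ W := fun x ↦ by
      refine ⟨?_, ?_⟩
      · change Ω e (P x) = 0
        simp [hP, halt, hef]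
      · change Ω f (P x) = 0
        rw [hP]
        simp only [map_sub, map_smul, halt, hfe, hskew f x, smul_eq_mul]
        ring
    let K : V ≃ₗ[ℝ] W × (ℝ × ℝ) :=
      { toFun := fun x ↦ (P.codRestrict W hPW x, (Ω x f, Ω e x))
        map_add' := fun x y ↦ by simp
        map_smul' := fun c x ↦ by simp
        invFun := fun y ↦ y.1 + y.2.1 • e + y.2.2 • f
        left_inv := fun x ↦ by
          change P x + Ω x f • e + Ω e x • f = x
          rw [hP]; abel
        right_inv := fun y ↦ by
          obtain ⟨w, s, t⟩ := y
          refine Prod.ext (Subtype.ext ?_) (Prod.ext ?_ ?_)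
          · change P (w + s • e + t • f) = w
            rw [hP]
            simp only [map_add, LinearMap.add_apply, map_smul, LinearMap.smul_apply, (hW w).1,
              (hW' w).2, hef, halt, smul_eq_mul, mul_zero, mul_one, zero_add, add_zero]
            abel
          · change Ω (w + s • e + t • f) f = s
            simp [(hW' w).2, hef, halt]
          · change Ω e (w + s • e + t • f) = t
            simp [(hW w).1, hef, halt] }
    have hK : ∀ x y, Ω x y = Ω (K x).1 (K y).1 + (Ω x f * Ω e y - Ω e x * Ω y f) := fun x y ↦ by
      change Ω x y = Ω (P x) (P y) + _
      rw [hP, hP]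
      simp only [map_sub, LinearMap.sub_apply, map_smul, LinearMap.smul_apply, smul_eq_mul, hef,
        hfe, halt, hskew x e, hskew f y]
      ring
    have hdimW : Module.finrank ℝ W = 2 * n := by
      have := K.finrank_eq
      simp at this
      omega
    -- Nondegeneracy passes to W: since W is orthogonal to the plane, pairing an element of W with
    -- any b sees only the W-component of b.
    obtain ⟨κ, hκ⟩ := ih (Ω.domRestrict₁₂ W W) (fun a ↦ halt a.1) (fun a ha ↦ by
      apply Subtype.ext
      apply hnd
      intro b
      have h1 : Ω a.1 (K b).1.1 = 0 := ha (K b).1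
      have h2 := hK a.1 b
      have h3 : K a.1 = (a, (0, 0)) := by
        rw [← LinearEquiv.eq_symm_apply]
        change a.1 = a.1 + (0 : ℝ) • e + (0 : ℝ) • f
        simp
      rw [h3, (hW' a).2, (hW a).1] at h2
      simpa [h2] using h1) hdimW (fun a b ↦ hskew a.1 b.1)
    refine ⟨K.trans ((κ.prodCongr (LinearEquiv.refl ℝ (ℝ × ℝ))).trans (consProdEquiv n)),
      fun x y ↦ ?_⟩
    rw [hK x y, Fin.sum_univ_succ]
    have := hκ (K x).1 (K y).1
    simp only [LinearMap.domRestrict₁₂_apply] at this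
    rw [this, add_comm]
    rfl

/-! ## Pfaffian charts with nondegenerate forms -/

section Pfaff

variable {F : Type*} [NormedAddCommGroup F] [NormedSpace ℝ F]
  {N : Type*} [TopologicalSpace N] [ChartedSpace F N]
  {H : Type*} [NormedAddCommGroup H] [NormedSpace ℝ H]

/-- If `ϑ` is a contact form, then the nilpotent approximation of its kernel is the Heisenberg
algebra. -/
theorem IsPfaffChart.nilpotentApproximation [IsManifold 𝓘(ℝ, F) ∞ N] [CompleteSpace F]
    [FiniteDimensional ℝ H] {D : (y : N) → Submodule ℝ (TangentSpace 𝓘(ℝ, F) y)} {q : N}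
    {φ : OpenPartialHomeomorph N H} {ϑ : H → H →L[ℝ] ℝ} (h : IsPfaffChart D q φ ϑ)
    (hne : ϑ (φ q) ≠ 0) {n : ℕ} (hn : 1 ≤ n) (hdim : Module.finrank ℝ H = 2 * n + 1)
    (hnd : ∀ a, ϑ (φ q) a = 0 →
      (∀ b, ϑ (φ q) b = 0 → exteriorDerivative ϑ (φ q) a b = 0) → a = 0) :
    derivedLayer D q = ⊤ ∧ LeviBracketWellDefined D q ∧
      ∃ e : OsculatingSpace D q ≃ₗ[ℝ] HeisenbergAlgebra n, IsGradedLieIso D q e := by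
  have : CompleteSpace H := FiniteDimensional.complete ℝ H
  let W : Submodule ℝ H := LinearMap.ker (ϑ (φ q) : H →ₗ[ℝ] ℝ)
  have hfin : Module.finrank ℝ W = 2 * n := by
    have h1 := (ϑ (φ q) : H →ₗ[ℝ] ℝ).finrank_range_add_finrank_ker
    have h2 : LinearMap.range (ϑ (φ q) : H →ₗ[ℝ] ℝ) = ⊤ := by
      refine LinearMap.range_eq_top.2 (LinearMap.surjective ?_)
      exact fun h0 ↦ hne (ContinuousLinearMap.coe_injective h0)
    rw [h2, finrank_top, Module.finrank_self, hdim] at h1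
    change 1 + Module.finrank ℝ W = _ at h1
    omega
  -- The sign is that of the Levi bracket, so symplectic coordinates reproduce the Heisenberg
  -- bracket.
  let Ω : W →ₗ[ℝ] W →ₗ[ℝ] ℝ := LinearMap.mk₂ ℝ
    (fun a b ↦ -exteriorDerivative ϑ (φ q) a.1 b.1)
    (fun a b c ↦ by simp [exteriorDerivative]; ring)
    (fun a b c ↦ by simp [exteriorDerivative]; ring)
    (fun a b c ↦ by simp [exteriorDerivative]; ring)
    (fun a b c ↦ by simp [exteriorDerivative]; ring)
  have hΩ : ∀ a b, Ω a b = -exteriorDerivative ϑ (φ q) a.1 b.1 := fun _ _ ↦ rfl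
  have hΩnd : ∀ a, (∀ b, Ω a b = 0) → a = 0 := fun a ha ↦
    Subtype.ext (hnd a.1 a.2 fun b hb ↦ by simpa [hΩ] using ha ⟨b, hb⟩)
  obtain ⟨κ, hκ⟩ := exists_symplectic_coordinates n Ω
    (fun a ↦ by simp [hΩ, exteriorDerivative]) hΩnd hfin
  refine ⟨?_, h.leviBracketWellDefined hne, ?_⟩
  -- Since `n ≥ 1` the hyperplane is nonzero, and nondegeneracy then yields a pair whose bracket
  -- leaves the distribution.
  · have : Nontrivial W := Module.nontrivial_of_finrank_pos (R := ℝ) (by omega)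
    obtain ⟨a, ha⟩ := exists_ne (0 : W)
    obtain ⟨b, hb⟩ : ∃ b, Ω a b ≠ 0 := by
      by_contra! hcon
      exact ha (hΩnd a hcon)
    exact h.derivedLayer_eq_top hne a.2 b.2 (fun h0 ↦ hb (by rw [hΩ, h0, neg_zero]))
  · obtain ⟨e, he, -⟩ := h.exists_isGradedLieIso hne κ fun a b ↦ by rw [← hκ, hΩ, neg_neg]
    exact ⟨e, he⟩

end Pfaff

/-! ## Darboux coordinates -/

theorem darbouxForm_apply (n : ℕ) (z b : DarbouxSpace n) :
    darbouxForm n z b = b.1 + ∑ i, z.2.2 i * b.2.1 i := by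
  simp [darbouxForm]

theorem contDiff_darbouxForm (n : ℕ) : ContDiff ℝ ∞ (darbouxForm n) := by
  refine contDiff_const.add (ContDiff.sum fun i _ ↦ ContDiff.fun_smul ?_ contDiff_const)
  exact (contDiff_apply ℝ ℝ i).comp (contDiff_snd.comp contDiff_snd)

theorem fderiv_darbouxForm (n : ℕ) (z a b : DarbouxSpace n) :
    fderiv ℝ (darbouxForm n) z a b = ∑ i, a.2.2 i * b.2.1 i := by
  have h1 := ((contDiff_darbouxForm n).differentiable (by simp) z).hasFDerivAt.clm_apply
    (hasFDerivAt_const b z)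
  let P : Fin n → DarbouxSpace n →L[ℝ] ℝ := fun i ↦
    (ContinuousLinearMap.proj (R := ℝ) (φ := fun _ : Fin n ↦ ℝ) i).comp
      ((ContinuousLinearMap.snd ℝ (Fin n → ℝ) (Fin n → ℝ)).comp
        (ContinuousLinearMap.snd ℝ ℝ ((Fin n → ℝ) × (Fin n → ℝ))))
  have h2 : HasFDerivAt (fun w : DarbouxSpace n ↦ b.1 + ∑ i, w.2.2 i * b.2.1 i)
      (∑ i, b.2.1 i • P i) z := by
    refine HasFDerivAt.const_add _ (HasFDerivAt.fun_sum fun i _ ↦ ?_)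
    exact (P i).hasFDerivAt.mul_const (b.2.1 i)
  simp_rw [darbouxForm_apply] at h1
  have h3 := congrArg (fun L : DarbouxSpace n →L[ℝ] ℝ ↦ L a) (h1.unique h2)
  simp only [ContinuousLinearMap.comp_zero, zero_add, ContinuousLinearMap.flip_apply,
    sum_apply, smul_apply] at h3
  rw [h3]
  exact Finset.sum_congr rfl fun i _ ↦ mul_comm _ _

theorem exteriorDerivative_darbouxForm (n : ℕ) (z a b : DarbouxSpace n) :
    exteriorDerivative (darbouxForm n) z a b
      = -∑ i, (a.2.1 i * b.2.2 i - a.2.2 i * b.2.1 i) := by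
  rw [exteriorDerivative, fderiv_darbouxForm, fderiv_darbouxForm, ← Finset.sum_sub_distrib,
    ← Finset.sum_neg_distrib]
  exact Finset.sum_congr rfl fun i _ ↦ by ring

section

variable {F : Type*} [NormedAddCommGroup F] [NormedSpace ℝ F] [CompleteSpace F]
  {N : Type*} [TopologicalSpace N] [ChartedSpace F N] [IsManifold 𝓘(ℝ, F) ∞ N]
  {D : (y : N) → Submodule ℝ (TangentSpace 𝓘(ℝ, F) y)} {q : N} {n : ℕ}
  {φ : OpenPartialHomeomorph N (DarbouxSpace n)}

omit [CompleteSpace F] in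
-- This reduces the statements in Darboux coordinates to the explicit form dv + ∑ p_i dx^i; neither
-- the metric nor its geodesics enter any more.
theorem IsDarbouxChart.isPfaffChart {θ : (y : N) → TangentSpace 𝓘(ℝ, F) y →L[ℝ] ℝ}
    (hθ : IsContactFormOn D θ φ.source) (hφ : IsDarbouxChart θ q φ) :
    IsPfaffChart D q φ (darbouxForm n) where
  contMDiffOn := hφ.contMDiffOn
  contMDiffOn_symm := hφ.contMDiffOn_symm
  mem_source := hφ.mem_source
  contDiffAt := Eventually.of_forall fun _ ↦ (contDiff_darbouxForm n).contDiffAt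
  mem_iff := by
    filter_upwards [φ.open_source.mem_nhds hφ.mem_source] with y hy ξ
    rw [← hθ.2.2 y hy]
    exact (hφ.form_eq y hy ξ).symm ▸ Iff.rfl

namespace IsPfaffChart

variable (h : IsPfaffChart D q φ (darbouxForm n)) (hq : φ q = 0)

omit [CompleteSpace F] in
theorem darbouxForm_zero_apply (b : DarbouxSpace n) : darbouxForm n 0 b = b.1 := by
  simp [darbouxForm_apply]

include h hq

/-- At the origin the form is dv, its kernel is the (x, p)-space, and the exterior derivative is
already in standard shape there. So projection to (x, p) serves as the symplectic coordinates. -/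
theorem exists_darboux_isGradedLieIso :
    ∃ e : OsculatingSpace D q ≃ₗ[ℝ] HeisenbergAlgebra n, IsGradedLieIso D q e ∧
      (∀ ξ : D q, e (ξ, 0) = ⟨(chartDiff φ q ξ.1).2.1, (chartDiff φ q ξ.1).2.2, 0⟩) ∧
      (∀ η : TangentSpace 𝓘(ℝ, F) q, e (0, Submodule.Quotient.mk η)
        = ⟨0, 0, (chartDiff φ q η).1⟩) ∧
      ∀ a, e (osculatingGradingDerivation D q a)
        = HeisenbergAlgebra.gradingDerivation n (e a) := by
  have hker : ∀ a : DarbouxSpace n,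
      a ∈ LinearMap.ker (darbouxForm n (φ q) : DarbouxSpace n →ₗ[ℝ] ℝ) ↔ a.1 = 0 := fun a ↦ by
    rw [hq, LinearMap.mem_ker]
    exact (darbouxForm_zero_apply a) ▸ Iff.rfl
  let κ : LinearMap.ker (darbouxForm n (φ q) : DarbouxSpace n →ₗ[ℝ] ℝ) ≃ₗ[ℝ]
      (Fin n → ℝ) × (Fin n → ℝ) :=
    { toFun := fun a ↦ a.1.2
      map_add' := fun _ _ ↦ rfl
      map_smul' := fun _ _ ↦ rfl
      invFun := fun b ↦ ⟨(0, b), (hker _).2 rfl⟩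
      left_inv := fun a ↦ Subtype.ext (Prod.ext ((hker a.1).1 a.2).symm rfl)
      right_inv := fun _ ↦ rfl }
  have hne : darbouxForm n (φ q) ≠ 0 := fun h0 ↦ by
    have := congrArg (fun L : DarbouxSpace n →L[ℝ] ℝ ↦ L (1, 0, 0)) h0
    simp [darbouxForm_apply] at this
  obtain ⟨e, he, h1, h2⟩ := h.exists_isGradedLieIso hne κ fun a b ↦
    exteriorDerivative_darbouxForm n _ _ _
  have h1' : ∀ ξ : D q, e (ξ, 0) = ⟨(chartDiff φ q ξ.1).2.1, (chartDiff φ q ξ.1).2.2, 0⟩ :=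
    fun ξ ↦ h1 ξ ⟨chartDiff φ q ξ.1, (h.mem_iff_self ξ.1).1 ξ.2⟩ rfl
  have h2' : ∀ η : TangentSpace 𝓘(ℝ, F) q, e (0, Submodule.Quotient.mk η)
      = ⟨0, 0, (chartDiff φ q η).1⟩ := fun η ↦ by
    rw [h2, hq, darbouxForm_zero_apply]
  refine ⟨e, he, h1', h2', fun a ↦ ?_⟩
  obtain ⟨ξ, η⟩ := a
  obtain ⟨η, rfl⟩ := Submodule.Quotient.mk_surjective _ η
  -- The cases c = 1 and c = 2 are the element itself and its image under the grading derivation.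
  have hsplit : ∀ c : ℝ, e (ξ, c • Submodule.Quotient.mk η)
      = ⟨(chartDiff φ q ξ.1).2.1, (chartDiff φ q ξ.1).2.2, c * (chartDiff φ q η).1⟩ := fun c ↦ by
    have : ((ξ, c • Submodule.Quotient.mk η) : OsculatingSpace D q)
        = (ξ, 0) + c • (0, Submodule.Quotient.mk η) := by simp
    rw [this, map_add, map_smul, h1', h2']
    apply HeisenbergAlgebra.ext <;> simp
  have hs1 := hsplit 1
  rw [one_smul, one_mul] at hs1
  rw [hs1]
  exact hsplit 2

/-- In the chart the field is a linear map A, so its bracket with X at the origin is A applied to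
the value of X. The map A is the identity on dv = 0 and doubles the v-direction. -/
theorem inducesOnOsculating_darbouxEuler :
    InducesOnOsculating D q (VectorField.mpullback 𝓘(ℝ, F) 𝓘(ℝ, DarbouxSpace n) φ (darbouxEuler n))
      (osculatingGradingDerivation D q) := by
  set Z := VectorField.mpullback 𝓘(ℝ, F) 𝓘(ℝ, DarbouxSpace n) φ (darbouxEuler n) with hZ
  let A : DarbouxSpace n →L[ℝ] DarbouxSpace n :=
    ((2 : ℝ) • ContinuousLinearMap.fst ℝ ℝ ((Fin n → ℝ) × (Fin n → ℝ))).prod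
      (ContinuousLinearMap.snd ℝ ℝ ((Fin n → ℝ) × (Fin n → ℝ)))
  have hA : (A : DarbouxSpace n → DarbouxSpace n) = darbouxEuler n := rfl
  have hinv := h.isInvertible_chartDiff h.mem_source
  have hZrep : chartRep φ Z =ᶠ[𝓝 (φ q)] A := by
    filter_upwards [φ.open_target.mem_nhds (φ.map_source h.mem_source)] with z hz
    exact h.chartRep_mpullback _ hz
  have hZs : ContMDiffAt 𝓘(ℝ, F) 𝓘(ℝ, F).tangent ∞
      (fun y ↦ (⟨y, Z y⟩ : TangentBundle 𝓘(ℝ, F) N)) q :=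
    h.contMDiffAt_mpullback h.mem_source (V := darbouxEuler n) A.contDiff.contDiffAt
  have key : ∀ X : (y : N) → TangentSpace 𝓘(ℝ, F) y, ContMDiffAt 𝓘(ℝ, F) 𝓘(ℝ, F).tangent ∞
      (fun y ↦ (⟨y, X y⟩ : TangentBundle 𝓘(ℝ, F) N)) q →
      chartDiff φ q (VectorField.mlieBracket 𝓘(ℝ, F) X Z q) = A (chartDiff φ q (X q)) := by
    intro X hX
    rw [h.chartDiff_mlieBracket h.mem_source hX hZs, VectorField.lieBracket,
      hZrep.fderiv_eq, hZrep.self_of_nhds, A.fderiv, hq, map_zero, map_zero, sub_zero, ← hq,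
      h.chartRep_self]
  refine ⟨?_, fun X hX hXq ↦ ?_, fun X hX ↦ ?_⟩
  · apply hinv.injective
    rw [hZ, h.chartDiff_mpullback _ h.mem_source, map_zero, ← hA, hq]
    exact map_zero A
  · have hX0 : (chartDiff φ q (X q)).1 = 0 := by
      have := (h.mem_iff_self _).1 hXq
      rwa [hq, darbouxForm_zero_apply] at this
    have hXZ : VectorField.mlieBracket 𝓘(ℝ, F) X Z q = X q := by
      apply hinv.injective
      rw [key X hX.contMDiffAt]
      exact Prod.ext (by change 2 * (chartDiff φ q (X q)).1 = _; rw [hX0, mul_zero]) rfl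
    refine ⟨hXZ.symm ▸ hXq, ?_⟩
    refine Prod.ext (Subtype.ext hXZ.symm) ?_
    exact smul_zero (2 : ℝ)
  · refine Prod.ext rfl ?_
    change (2 : ℝ) • (Submodule.Quotient.mk (X q) : TangentSpace 𝓘(ℝ, F) q ⧸ D q) = _
    rw [← Submodule.Quotient.mk_smul, Submodule.Quotient.eq, h.mem_iff_self, map_sub, map_smul,
      key X hX.contMDiffAt, hq, darbouxForm_zero_apply]
    exact sub_self _

/-- At `q` the differential dv equals the contact form, so first derivatives of v along the
distribution vanish. The section ∂_{x^i} - p_i ∂_v takes v to -p_i, which has weight exactly one, so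
v cannot have weight three. -/
theorem hasWeight_darboux (hn : 1 ≤ n) :
    (∀ i, HasWeight D q 1 (fun y ↦ (φ y).2.1 i)) ∧
    (∀ i, HasWeight D q 1 (fun y ↦ (φ y).2.2 i)) ∧
    HasWeight D q 2 (fun y ↦ (φ y).1) := by
  have hne : darbouxForm n (φ q) ≠ 0 := fun h0 ↦ by
    have := congrArg (fun L : DarbouxSpace n →L[ℝ] ℝ ↦ L (1, 0, 0)) h0
    simp [darbouxForm_apply] at this
  let u : DarbouxSpace n →L[ℝ] ℝ := ContinuousLinearMap.fst ℝ ℝ ((Fin n → ℝ) × (Fin n → ℝ))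
  let x : Fin n → DarbouxSpace n →L[ℝ] ℝ := fun i ↦
    (ContinuousLinearMap.proj (R := ℝ) (φ := fun _ : Fin n ↦ ℝ) i).comp
      ((ContinuousLinearMap.fst ℝ (Fin n → ℝ) (Fin n → ℝ)).comp
        (ContinuousLinearMap.snd ℝ ℝ ((Fin n → ℝ) × (Fin n → ℝ))))
  let p : Fin n → DarbouxSpace n →L[ℝ] ℝ := fun i ↦
    (ContinuousLinearMap.proj (R := ℝ) (φ := fun _ : Fin n ↦ ℝ) i).comp
      ((ContinuousLinearMap.snd ℝ (Fin n → ℝ) (Fin n → ℝ)).comp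
        (ContinuousLinearMap.snd ℝ ℝ ((Fin n → ℝ) × (Fin n → ℝ))))
  refine ⟨fun i ↦ ?_, fun i ↦ ?_, ⟨?_, fun X hX ↦ ⟨?_, fun _ _ ↦ trivial⟩⟩, fun hw ↦ ?_⟩
  · exact h.hasWeight_one hne (x i) (by rw [hq, map_zero]) (a := (0, Pi.single i 1, 0))
      (by rw [hq, darbouxForm_zero_apply]) (by simp [x])
  · exact h.hasWeight_one hne (p i) (by rw [hq, map_zero]) (a := (0, 0, Pi.single i 1))
      (by rw [hq, darbouxForm_zero_apply]) (by simp [p])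
  · exact congrArg Prod.fst hq
  · refine (h.eventually_mfderiv_comp u X).self_of_nhds.trans ?_
    have := (h.mem_iff_self _).1 hX.eventually_mem.self_of_nhds
    rwa [hq, darbouxForm_zero_apply] at this
  · let i : Fin n := ⟨0, hn⟩
    -- The section ∂_{x^i} - p_i ∂_v, with -p_i chosen so that the contact form vanishes on it.
    let V : (z : DarbouxSpace n) → TangentSpace 𝓘(ℝ, DarbouxSpace n) z := fun z ↦
      ((-p i z, Pi.single i 1, 0) : DarbouxSpace n)
    have hV : IsLocalSection D q
        (VectorField.mpullback 𝓘(ℝ, F) 𝓘(ℝ, DarbouxSpace n) φ V) := by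
      refine h.isLocalSection_mpullback (Eventually.of_forall fun z ↦ ?_)
        (Eventually.of_forall fun z ↦ ?_)
      · exact ((p i).contDiff.neg.prodMk contDiff_const).contDiffAt
      · have := darbouxForm_apply n z (-p i z, Pi.single i 1, 0)
        refine this.trans ?_
        simp [p, Pi.single_apply]
    have h1 := hw.2 _ hV
    have h2 : WeightAtLeast D q 2 (fun y ↦ (-p i) (φ y)) := by
      refine h1.congr ?_
      filter_upwards [h.eventually_mfderiv_comp u _, φ.open_source.mem_nhds h.mem_source]
        with y hy hys
      refine hy.trans ?_
      rw [h.chartDiff_mpullback V hys]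
      rfl
    exact (h.hasWeight_one hne (-p i) (by rw [hq, map_zero]) (a := (0, 0, Pi.single i 1))
      (by rw [hq, darbouxForm_zero_apply]) (by simp [p])).2 h2

end IsPfaffChart

end

/-! ## The geodesic spray of a metric on a vector space -/

section Spray

set_option synthInstance.maxHeartbeats 200000

variable {E : Type*} [NormedAddCommGroup E] [NormedSpace ℝ E] (G : E → E →L[ℝ] E →L[ℝ] ℝ)

local instance : NormedAddCommGroup (E →L[ℝ] E →L[ℝ] ℝ) :=
  ContinuousLinearMap.toNormedAddCommGroup

local instance : NormedSpace ℝ (E →L[ℝ] E →L[ℝ] ℝ) :=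
  ContinuousLinearMap.toNormedSpace

/-- The function `(y, u) ↦ G_y(u, u)`. -/
def metricEnergy (z : E × E) : ℝ := G z.1 z.2 z.2

/-- The Liouville form `α_{(y, u)}(ξ) = G_y(u, dπ ξ)`. -/
def liouvilleForm (z : E × E) : E × E →L[ℝ] ℝ :=
  (G z.1 z.2).comp (ContinuousLinearMap.fst ℝ E E)

/-- The Christoffel symbols of the first kind, as covectors. -/
def christoffelForm (y a b : E) : E →L[ℝ] ℝ :=
  (2⁻¹ : ℝ) • (fderiv ℝ G y a b + fderiv ℝ G y b a - ((fderiv ℝ G y).flip a).flip b)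

/-- The geodesic spray. -/
def geodesicSpray (z : E × E) : E × E :=
  (z.2, -(G z.1).inverse (christoffelForm G z.1 z.2 z.2))

variable {G}

theorem christoffelForm_apply (y a b w : E) : christoffelForm G y a b w
    = (fderiv ℝ G y a b w + fderiv ℝ G y b a w - fderiv ℝ G y w a b) / 2 := by
  simp [christoffelForm]
  ring

theorem liouvilleForm_apply (z ξ : E × E) : liouvilleForm G z ξ = G z.1 z.2 ξ.1 := rfl

theorem isInvertible_of_nondegenerate [FiniteDimensional ℝ E] {T : E →L[ℝ] E →L[ℝ] ℝ}
    (hT : ∀ a, (∀ b, T a b = 0) → a = 0) : T.IsInvertible := by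
  let S : E →ₗ[ℝ] Module.Dual ℝ E :=
    (LinearMap.toContinuousLinearMap (𝕜 := ℝ) (E := E) (F' := ℝ)).symm.toLinearMap ∘ₗ
      (T : E →ₗ[ℝ] E →L[ℝ] ℝ)
  have hS : Function.Injective S := by
    rw [← LinearMap.ker_eq_bot, LinearMap.ker_eq_bot']
    exact fun a ha ↦ hT a fun b ↦ congrArg (fun L : Module.Dual ℝ E ↦ L b) ha
  let e := (LinearMap.linearEquivOfInjective S hS Subspace.dual_finrank_eq.symm).trans
    (LinearMap.toContinuousLinearMap (𝕜 := ℝ) (E := E) (F' := ℝ))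
  exact ⟨e.toContinuousLinearEquiv, by ext a b; rfl⟩

theorem metric_geodesicSpray {z : E × E} (hz : (G z.1).IsInvertible) (w : E) :
    G z.1 (geodesicSpray G z).2 w = -christoffelForm G z.1 z.2 z.2 w := by
  rw [geodesicSpray, map_neg, hz.self_apply_inverse]
  rfl

/-- The product rule for the trilinear expression G_f(a, b), with the values of the derivative made
explicit. -/
theorem hasFDerivAt_metric_apply {X : Type*} [NormedAddCommGroup X] [NormedSpace ℝ X]
    {f a b : X → E}
    {f' a' b' : X →L[ℝ] E} {x : X} (hG : DifferentiableAt ℝ G (f x)) (hf : HasFDerivAt f f' x)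
    (ha : HasFDerivAt a a' x) (hb : HasFDerivAt b b' x) :
    ∃ L : X →L[ℝ] ℝ, HasFDerivAt (fun x ↦ G (f x) (a x) (b x)) L x ∧
      ∀ ξ, L ξ = fderiv ℝ G (f x) (f' ξ) (a x) (b x) + G (f x) (a' ξ) (b x)
        + G (f x) (a x) (b' ξ) := by
  refine ⟨_, ((hG.hasFDerivAt.comp x hf).clm_apply ha).clm_apply hb, fun ξ ↦ ?_⟩
  simp
  ring

theorem contDiffAt_metricEnergy {z : E × E} (hG : ContDiffAt ℝ ∞ G z.1) :
    ContDiffAt ℝ ∞ (metricEnergy G) z :=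
  ((hG.comp z contDiffAt_fst).clm_apply contDiffAt_snd).clm_apply contDiffAt_snd

theorem contDiffAt_liouvilleForm {z : E × E} (hG : ContDiffAt ℝ ∞ G z.1) :
    ContDiffAt ℝ ∞ (liouvilleForm G) z :=
  ((hG.comp z contDiffAt_fst).clm_apply contDiffAt_snd).clm_comp contDiffAt_const

/-- In finite dimension a basis identifies linear maps on `E` with tuples of their values. -/
theorem contDiffAt_clm_of_apply {X F : Type*} [NormedAddCommGroup X] [NormedSpace ℝ X]
    [NormedAddCommGroup F] [NormedSpace ℝ F] [FiniteDimensional ℝ E] {f : X → E →L[ℝ] F} {x : X}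
    {n : ℕ∞ω} (hf : ∀ w, ContDiffAt ℝ n (fun y ↦ f y w) x) : ContDiffAt ℝ n f x := by
  let d := Module.finrank ℝ E
  have hd : d = Module.finrank ℝ (Fin d → ℝ) := (Module.finrank_fin_fun ℝ).symm
  let e₁ := ContinuousLinearEquiv.ofFinrankEq hd
  let e₂ := (e₁.arrowCongr (1 : F ≃L[ℝ] F)).trans (ContinuousLinearEquiv.piRing (Fin d))
  rw [← Function.id_comp f, ← e₂.symm_comp_self]
  exact e₂.symm.contDiff.contDiffAt.comp x (contDiffAt_pi.2 fun i ↦ hf _)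

theorem contDiffAt_fderiv_apply {X F : Type*} [NormedAddCommGroup X] [NormedSpace ℝ X]
    [NormedAddCommGroup F] [NormedSpace ℝ F] {H : E → F} {f a : X → E} {x : X}
    (hH : ContDiffAt ℝ ∞ H (f x)) (hf : ContDiffAt ℝ ∞ f x) (ha : ContDiffAt ℝ ∞ a x) :
    ContDiffAt ℝ ∞ (fun x ↦ fderiv ℝ H (f x) (a x)) x :=
  ((hH.fderiv_right (m := ∞) (by simp)).comp x hf).clm_apply ha

theorem contDiffAt_christoffelForm [FiniteDimensional ℝ E] {z : E × E}
    (hG : ContDiffAt ℝ ∞ G z.1) :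
    ContDiffAt ℝ ∞ (fun z : E × E ↦ christoffelForm G z.1 z.2 z.2) z := by
  refine contDiffAt_clm_of_apply fun w ↦ ?_
  simp only [christoffelForm_apply]
  have key : ∀ {a b c : E × E → E}, ContDiffAt ℝ ∞ a z → ContDiffAt ℝ ∞ b z →
      ContDiffAt ℝ ∞ c z → ContDiffAt ℝ ∞ (fun z ↦ fderiv ℝ G z.1 (a z) (b z) (c z)) z :=
    fun ha hb hc ↦
      ((contDiffAt_fderiv_apply hG contDiffAt_fst ha).clm_apply hb).clm_apply hc
  exact (((key contDiffAt_snd contDiffAt_snd contDiffAt_const).add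
    (key contDiffAt_snd contDiffAt_snd contDiffAt_const)).sub
    (key contDiffAt_const contDiffAt_snd contDiffAt_snd)).div_const _

theorem contDiffAt_geodesicSpray [FiniteDimensional ℝ E] {z : E × E} (hG : ContDiffAt ℝ ∞ G z.1)
    (hz : (G z.1).IsInvertible) : ContDiffAt ℝ ∞ (geodesicSpray G) z := by
  have : CompleteSpace E := FiniteDimensional.complete ℝ E
  refine contDiffAt_snd.prodMk (ContDiffAt.neg (ContDiffAt.clm_apply ?_
    (contDiffAt_christoffelForm hG)))
  exact hz.contDiffAt_map_inverse.comp z (hG.comp z contDiffAt_fst)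

theorem fderiv_metricEnergy (hsymm : ∀ y a b, G y a b = G y b a) {z : E × E}
    (hG : DifferentiableAt ℝ G z.1) (ξ : E × E) :
    fderiv ℝ (metricEnergy G) z ξ = fderiv ℝ G z.1 ξ.1 z.2 z.2 + 2 * G z.1 z.2 ξ.2 := by
  obtain ⟨L, hL, hL'⟩ := hasFDerivAt_metric_apply (f := Prod.fst) hG (hasFDerivAt_fst (p := z))
    hasFDerivAt_snd hasFDerivAt_snd
  have : HasFDerivAt (metricEnergy G) L z := hL
  rw [this.fderiv, hL', hsymm _ _ z.2]
  simp
  ring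

theorem fderiv_liouvilleForm {z : E × E} (hG : ContDiffAt ℝ ∞ G z.1) (ξ η : E × E) :
    fderiv ℝ (liouvilleForm G) z ξ η = fderiv ℝ G z.1 ξ.1 z.2 η.1 + G z.1 ξ.2 η.1 := by
  obtain ⟨L, hL, hL'⟩ := hasFDerivAt_metric_apply (f := Prod.fst)
    (hG.differentiableAt (by simp)) (hasFDerivAt_fst (p := z))
    hasFDerivAt_snd (hasFDerivAt_const η.1 z)
  have h1 := ((contDiffAt_liouvilleForm hG).differentiableAt (by simp)).hasFDerivAt.clm_apply
    (hasFDerivAt_const η z)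
  have h2 := congrArg (fun L : E × E →L[ℝ] ℝ ↦ L ξ) (h1.unique hL)
  simp [hL'] at h2
  exact h2

/-- Conservation of energy, infinitesimally: on the diagonal Γ(u, u; u) is half of the derivative of
G(u, u) along u, which cancels the change of the metric. -/
theorem fderiv_metricEnergy_geodesicSpray (hsymm : ∀ y a b, G y a b = G y b a) {z : E × E}
    (hG : DifferentiableAt ℝ G z.1) (hz : (G z.1).IsInvertible) :
    fderiv ℝ (metricEnergy G) z (geodesicSpray G z) = 0 := by
  rw [fderiv_metricEnergy hsymm hG, hsymm, metric_geodesicSpray hz, christoffelForm_apply]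
  simp only [geodesicSpray]
  ring

theorem exteriorDerivative_liouvilleForm {z : E × E} (hG : ContDiffAt ℝ ∞ G z.1) (ξ η : E × E) :
    exteriorDerivative (liouvilleForm G) z ξ η = fderiv ℝ G z.1 ξ.1 z.2 η.1 + G z.1 ξ.2 η.1
      - (fderiv ℝ G z.1 η.1 z.2 ξ.1 + G z.1 η.2 ξ.1) := by
  rw [exteriorDerivative, fderiv_liouvilleForm hG, fderiv_liouvilleForm hG]

/-- Hamilton's equations: the spray is the Hamiltonian field of half the energy for the symplectic
form dα. -/
theorem exteriorDerivative_geodesicSpray (hsymm : ∀ y a b, G y a b = G y b a) {z : E × E}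
    (hG : ContDiffAt ℝ ∞ G z.1) (hz : (G z.1).IsInvertible) (η : E × E) :
    exteriorDerivative (liouvilleForm G) z (geodesicSpray G z) η
      = -(fderiv ℝ (metricEnergy G) z η) / 2 := by
  have hd := hG.differentiableAt (by simp)
  rw [exteriorDerivative_liouvilleForm hG, fderiv_metricEnergy hsymm hd, metric_geodesicSpray hz,
    christoffelForm_apply, hsymm _ η.2]
  simp only [geodesicSpray]
  ring

/-- The Liouville form is linear in the fibre variable and vanishes on vertical vectors, so
contracting dα with the Euler field returns α. -/
theorem exteriorDerivative_euler {z : E × E} (hG : ContDiffAt ℝ ∞ G z.1) (η : E × E) :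
    exteriorDerivative (liouvilleForm G) z (0, z.2) η = liouvilleForm G z η := by
  rw [exteriorDerivative_liouvilleForm hG, liouvilleForm_apply]
  simp

/-- The differential of α is symplectic: vertical test vectors detect the horizontal part of ξ, and
then horizontal ones detect the vertical part. -/
theorem eq_zero_of_exteriorDerivative_eq_zero (hsymm : ∀ y a b, G y a b = G y b a) {z : E × E}
    (hG : ContDiffAt ℝ ∞ G z.1) (hnd : ∀ a, (∀ b, G z.1 a b = 0) → a = 0) {ξ : E × E}
    (hξ : ∀ η, exteriorDerivative (liouvilleForm G) z ξ η = 0) : ξ = 0 := by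
  simp only [exteriorDerivative_liouvilleForm hG] at hξ
  have h1 : ξ.1 = 0 := hnd _ fun b ↦ by
    have := hξ (0, b)
    simp only [map_zero, zero_apply, add_zero, zero_add, zero_sub, neg_eq_zero] at this
    rw [hsymm, this]
  refine Prod.ext h1 (hnd _ fun b ↦ ?_)
  have := hξ (b, 0)
  simpa [h1] using this

/-- The Lie derivative of the Liouville form along the spray is half the differential of the
energy. -/
theorem lieDerivative_liouvilleForm [FiniteDimensional ℝ E] (hsymm : ∀ y a b, G y a b = G y b a)
    {z : E × E} (hG : ContDiffAt ℝ ∞ G z.1) (hz : (G z.1).IsInvertible) (ξ : E × E) :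
    fderiv ℝ (liouvilleForm G) z (geodesicSpray G z) ξ
      + liouvilleForm G z (fderiv ℝ (geodesicSpray G) z ξ)
      = fderiv ℝ (metricEnergy G) z ξ / 2 := by
  have h1 := ((contDiffAt_liouvilleForm hG).differentiableAt (by simp)).hasFDerivAt.clm_apply
    ((contDiffAt_geodesicSpray hG hz).differentiableAt (by simp)).hasFDerivAt
  -- Here α(X) = E, so Cartan's formula L_X α = d(α(X)) + ι_X dα gives dE - dE/2.
  have h2 : HasFDerivAt (fun z ↦ liouvilleForm G z (geodesicSpray G z))
      (fderiv ℝ (metricEnergy G) z) z :=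
    ((contDiffAt_metricEnergy hG).differentiableAt (by simp)).hasFDerivAt
  have h3 := congrArg (fun L : E × E →L[ℝ] ℝ ↦ L ξ) (h1.unique h2)
  simp at h3
  have h4 := exteriorDerivative_geodesicSpray hsymm hG hz ξ
  rw [exteriorDerivative] at h4
  linarith

end Spray

/-! ## The space of null geodesics in a chart -/

section NullModel

variable {E : Type*} [NormedAddCommGroup E] [NormedSpace ℝ E]
  {B : Type*} [NormedAddCommGroup B] [NormedSpace ℝ B]

local instance : NormedAddCommGroup (E →L[ℝ] E →L[ℝ] ℝ) :=
  ContinuousLinearMap.toNormedAddCommGroup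

local instance : NormedSpace ℝ (E →L[ℝ] E →L[ℝ] ℝ) :=
  ContinuousLinearMap.toNormedSpace

/-- This converts a submersion of the hypersurface f = 0 into a submersion of (f, A) on the ambient
space, which is an open condition. -/
theorem surjective_prod_of_ker {X Y : Type*} [NormedAddCommGroup X] [NormedSpace ℝ X]
    [NormedAddCommGroup Y] [NormedSpace ℝ Y] {f : X →L[ℝ] ℝ} {A : X →L[ℝ] Y} {x : X}
    (hx : f x ≠ 0) (h : ∀ η, ∃ ξ, f ξ = 0 ∧ A ξ = η) : Function.Surjective (f.prod A) := by
  rintro ⟨r, η⟩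
  obtain ⟨ξ, hξ, hξ'⟩ := h (η - A ((r / f x) • x))
  exact ⟨(r / f x) • x + ξ, Prod.ext (by simp [hξ, hx]) (by simp [hξ'])⟩

/-- On the open set `W` of tangent vectors, the map `p` is a submersion of the null cone of `G` onto
the space of null geodesics. -/
structure IsNullModel (G : E → E →L[ℝ] E →L[ℝ] ℝ) (p : E × E → B) (W : Set (E × E)) : Prop where
  isOpen : IsOpen W
  symm : ∀ y a b, G y a b = G y b a
  contDiffAt_metric : ∀ z ∈ W, ContDiffAt ℝ ∞ G z.1
  nondegenerate : ∀ z ∈ W, ∀ a, (∀ b, G z.1 a b = 0) → a = 0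
  ne_zero : ∀ z ∈ W, z.2 ≠ 0
  contDiffAt : ∀ z ∈ W, ContDiffAt ℝ ∞ p z
  surjective : ∀ z ∈ W, metricEnergy G z = 0 → ∀ η, ∃ ξ,
    fderiv ℝ (metricEnergy G) z ξ = 0 ∧ fderiv ℝ p z ξ = η
  spray : ∀ z ∈ W, metricEnergy G z = 0 → fderiv ℝ p z (geodesicSpray G z) = 0
  euler : ∀ z ∈ W, metricEnergy G z = 0 → fderiv ℝ p z (0, z.2) = 0
  finrank : Module.finrank ℝ B + 3 = 2 * Module.finrank ℝ E

/-- The velocities of the abreast variations of the null vector `z`. -/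
def abreastVelocities (G : E → E →L[ℝ] E →L[ℝ] ℝ) (p : E × E → B) (z : E × E) : Set B :=
  {η | ∃ ξ, fderiv ℝ (metricEnergy G) z ξ = 0 ∧ liouvilleForm G z ξ = 0 ∧ fderiv ℝ p z ξ = η}

namespace IsNullModel

variable {G : E → E →L[ℝ] E →L[ℝ] ℝ} {p : E × E → B} {W : Set (E × E)}
  (h : IsNullModel G p W) {z : E × E}
include h

theorem isInvertible [FiniteDimensional ℝ E] (hz : z ∈ W) : (G z.1).IsInvertible :=
  isInvertible_of_nondegenerate (h.nondegenerate z hz)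

theorem fderiv_energy (hz : z ∈ W) (ξ : E × E) :
    fderiv ℝ (metricEnergy G) z ξ = fderiv ℝ G z.1 ξ.1 z.2 z.2 + 2 * G z.1 z.2 ξ.2 :=
  fderiv_metricEnergy h.symm ((h.contDiffAt_metric z hz).differentiableAt (by simp)) ξ

theorem exists_metric_ne_zero (hz : z ∈ W) : ∃ w, G z.1 z.2 w ≠ 0 := by
  by_contra! hcon
  exact h.ne_zero z hz (h.nondegenerate z hz _ hcon)

theorem prod_surjective (hz : z ∈ W) (h0 : metricEnergy G z = 0) :
    Function.Surjective ((fderiv ℝ (metricEnergy G) z).prod (fderiv ℝ p z)) := by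
  obtain ⟨w, hw⟩ := h.exists_metric_ne_zero hz
  refine surjective_prod_of_ker (x := (0, w)) ?_ (h.surjective z hz h0)
  rw [h.fderiv_energy hz]
  simpa using hw

/-- The fibre directions inside the cone form a plane by a dimension count. The spray and the Euler
field lie in it and are independent because the null vector is nonzero. -/
theorem exists_eq_of_fderiv_eq_zero [FiniteDimensional ℝ E] [FiniteDimensional ℝ B] (hz : z ∈ W)
    (h0 : metricEnergy G z = 0) {ξ : E × E} (h1 : fderiv ℝ (metricEnergy G) z ξ = 0)
    (h2 : fderiv ℝ p z ξ = 0) : ∃ s t : ℝ, s • geodesicSpray G z + t • (0, z.2) = ξ := by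
  let T : E × E →ₗ[ℝ] ℝ × B :=
    ((fderiv ℝ (metricEnergy G) z).prod (fderiv ℝ p z)).toLinearMap
  have hT : ∀ ξ, ξ ∈ LinearMap.ker T ↔
      fderiv ℝ (metricEnergy G) z ξ = 0 ∧ fderiv ℝ p z ξ = 0 := fun ξ ↦ by
    rw [LinearMap.mem_ker]
    exact Prod.ext_iff
  -- The dimension is 2 dim E - (1 + dim B), which is 2 because dim B + 3 = 2 dim E.
  have hdim : Module.finrank ℝ (LinearMap.ker T) = 2 := by
    have h3 := T.finrank_range_add_finrank_ker
    rw [LinearMap.range_eq_top.2 (h.prod_surjective hz h0), finrank_top, Module.finrank_prod,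
      Module.finrank_prod, Module.finrank_self] at h3
    have := h.finrank
    omega
  have hli : LinearIndependent ℝ ![geodesicSpray G z, (0, z.2)] := by
    rw [LinearIndependent.pair_iff]
    intro s t hst
    have h4 : s • z.2 = 0 := by simpa [geodesicSpray] using congrArg Prod.fst hst
    have hs : s = 0 := (smul_eq_zero.1 h4).resolve_right (h.ne_zero z hz)
    have h5 : t • z.2 = 0 := by simpa [hs] using congrArg Prod.snd hst
    exact ⟨hs, (smul_eq_zero.1 h5).resolve_right (h.ne_zero z hz)⟩
  have hspan := finrank_span_eq_card hli
  have hrange : Set.range ![geodesicSpray G z, (0, z.2)] = {geodesicSpray G z, (0, z.2)} := by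
    ext x
    simp [or_comm]
  rw [hrange, Fintype.card_fin] at hspan
  have hle : Submodule.span ℝ {geodesicSpray G z, (0, z.2)} ≤ LinearMap.ker T := by
    rw [Submodule.span_le]
    rintro x (rfl | rfl)
    · exact (hT _).2 ⟨fderiv_metricEnergy_geodesicSpray h.symm
        ((h.contDiffAt_metric z hz).differentiableAt (by simp)) (h.isInvertible hz),
        h.spray z hz h0⟩
    · refine (hT _).2 ⟨?_, h.euler z hz h0⟩
      rw [h.fderiv_energy hz]
      have : G z.1 z.2 z.2 = 0 := h0
      simp [this]
  have heq := Submodule.eq_of_le_of_finrank_eq hle (hspan.trans hdim.symm)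
  exact Submodule.mem_span_pair.1 (heq ▸ (hT ξ).2 ⟨h1, h2⟩)

/-- On the spray α takes the value E = 0, and on the vertical Euler field it vanishes. So α of a
vector tangent to the cone depends only on the projection of that vector. -/
theorem liouvilleForm_eq_zero [FiniteDimensional ℝ E] [FiniteDimensional ℝ B] (hz : z ∈ W)
    (h0 : metricEnergy G z = 0) {ξ : E × E} (h1 : fderiv ℝ (metricEnergy G) z ξ = 0)
    (h2 : fderiv ℝ p z ξ = 0) : liouvilleForm G z ξ = 0 := by
  obtain ⟨s, t, rfl⟩ := h.exists_eq_of_fderiv_eq_zero hz h0 h1 h2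
  have : G z.1 z.2 z.2 = 0 := h0
  simp [liouvilleForm_apply, geodesicSpray, this]

omit h in
/-- A continuous linear right inverse of a surjection of finite-dimensional spaces. -/
theorem _root_.ContinuousLinearMap.exists_comp_eq_id {X Y : Type*} [NormedAddCommGroup X]
    [NormedSpace ℝ X] [NormedAddCommGroup Y] [NormedSpace ℝ Y] [FiniteDimensional ℝ Y]
    (A : X →L[ℝ] Y) (hA : Function.Surjective A) :
    ∃ R : Y →L[ℝ] X, A.comp R = ContinuousLinearMap.id ℝ Y := by
  obtain ⟨R, hR⟩ := A.toLinearMap.exists_rightInverse_of_surjective (LinearMap.range_eq_top.2 hA)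
  exact ⟨LinearMap.toContinuousLinearMap R, by
    ext y
    exact congrArg (fun L : Y →ₗ[ℝ] Y ↦ L y) hR⟩

omit h in
/-- A submersion has a smooth local section. -/
theorem _root_.exists_local_section {X Y : Type*} [NormedAddCommGroup X] [NormedSpace ℝ X]
    [NormedAddCommGroup Y] [NormedSpace ℝ Y] [FiniteDimensional ℝ Y] {f : X → Y} {x : X}
    (hf : ∀ᶠ w in 𝓝 x, ContDiffAt ℝ ∞ f w) (hs : Function.Surjective (fderiv ℝ f x)) :
    ∃ s : Y → X, s (f x) = x ∧ ∀ᶠ y in 𝓝 (f x), ContDiffAt ℝ ∞ s y ∧ f (s y) = y := by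
  have : CompleteSpace Y := FiniteDimensional.complete ℝ Y
  obtain ⟨R, hR⟩ := (fderiv ℝ f x).exists_comp_eq_id hs
  -- An affine slice through x in the direction of a right inverse of the differential: `f ∘ i` has
  -- identity derivative at `f x`, and the inverse function theorem applies.
  let i : Y → X := fun y ↦ x + R (y - f x)
  have hi : ContDiff ℝ ∞ i := contDiff_const.add (R.contDiff.comp (contDiff_id.sub contDiff_const))
  have hix : i (f x) = x := by simp [i]
  have hid : HasFDerivAt i R (f x) := by
    have h1 : i = fun y ↦ (x - R (f x)) + R y := by
      funext y
      simp only [i, map_sub]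
      abel
    rw [h1]
    exact R.hasFDerivAt.const_add _
  have hfi : ∀ᶠ y in 𝓝 (f x), ContDiffAt ℝ ∞ (f ∘ i) y := by
    have ht : Tendsto i (𝓝 (f x)) (𝓝 x) := by
      simpa [hix] using (hi.continuous.tendsto (f x))
    filter_upwards [ht.eventually hf] with y hy using hy.comp y hi.contDiffAt
  have hder : HasFDerivAt (f ∘ i) ((ContinuousLinearEquiv.refl ℝ Y : Y ≃L[ℝ] Y) : Y →L[ℝ] Y)
      (f x) := by
    have h1 : HasFDerivAt f (fderiv ℝ f x) (i (f x)) := by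
      rw [hix]
      exact (hf.self_of_nhds.differentiableAt (by simp)).hasFDerivAt
    have h2 := h1.comp (f x) hid
    rw [hR] at h2
    exact h2
  have hne : (∞ : ℕ∞ω) ≠ 0 := by simp
  let e := hfi.self_of_nhds.toOpenPartialHomeomorph (f ∘ i) hder hne
  have he : ∀ y, e y = f (i y) := fun y ↦ rfl
  have hsrc : f x ∈ e.source := hfi.self_of_nhds.mem_toOpenPartialHomeomorph_source hder hne
  have hex : e (f x) = f x := by rw [he, hix]
  have htgt : f x ∈ e.target := hex ▸ e.map_source hsrc
  have hsx : e.symm (f x) = f x := by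
    have := e.left_inv hsrc
    rwa [hex] at this
  have htend : Tendsto e.symm (𝓝 (f x)) (𝓝 (f x)) := by
    simpa [ContinuousAt, hsx] using e.continuousAt_symm htgt
  -- The derivative stays invertible nearby, so the local inverse is smooth on a neighbourhood and
  -- not only at the centre.
  have hinv : ∀ᶠ y in 𝓝 (f x), ∃ A : Y ≃L[ℝ] Y, (A : Y →L[ℝ] Y) = fderiv ℝ (f ∘ i) y := by
    have hc : ContinuousAt (fderiv ℝ (f ∘ i)) (f x) :=
      (hfi.self_of_nhds.fderiv_right (m := ∞) (by simp)).continuousAt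
    have h3 := (ContinuousLinearEquiv.refl ℝ Y).nhds
    rw [← hder.fderiv] at h3
    exact hc.eventually h3
  refine ⟨fun y ↦ i (e.symm y), by
    change i (e.symm (f x)) = x
    rw [hsx, hix], ?_⟩
  filter_upwards [htend.eventually hfi, htend.eventually hinv, e.open_target.mem_nhds htgt]
    with y hy1 hy2 hy3
  obtain ⟨A, hA⟩ := hy2
  refine ⟨hi.contDiffAt.comp y (e.contDiffAt_symm hy3 (f₀' := A) ?_ hy1), e.right_inv hy3⟩
  rw [hA]
  exact (hy1.differentiableAt (by simp)).hasFDerivAt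

/-- The projection of the null cone to the space of null geodesics has smooth local sections. -/
theorem exists_section [FiniteDimensional ℝ B] (hz : z ∈ W) (h0 : metricEnergy G z = 0) :
    ∃ s : B → E × E, s (p z) = z ∧ ∀ᶠ b in 𝓝 (p z), ContDiffAt ℝ ∞ s b ∧ s b ∈ W ∧
      metricEnergy G (s b) = 0 ∧ p (s b) = b := by
  have hf : ∀ᶠ w in 𝓝 z, ContDiffAt ℝ ∞ (fun w ↦ (metricEnergy G w, p w)) w := by
    filter_upwards [h.isOpen.mem_nhds hz] with w hw
    exact (contDiffAt_metricEnergy (h.contDiffAt_metric w hw)).prodMk (h.contDiffAt w hw)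
  have hd := (((contDiffAt_metricEnergy (h.contDiffAt_metric z hz)).differentiableAt
    (by simp)).hasFDerivAt.prodMk ((h.contDiffAt z hz).differentiableAt (by simp)).hasFDerivAt)
  -- A section of the pair (E, p), restricted to the slice E = 0, takes values in the null cone.
  obtain ⟨s, hs, hs'⟩ := exists_local_section hf
    (by rw [hd.fderiv]; exact h.prod_surjective hz h0)
  rw [h0] at hs hs'
  have hsub : Tendsto (fun b : B ↦ ((0 : ℝ), b)) (𝓝 (p z)) (𝓝 (0, p z)) :=
    (Continuous.prodMk_right (0 : ℝ)).tendsto _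
  refine ⟨fun b ↦ s (0, b), hs, ?_⟩
  have hc : ContinuousAt s (0, p z) := hs'.self_of_nhds.1.continuousAt
  rw [ContinuousAt, hs] at hc
  filter_upwards [hsub.eventually hs', hsub.eventually (hc.eventually (h.isOpen.mem_nhds hz))]
    with b hb hb'
  refine ⟨hb.1.comp b (contDiffAt_const.prodMk contDiffAt_id), hb', ?_, ?_⟩
  · exact congrArg Prod.fst hb.2
  · exact congrArg Prod.snd hb.2

end IsNullModel

end NullModel

/-! ### Calculus along hypersurfaces and commutators. -/

section Flat

variable {X Y : Type*} [NormedAddCommGroup X] [NormedSpace ℝ X]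
  [NormedAddCommGroup Y] [NormedSpace ℝ Y]

theorem minSmoothness_two_le_infty : minSmoothness ℝ 2 ≤ ∞ := by
  rw [minSmoothness_of_isRCLikeNormedField]
  exact WithTop.coe_le_coe.2 le_top

theorem fderiv_eq_zero_of_eventually_eq_const {k : X → Y} {z : X} {y : Y}
    (hk : ∀ᶠ w in 𝓝 z, k w = y) : fderiv ℝ k z = 0 := by
  rw [Filter.EventuallyEq.fderiv_eq (f₁ := k) (f := fun _ ↦ y) hk]
  simp

/-- The derivative of `f` along the commutator of two vector fields. -/
theorem fderiv_apply_commutator {f : X → Y} {V Z : X → X} {w : X} (hf : ContDiffAt ℝ ∞ f w)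
    (hV : DifferentiableAt ℝ V w) (hZ : DifferentiableAt ℝ Z w) :
    fderiv ℝ f w (fderiv ℝ V w (Z w) - fderiv ℝ Z w (V w))
      = fderiv ℝ (fun w ↦ fderiv ℝ f w (V w)) w (Z w)
        - fderiv ℝ (fun w ↦ fderiv ℝ f w (Z w)) w (V w) := by
  have hd : DifferentiableAt ℝ (fderiv ℝ f) w :=
    (hf.fderiv_right (m := ∞) (by simp)).differentiableAt (by simp)
  have hs := hf.isSymmSndFDerivAt minSmoothness_two_le_infty (Z w) (V w)
  rw [(hd.hasFDerivAt.clm_apply hV.hasFDerivAt).fderiv,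
    (hd.hasFDerivAt.clm_apply hZ.hasFDerivAt).fderiv]
  simp [hs]

/-- The derivative of a map that vanishes on a hypersurface vanishes on its tangent space. -/
theorem fderiv_eq_zero_of_eq_zero_on {f : X → ℝ} {k : X → Y} {z ξ : X} [CompleteSpace X]
    (hf : ContDiffAt ℝ ∞ f z) (hk : ContDiffAt ℝ ∞ k z) (h0 : f z = 0)
    (hne : fderiv ℝ f z ≠ 0) (hz : ∀ᶠ w in 𝓝 z, f w = 0 → k w = 0)
    (hξ : fderiv ℝ f z ξ = 0) : fderiv ℝ k z ξ = 0 := by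
  refine SeparatingDual.eq_zero_of_forall_dual_eq_zero (R := ℝ) fun ℓ ↦ ?_
  -- Each scalar component of k is constant on the hypersurface, so z is a constrained extremum. The
  -- Lagrange multiplier rule makes its differential a multiple of that of f.
  have hext : IsLocalExtrOn (fun w ↦ ℓ (k w)) {w | f w = f z} z := by
    left
    filter_upwards [mem_nhdsWithin_of_mem_nhds hz, self_mem_nhdsWithin] with w hw hw'
    rw [hw (hw'.trans h0), hz.self_of_nhds h0]
  have hk' : HasStrictFDerivAt (fun w ↦ ℓ (k w)) (ℓ.comp (fderiv ℝ k z)) z :=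
    ℓ.hasStrictFDerivAt.comp z (hk.hasStrictFDerivAt (by simp))
  obtain ⟨a, b, hab, h1⟩ := hext.exists_multipliers_of_hasStrictFDerivAt_1d
    (hf.hasStrictFDerivAt (by simp)) hk'
  have hb : b ≠ 0 := by
    rintro rfl
    have ha : a ≠ 0 := by
      rintro rfl
      exact hab rfl
    exact hne ((smul_eq_zero.1 (by simpa using h1)).resolve_left ha)
  have h2 := congrArg (fun L : X →L[ℝ] ℝ ↦ L ξ) h1
  simpa [hξ, hb] using h2

end Flat

/-! ### The contact form on the space of null geodesics and the geodesic flow. -/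

section NullModel

variable {E : Type*} [NormedAddCommGroup E] [NormedSpace ℝ E]
  {B : Type*} [NormedAddCommGroup B] [NormedSpace ℝ B]

local instance : NormedAddCommGroup (E →L[ℝ] E →L[ℝ] ℝ) :=
  ContinuousLinearMap.toNormedAddCommGroup

local instance : NormedSpace ℝ (E →L[ℝ] E →L[ℝ] ℝ) :=
  ContinuousLinearMap.toNormedSpace

/-- The pullback of the Liouville form under a section. -/
def pulledBackForm (G : E → E →L[ℝ] E →L[ℝ] ℝ) (s : B → E × E) (b : B) : B →L[ℝ] ℝ :=
  (liouvilleForm G (s b)).comp (fderiv ℝ s b)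

theorem contDiffAt_pulledBackForm {G : E → E →L[ℝ] E →L[ℝ] ℝ} {s : B → E × E} {b : B}
    (hG : ContDiffAt ℝ ∞ G (s b).1) (hs : ContDiffAt ℝ ∞ s b) :
    ContDiffAt ℝ ∞ (pulledBackForm G s) b :=
  ((contDiffAt_liouvilleForm hG).comp b hs).clm_comp (hs.fderiv_right (by simp))

/-- Pullback commutes with d: the terms with the second derivative of `s` cancel by symmetry. -/
theorem exteriorDerivative_pulledBackForm {G : E → E →L[ℝ] E →L[ℝ] ℝ} {s : B → E × E} {b : B}
    (hG : ContDiffAt ℝ ∞ G (s b).1) (hs : ContDiffAt ℝ ∞ s b) (η η' : B) :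
    exteriorDerivative (pulledBackForm G s) b η η'
      = exteriorDerivative (liouvilleForm G) (s b) (fderiv ℝ s b η) (fderiv ℝ s b η') := by
  have hd : DifferentiableAt ℝ (fderiv ℝ s) b :=
    (hs.fderiv_right (m := ∞) (by simp)).differentiableAt (by simp)
  have hα := ((contDiffAt_liouvilleForm hG).differentiableAt (by simp)).hasFDerivAt.comp b
    (hs.differentiableAt (by simp)).hasFDerivAt
  have h1 : ∀ η η', fderiv ℝ (pulledBackForm G s) b η η'
      = fderiv ℝ (liouvilleForm G) (s b) (fderiv ℝ s b η) (fderiv ℝ s b η')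
        + liouvilleForm G (s b) (fderiv ℝ (fderiv ℝ s) b η η') := by
    intro η η'
    have h2 := hα.clm_apply (hd.hasFDerivAt.clm_apply (hasFDerivAt_const η' b))
    have h3 := (((contDiffAt_pulledBackForm hG hs).differentiableAt
      (by simp)).hasFDerivAt.clm_apply (hasFDerivAt_const η' b))
    have h4 := congrArg (fun L : B →L[ℝ] ℝ ↦ L η) (h3.unique h2)
    simp at h4
    rw [h4]
    ring
  have hsymm := hs.isSymmSndFDerivAt minSmoothness_two_le_infty η η'
  rw [exteriorDerivative, h1, h1, hsymm, exteriorDerivative]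
  ring

namespace IsNullModel

variable {G : E → E →L[ℝ] E →L[ℝ] ℝ} {p : E × E → B} {W : Set (E × E)}
  (h : IsNullModel G p W) {z : E × E}
include h

/-- Two lifts of one vector differ by a fibre direction, on which α vanishes; so abreastness may be
tested on any lift. -/
theorem mem_abreastVelocities_iff [FiniteDimensional ℝ E] [FiniteDimensional ℝ B] (hz : z ∈ W)
    (h0 : metricEnergy G z = 0) {ξ : E × E} (hξ : fderiv ℝ (metricEnergy G) z ξ = 0) :
    fderiv ℝ p z ξ ∈ abreastVelocities G p z ↔ liouvilleForm G z ξ = 0 := by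
  refine ⟨fun ⟨ξ', h1, h2, h3⟩ ↦ ?_, fun h1 ↦ ⟨ξ, hξ, h1, rfl⟩⟩
  have h4 := h.liouvilleForm_eq_zero hz h0 (ξ := ξ - ξ') (by rw [map_sub, hξ, h1, sub_zero])
    (by rw [map_sub, h3, sub_self])
  rwa [map_sub, h2, sub_zero] at h4

theorem exists_liouvilleForm_ne_zero (hz : z ∈ W) :
    ∃ ξ, fderiv ℝ (metricEnergy G) z ξ = 0 ∧ liouvilleForm G z ξ ≠ 0 := by
  obtain ⟨a, ha⟩ := h.exists_metric_ne_zero hz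
  -- The vertical part solves dE = 0 and does not affect α, whose value is G(u, a) ≠ 0.
  refine ⟨(a, (-fderiv ℝ G z.1 a z.2 z.2 / (2 * G z.1 z.2 a)) • a), ?_, ha⟩
  rw [h.fderiv_energy hz]
  simp
  field_simp
  ring

theorem contDiffAt_energy (hz : z ∈ W) : ContDiffAt ℝ ∞ (metricEnergy G) z :=
  contDiffAt_metricEnergy (h.contDiffAt_metric z hz)

theorem contDiffAt_spray [FiniteDimensional ℝ E] (hz : z ∈ W) :
    ContDiffAt ℝ ∞ (geodesicSpray G) z :=
  contDiffAt_geodesicSpray (h.contDiffAt_metric z hz) (h.isInvertible hz)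

omit h in
theorem _root_.fderiv_of_section {s : B → E × E} {b : B}
    (hs : ∀ᶠ b in 𝓝 b, ContDiffAt ℝ ∞ s b ∧ s b ∈ W ∧ metricEnergy G (s b) = 0 ∧ p (s b) = b)
    (hE : ContDiffAt ℝ ∞ (metricEnergy G) (s b)) (hp : ContDiffAt ℝ ∞ p (s b)) (η : B) :
    fderiv ℝ (metricEnergy G) (s b) (fderiv ℝ s b η) = 0 ∧
      fderiv ℝ p (s b) (fderiv ℝ s b η) = η := by
  have hd := (hs.self_of_nhds.1.differentiableAt (by simp)).hasFDerivAt
  constructor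
  · have h1 := (hE.differentiableAt (by simp)).hasFDerivAt.comp b hd
    have h2 : HasFDerivAt (metricEnergy G ∘ s) (0 : B →L[ℝ] ℝ) b :=
      (hasFDerivAt_const (0 : ℝ) b).congr_of_eventuallyEq (hs.mono fun b hb ↦ hb.2.2.1)
    exact congrArg (fun L : B →L[ℝ] ℝ ↦ L η) (h1.unique h2)
  · have h1 := (hp.differentiableAt (by simp)).hasFDerivAt.comp b hd
    have h2 : HasFDerivAt (p ∘ s) (ContinuousLinearMap.id ℝ B) b :=
      (hasFDerivAt_id b).congr_of_eventuallyEq (hs.mono fun b hb ↦ hb.2.2.2)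
    exact congrArg (fun L : B →L[ℝ] B ↦ L η) (h1.unique h2)

/-- The pullback of the Liouville form under a section of the null cone is a contact form. -/
theorem pulledBackForm_spec [FiniteDimensional ℝ E] [FiniteDimensional ℝ B]
    {s : B → E × E} {b : B}
    (hs : ∀ᶠ b in 𝓝 b, ContDiffAt ℝ ∞ s b ∧ s b ∈ W ∧ metricEnergy G (s b) = 0 ∧ p (s b) = b) :
    ContDiffAt ℝ ∞ (pulledBackForm G s) b ∧
      (∀ η, pulledBackForm G s b η = 0 ↔ η ∈ abreastVelocities G p (s b)) ∧
      pulledBackForm G s b ≠ 0 ∧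
      ∀ η, pulledBackForm G s b η = 0 →
        (∀ η', pulledBackForm G s b η' = 0 →
          exteriorDerivative (pulledBackForm G s) b η η' = 0) → η = 0 := by
  obtain ⟨hsd, hsW, hs0, -⟩ := hs.self_of_nhds
  have hG := h.contDiffAt_metric _ hsW
  have hds := fderiv_of_section hs (h.contDiffAt_energy hsW) (h.contDiffAt _ hsW)
  have hiff : ∀ η, pulledBackForm G s b η = 0 ↔ η ∈ abreastVelocities G p (s b) := by
    intro η
    have h1 := h.mem_abreastVelocities_iff hsW hs0 (hds η).1
    rw [(hds η).2] at h1
    exact h1.symm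
  -- A vector tangent to the cone differs from the lift of its projection by a fibre direction.
  have hproj : ∀ ξ, fderiv ℝ (metricEnergy G) (s b) ξ = 0 →
      fderiv ℝ (metricEnergy G) (s b) (ξ - fderiv ℝ s b (fderiv ℝ p (s b) ξ)) = 0 ∧
      fderiv ℝ p (s b) (ξ - fderiv ℝ s b (fderiv ℝ p (s b) ξ)) = 0 := by
    intro ξ hξ
    rw [map_sub, map_sub, (hds _).1, (hds _).2, hξ]
    simp
  refine ⟨contDiffAt_pulledBackForm hG hsd, hiff, ?_, ?_⟩
  · obtain ⟨ξ, h1, h2⟩ := h.exists_liouvilleForm_ne_zero hsW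
    intro h0
    have h3 := h.liouvilleForm_eq_zero hsW hs0 (hproj ξ h1).1 (hproj ξ h1).2
    have h4 := congrArg (fun L : B →L[ℝ] ℝ ↦ L (fderiv ℝ p (s b) ξ)) h0
    rw [map_sub, sub_eq_zero] at h3
    exact h2 (h3.trans h4)
  · intro η hη hη'
    set ξ := fderiv ℝ s b η with hξ
    have hαX : liouvilleForm G (s b) (geodesicSpray G (s b)) = 0 := hs0
    have hEX := fderiv_metricEnergy_geodesicSpray h.symm (hG.differentiableAt (by simp))
      (h.isInvertible hsW)
    let L : Fin 2 → (E × E →ₗ[ℝ] ℝ) :=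
      ![(fderiv ℝ (metricEnergy G) (s b)).toLinearMap, (liouvilleForm G (s b)).toLinearMap]
    let K : E × E →L[ℝ] ℝ := fderiv ℝ (liouvilleForm G) (s b) ξ
      - (fderiv ℝ (liouvilleForm G) (s b)).flip ξ
    have hK : ∀ ζ, K ζ = exteriorDerivative (liouvilleForm G) (s b) ξ ζ := fun ζ ↦ rfl
    -- The covector K = ι_ξ dα vanishes on ker dE ∩ ker α: on the fibre part by the contraction
    -- formulas, on the lifted part by the hypothesis on η. Hence K is a combination of dE and α.
    have hker : ⨅ i, LinearMap.ker (L i) ≤ LinearMap.ker K.toLinearMap := by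
      intro ζ hζ
      rw [Submodule.mem_iInf] at hζ
      have hζ0 : fderiv ℝ (metricEnergy G) (s b) ζ = 0 := hζ 0
      have hζ1 : liouvilleForm G (s b) ζ = 0 := hζ 1
      change K ζ = 0
      obtain ⟨c, d, hcd⟩ := h.exists_eq_of_fderiv_eq_zero hsW hs0 (hproj ζ hζ0).1 (hproj ζ hζ0).2
      have hζ2 : ζ = (c • geodesicSpray G (s b) + d • (0, (s b).2))
          + fderiv ℝ s b (fderiv ℝ p (s b) ζ) := by rw [hcd]; abel
      have hskew : ∀ ζ', exteriorDerivative (liouvilleForm G) (s b) ξ ζ'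
          = -exteriorDerivative (liouvilleForm G) (s b) ζ' ξ := fun ζ' ↦ by
        rw [exteriorDerivative, exteriorDerivative]; ring
      have hKX : K (geodesicSpray G (s b)) = 0 := by
        rw [hK, hskew, exteriorDerivative_geodesicSpray h.symm hG (h.isInvertible hsW), (hds η).1]
        simp
      have hKE : K (0, (s b).2) = 0 := by
        rw [hK, hskew, exteriorDerivative_euler hG]
        exact neg_eq_zero.2 hη
      have hKs : K (fderiv ℝ s b (fderiv ℝ p (s b) ζ)) = 0 := by
        rw [hK, hξ, ← exteriorDerivative_pulledBackForm hG hsd]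
        refine hη' _ ((hiff _).2 ?_)
        exact (h.mem_abreastVelocities_iff hsW hs0 hζ0).2 hζ1
      rw [hζ2, map_add, map_add, map_smul, map_smul, hKX, hKE, hKs]
      simp
    obtain ⟨c, hc⟩ := (Submodule.mem_span_range_iff_exists_fun ℝ).1
      (mem_span_of_iInf_ker_le_ker hker)
    have hc' : ∀ ζ, K ζ
        = c 0 * fderiv ℝ (metricEnergy G) (s b) ζ + c 1 * liouvilleForm G (s b) ζ := by
      intro ζ
      have := congrArg (fun T : E × E →ₗ[ℝ] ℝ ↦ T ζ) hc
      simpa [L] using this.symm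
    -- As ι_X dα = -dE/2 and ι_R dα = α, the field -2 c₀ X + c₁ R has the same contraction with dα
    -- as ξ. Nondegeneracy makes them equal, and the projection kills this combination.
    have hzero : ξ - ((-2 * c 0) • geodesicSpray G (s b) + c 1 • ((0, (s b).2) : E × E)) = 0 := by
      refine eq_zero_of_exteriorDerivative_eq_zero h.symm hG (h.nondegenerate _ hsW) fun ζ ↦ ?_
      have hlin : exteriorDerivative (liouvilleForm G) (s b)
          (ξ - ((-2 * c 0) • geodesicSpray G (s b) + c 1 • ((0, (s b).2) : E × E))) ζ
          = exteriorDerivative (liouvilleForm G) (s b) ξ ζ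
            - ((-2 * c 0) * exteriorDerivative (liouvilleForm G) (s b) (geodesicSpray G (s b)) ζ
              + c 1 * exteriorDerivative (liouvilleForm G) (s b) (0, (s b).2) ζ) := by
        simp only [exteriorDerivative, map_sub, map_add, map_smul, sub_apply, add_apply, smul_apply,
          smul_eq_mul]
        ring
      rw [hlin, ← hK, hc', exteriorDerivative_geodesicSpray h.symm hG (h.isInvertible hsW),
        exteriorDerivative_euler hG]
      ring
    rw [← (hds η).2, ← hξ, sub_eq_zero.1 hzero, map_add, map_smul, map_smul, h.spray _ hsW hs0,
      h.euler _ hsW hs0]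
    simp

theorem fderiv_energy_ne_zero (hz : z ∈ W) : fderiv ℝ (metricEnergy G) z ≠ 0 := by
  obtain ⟨w, hw⟩ := h.exists_metric_ne_zero hz
  intro h0
  have h1 := h.fderiv_energy hz (0, w)
  rw [h0] at h1
  simp [hw] at h1

/-- The Liouville form on a vector field that projects to a constant is constant along the
geodesic flow. -/
theorem fderiv_liouvilleForm_eq_zero [FiniteDimensional ℝ E] [FiniteDimensional ℝ B] (hz : z ∈ W)
    (h0 : metricEnergy G z = 0) {V : E × E → E × E} {η : B} (hV : ContDiffAt ℝ ∞ V z)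
    (hVE : ∀ᶠ w in 𝓝 z, fderiv ℝ (metricEnergy G) w (V w) = 0)
    (hVp : ∀ᶠ w in 𝓝 z, fderiv ℝ p w (V w) = η) :
    fderiv ℝ (fun w ↦ liouvilleForm G w (V w)) z (geodesicSpray G z) = 0 := by
  have : CompleteSpace E := FiniteDimensional.complete ℝ E
  have hG := h.contDiffAt_metric z hz
  have hVd := hV.differentiableAt (by simp)
  have hX := h.contDiffAt_spray hz
  have hXd := hX.differentiableAt (by simp)
  have hEX : ∀ᶠ w in 𝓝 z, fderiv ℝ (metricEnergy G) w (geodesicSpray G w) = 0 := by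
    filter_upwards [h.isOpen.mem_nhds hz] with w hw
    exact fderiv_metricEnergy_geodesicSpray h.symm
      ((h.contDiffAt_metric w hw).differentiableAt (by simp)) (h.isInvertible hw)
  have h1 := fderiv_apply_commutator (h.contDiffAt_energy hz) hVd hXd
  rw [fderiv_eq_zero_of_eventually_eq_const hVE,
    fderiv_eq_zero_of_eventually_eq_const hEX] at h1
  -- The identity dp(X) = 0 is known only on the cone, so it may be differentiated only in
  -- directions tangent to the cone, such as V.
  have hlag : fderiv ℝ (fun w ↦ fderiv ℝ p w (geodesicSpray G w)) z (V z) = 0 := by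
    refine fderiv_eq_zero_of_eq_zero_on (h.contDiffAt_energy hz)
      (((h.contDiffAt z hz).fderiv_right (by simp)).clm_apply hX) h0 (h.fderiv_energy_ne_zero hz)
      ?_ hVE.self_of_nhds
    filter_upwards [h.isOpen.mem_nhds hz] with w hw using h.spray w hw
  have h2 := fderiv_apply_commutator (h.contDiffAt z hz) hVd hXd
  rw [fderiv_eq_zero_of_eventually_eq_const hVp, hlag] at h2
  -- The commutator of V and X is a fibre direction inside the cone.
  have h3 := h.liouvilleForm_eq_zero hz h0 (h1.trans (sub_self 0)) (h2.trans (sub_self 0))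
  have h4 := lieDerivative_liouvilleForm h.symm hG (h.isInvertible hz) (V z)
  rw [hVE.self_of_nhds, zero_div] at h4
  rw [(((contDiffAt_liouvilleForm hG).differentiableAt (by simp)).hasFDerivAt.clm_apply
    hVd.hasFDerivAt).fderiv]
  rw [map_sub] at h3
  simp only [add_apply, ContinuousLinearMap.comp_apply, ContinuousLinearMap.flip_apply]
  linarith

/-- Abreastness is preserved by the geodesic flow. -/
theorem eventually_abreastVelocities_eq [FiniteDimensional ℝ E] [FiniteDimensional ℝ B]
    {c : ℝ → E × E} {t₀ : ℝ} (hW : ∀ᶠ t in 𝓝 t₀, c t ∈ W)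
    (h0 : ∀ᶠ t in 𝓝 t₀, metricEnergy G (c t) = 0)
    (hc : ∀ᶠ t in 𝓝 t₀, HasDerivAt c (geodesicSpray G (c t)) t) :
    ∀ᶠ t in 𝓝 t₀, abreastVelocities G p (c t) = abreastVelocities G p (c t₀) := by
  let A : E × E → E × E →L[ℝ] ℝ × B := fun w ↦ (fderiv ℝ (metricEnergy G) w).prod (fderiv ℝ p w)
  have hz := hW.self_of_nhds
  obtain ⟨R, hR⟩ := (A (c t₀)).exists_comp_eq_id (h.prod_surjective hz h0.self_of_nhds)
  have hAd : ∀ w ∈ W, ContDiffAt ℝ ∞ (fun w ↦ (A w).comp R) w := fun w hw ↦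
    contDiffAt_clm_of_apply fun y ↦
      (((h.contDiffAt_energy hw).fderiv_right (by simp)).clm_apply contDiffAt_const).prodMk
      (((h.contDiffAt w hw).fderiv_right (by simp)).clm_apply contDiffAt_const)
  have hinv : ∀ᶠ w in 𝓝 (c t₀), ((A w).comp R).IsInvertible := by
    have h3 := (ContinuousLinearEquiv.refl ℝ (ℝ × B)).nhds
    have h4 : ((ContinuousLinearEquiv.refl ℝ (ℝ × B) : (ℝ × B) ≃L[ℝ] (ℝ × B)) :
        (ℝ × B) →L[ℝ] (ℝ × B)) = (A (c t₀)).comp R := hR.symm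
    rw [h4] at h3
    exact (hAd _ hz).continuousAt.eventually h3
  -- A smooth lift of the constant vector η, with dE(V) = 0 and dp(V) = η near `c t₀`: the right
  -- inverse chosen at `c t₀` is corrected at nearby points.
  let V : B → E × E → E × E := fun η w ↦ R (((A w).comp R).inverse (0, η))
  have : CompleteSpace B := FiniteDimensional.complete ℝ B
  have hAV : ∀ η w, ((A w).comp R).IsInvertible → A w (V η w) = (0, η) := fun η w hw ↦
    hw.self_apply_inverse _
  have hVd : ∀ η w, w ∈ W → ((A w).comp R).IsInvertible → ContDiffAt ℝ ∞ (V η) w :=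
    fun η w hw hi ↦ R.contDiff.contDiffAt.comp w
      ((hi.contDiffAt_map_inverse.comp w (hAd w hw)).clm_apply contDiffAt_const)
  have hct : ContinuousAt c t₀ := hc.self_of_nhds.continuousAt
  have hev : ∀ᶠ t in 𝓝 t₀, c t ∈ W ∧ metricEnergy G (c t) = 0 ∧
      HasDerivAt c (geodesicSpray G (c t)) t ∧
      ∀ᶠ w in 𝓝 (c t), ((A w).comp R).IsInvertible := by
    filter_upwards [hW, h0, hc, hct.eventually hinv.eventually_nhds] with t h1 h2 h3 h4
      using ⟨h1, h2, h3, h4⟩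
  obtain ⟨ε, hε, hball⟩ := Metric.eventually_nhds_iff_ball.1 hev
  have hderiv : ∀ η, ∀ t ∈ Metric.ball t₀ ε,
      HasDerivAt (fun t ↦ liouvilleForm G (c t) (V η (c t))) 0 t := by
    intro η t ht
    obtain ⟨h1, h2, h3, h4⟩ := hball t ht
    have h5 := h.fderiv_liouvilleForm_eq_zero h1 h2 (hVd η _ h1 h4.self_of_nhds)
      (h4.mono fun w hw ↦ congrArg Prod.fst (hAV η w hw))
      (h4.mono fun w hw ↦ congrArg Prod.snd (hAV η w hw))
    have h6 : DifferentiableAt ℝ (fun w ↦ liouvilleForm G w (V η w)) (c t) :=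
      ((contDiffAt_liouvilleForm (h.contDiffAt_metric _ h1)).clm_apply
        (hVd η _ h1 h4.self_of_nhds)).differentiableAt (by simp)
    rw [← h5]
    exact h6.hasFDerivAt.comp_hasDerivAt t h3
  filter_upwards [Metric.ball_mem_nhds t₀ hε] with t ht
  have ht₀ := Metric.mem_ball_self (x := t₀) hε
  ext η
  have hcst : liouvilleForm G (c t) (V η (c t)) = liouvilleForm G (c t₀) (V η (c t₀)) :=
    Metric.isOpen_ball.is_const_of_deriv_eq_zero (convex_ball _ _).isPreconnected
      (fun t ht ↦ (hderiv η t ht).differentiableAt.differentiableWithinAt)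
      (fun t ht ↦ (hderiv η t ht).deriv) ht ht₀
  have hmem : ∀ t ∈ Metric.ball t₀ ε,
      η ∈ abreastVelocities G p (c t) ↔ liouvilleForm G (c t) (V η (c t)) = 0 := by
    intro t ht
    obtain ⟨h1, h2, -, h4⟩ := hball t ht
    have h5 := hAV η _ h4.self_of_nhds
    have h6 := h.mem_abreastVelocities_iff h1 h2 (ξ := V η (c t)) (congrArg Prod.fst h5)
    rwa [show fderiv ℝ p (c t) (V η (c t)) = η from congrArg Prod.snd h5] at h6
  rw [hmem t ht, hmem t₀ ht₀, hcst]

end IsNullModel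

end NullModel

/-! ## The tangent bundle in a chart -/

section TangentChart

variable {E : Type*} [NormedAddCommGroup E] [NormedSpace ℝ E]
  {M : Type*} [TopologicalSpace M] [ChartedSpace E M]

/-- The chart of the tangent bundle induced by the preferred chart at `x₀`. -/
def tangentChart (x₀ : M) (v : TangentBundle 𝓘(ℝ, E) M) : E × E :=
  (extChartAt 𝓘(ℝ, E) x₀ v.1, mfderiv 𝓘(ℝ, E) 𝓘(ℝ, E) (extChartAt 𝓘(ℝ, E) x₀) v.1 v.2)

/-- The inverse of `tangentChart`. -/
def tangentChartSymm (x₀ : M) (z : E × E) : TangentBundle 𝓘(ℝ, E) M :=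
  ⟨(extChartAt 𝓘(ℝ, E) x₀).symm z.1,
    mfderiv 𝓘(ℝ, E) 𝓘(ℝ, E) (extChartAt 𝓘(ℝ, E) x₀).symm z.1 z.2⟩

theorem tangentBundle_ext {v : TangentBundle 𝓘(ℝ, E) M} {x : M} {a : E} (h1 : v.1 = x)
    (h2 : (v.2 : E) = a) : v = (⟨x, a⟩ : TangentBundle 𝓘(ℝ, E) M) := by
  obtain ⟨y, b⟩ := v
  dsimp only at h1
  subst h1
  exact congrArg _ h2

variable [IsManifold 𝓘(ℝ, E) ∞ M] {x₀ : M}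

theorem contMDiffAt_chart {x : M} (hx : x ∈ (extChartAt 𝓘(ℝ, E) x₀).source) :
    ContMDiffAt 𝓘(ℝ, E) 𝓘(ℝ, E) ∞ (extChartAt 𝓘(ℝ, E) x₀) x :=
  contMDiffAt_extChartAt' (by rwa [extChartAt_source] at hx)

theorem contMDiffAt_chart_symm {y : E} (hy : y ∈ (extChartAt 𝓘(ℝ, E) x₀).target) :
    ContMDiffAt 𝓘(ℝ, E) 𝓘(ℝ, E) ∞ (extChartAt 𝓘(ℝ, E) x₀).symm y :=
  (contMDiffOn_extChartAt_symm x₀).contMDiffAt ((isOpen_extChartAt_target x₀).mem_nhds hy)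

theorem mfderiv_chart_symm_comp {y : E} (hy : y ∈ (extChartAt 𝓘(ℝ, E) x₀).target) (u : E) :
    mfderiv 𝓘(ℝ, E) 𝓘(ℝ, E) (extChartAt 𝓘(ℝ, E) x₀) ((extChartAt 𝓘(ℝ, E) x₀).symm y)
      (mfderiv 𝓘(ℝ, E) 𝓘(ℝ, E) (extChartAt 𝓘(ℝ, E) x₀).symm y u) = u := by
  have h := mfderiv_extChartAt_comp_mfderivWithin_extChartAt_symm (I := 𝓘(ℝ, E)) hy
  rw [modelWithCornersSelf_coe, Set.range_id, mfderivWithin_univ] at h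
  exact congrArg (fun L : E →L[ℝ] E ↦ L u) h

theorem mfderiv_chart_comp {x : M} (hx : x ∈ (extChartAt 𝓘(ℝ, E) x₀).source)
    (u : TangentSpace 𝓘(ℝ, E) x) :
    (mfderiv 𝓘(ℝ, E) 𝓘(ℝ, E) (extChartAt 𝓘(ℝ, E) x₀).symm (extChartAt 𝓘(ℝ, E) x₀ x)
      (mfderiv 𝓘(ℝ, E) 𝓘(ℝ, E) (extChartAt 𝓘(ℝ, E) x₀) x u) : E) = u := by
  have h := mfderivWithin_extChartAt_symm_comp_mfderiv_extChartAt' (I := 𝓘(ℝ, E)) hx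
  rw [modelWithCornersSelf_coe, Set.range_id, mfderivWithin_univ] at h
  exact congrArg (fun L : E →L[ℝ] E ↦ L u) h

theorem tangentChart_symm {z : E × E} (hz : z.1 ∈ (extChartAt 𝓘(ℝ, E) x₀).target) :
    tangentChart x₀ (tangentChartSymm x₀ z) = z :=
  Prod.ext ((extChartAt 𝓘(ℝ, E) x₀).right_inv hz) (mfderiv_chart_symm_comp hz z.2)

theorem tangentChartSymm_tangentChart {v : TangentBundle 𝓘(ℝ, E) M}
    (hv : v.1 ∈ (extChartAt 𝓘(ℝ, E) x₀).source) :
    tangentChartSymm x₀ (tangentChart x₀ v) = v :=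
  tangentBundle_ext ((extChartAt 𝓘(ℝ, E) x₀).left_inv hv) (mfderiv_chart_comp hv v.2)

theorem contMDiff_toTangentBundle :
    ContMDiff 𝓘(ℝ, E × E) 𝓘(ℝ, E).tangent ∞
      (fun z : E × E ↦ (⟨z.1, z.2⟩ : TangentBundle 𝓘(ℝ, E) E)) := by
  intro z
  rw [contMDiffAt_totalSpace]
  refine ⟨contDiff_fst.contMDiff.contMDiffAt, ?_⟩
  refine contDiff_snd.contMDiff.contMDiffAt.congr_of_eventuallyEq (Eventually.of_forall fun w ↦ ?_)
  simp

theorem contMDiffAt_tangentChartSymm {z : E × E} (hz : z.1 ∈ (extChartAt 𝓘(ℝ, E) x₀).target) :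
    ContMDiffAt 𝓘(ℝ, E × E) 𝓘(ℝ, E).tangent ∞ (tangentChartSymm x₀) z := by
  have hopen := isOpen_extChartAt_target (I := 𝓘(ℝ, E)) x₀
  have h1 := (contMDiffOn_extChartAt_symm (I := 𝓘(ℝ, E)) (n := ∞) x₀).contMDiffOn_tangentMapWithin
    (m := ∞) (by simp) hopen.uniqueMDiffOn
  have h2 : ContMDiffOn 𝓘(ℝ, E × E) 𝓘(ℝ, E).tangent ∞ (tangentChartSymm x₀)
      (Prod.fst ⁻¹' (extChartAt 𝓘(ℝ, E) x₀).target) := by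
    refine (h1.comp contMDiff_toTangentBundle.contMDiffOn fun z hz ↦ hz).congr fun z hz ↦ ?_
    simp only [Function.comp, tangentMapWithin, tangentChartSymm]
    rw [mfderivWithin_of_isOpen hopen hz]
  exact h2.contMDiffAt ((hopen.preimage continuous_fst).mem_nhds hz)

theorem contMDiffAt_tangentChart {v : TangentBundle 𝓘(ℝ, E) M}
    (hv : v.1 ∈ (extChartAt 𝓘(ℝ, E) x₀).source) :
    ContMDiffAt 𝓘(ℝ, E).tangent 𝓘(ℝ, E × E) ∞ (tangentChart x₀) v := by
  have hopen := isOpen_extChartAt_source (I := 𝓘(ℝ, E)) x₀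
  have h0 : ContMDiffOn 𝓘(ℝ, E) 𝓘(ℝ, E) ∞ (extChartAt 𝓘(ℝ, E) x₀)
      (extChartAt 𝓘(ℝ, E) x₀).source := fun x hx ↦ (contMDiffAt_chart hx).contMDiffWithinAt
  have h1 := h0.contMDiffOn_tangentMapWithin (m := ∞) (by simp) hopen.uniqueMDiffOn
  have h2 : ContMDiffAt 𝓘(ℝ, E).tangent 𝓘(ℝ, E) ∞ (fun v : TangentBundle 𝓘(ℝ, E) M ↦
      (mfderiv 𝓘(ℝ, E) 𝓘(ℝ, E) (extChartAt 𝓘(ℝ, E) x₀) v.1 v.2 : E)) v := by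
    have h3 := (contMDiff_snd_tangentBundle_modelSpace (n := ∞) E 𝓘(ℝ, E)).comp_contMDiffOn h1
    refine ContMDiffOn.contMDiffAt (h3.congr fun w hw ↦ ?_)
      ((hopen.preimage (FiberBundle.continuous_proj E (TangentSpace 𝓘(ℝ, E)))).mem_nhds hv)
    simp only [Function.comp, tangentMapWithin]
    rw [mfderivWithin_of_isOpen hopen hw]
  exact ((contMDiffAt_chart hv).comp v (contMDiffAt_proj (TangentSpace 𝓘(ℝ, E)))).prodMk_space h2

theorem tangentChart_tangentMap {γ : ℝ → M} {t : ℝ}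
    (hγ : MDifferentiableAt 𝓘(ℝ, ℝ) 𝓘(ℝ, E) γ t)
    (ht : γ t ∈ (extChartAt 𝓘(ℝ, E) x₀).source) :
    tangentChart x₀ (tangentMap 𝓘(ℝ, ℝ) 𝓘(ℝ, E) γ ⟨t, (1 : ℝ)⟩)
      = (extChartAt 𝓘(ℝ, E) x₀ (γ t), deriv (fun s ↦ extChartAt 𝓘(ℝ, E) x₀ (γ s)) t) := by
  refine Prod.ext rfl ?_
  have h1 := mfderiv_comp t ((contMDiffAt_chart ht).mdifferentiableAt (by simp)) hγ
  have h2 : mfderiv 𝓘(ℝ, ℝ) 𝓘(ℝ, E) (extChartAt 𝓘(ℝ, E) x₀ ∘ γ) t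
      = fderiv ℝ (fun s ↦ extChartAt 𝓘(ℝ, E) x₀ (γ s)) t := mfderiv_eq_fderiv
  rw [h2] at h1
  exact (congrArg (fun L : ℝ →L[ℝ] E ↦ L 1) h1).symm

/-- The differential of `tangentChart`. -/
def tangentChartDiff (x₀ : M) (v : TangentBundle 𝓘(ℝ, E) M)
    (ξ : TangentSpace 𝓘(ℝ, E).tangent v) : E × E :=
  mfderiv 𝓘(ℝ, E).tangent 𝓘(ℝ, E × E) (tangentChart x₀) v ξ

theorem fderiv_tangentChartDiff {Y : Type*} [NormedAddCommGroup Y] [NormedSpace ℝ Y]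
    {k : E × E → Y} {K : TangentBundle 𝓘(ℝ, E) M → Y} {v : TangentBundle 𝓘(ℝ, E) M}
    (hv : v.1 ∈ (extChartAt 𝓘(ℝ, E) x₀).source) (hk : DifferentiableAt ℝ k (tangentChart x₀ v))
    (h : ∀ z, k z = K (tangentChartSymm x₀ z)) (ξ : TangentSpace 𝓘(ℝ, E).tangent v) :
    fderiv ℝ k (tangentChart x₀ v) (tangentChartDiff x₀ v ξ)
      = (mfderiv 𝓘(ℝ, E).tangent 𝓘(ℝ, Y) K v ξ : Y) := by
  have hΦ := (contMDiffAt_tangentChart (x₀ := x₀) hv).mdifferentiableAt (n := ∞) (by simp)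
  have h1 := mfderiv_comp v (I' := 𝓘(ℝ, E × E)) (g := k) (f := tangentChart x₀) (I'' := 𝓘(ℝ, Y))
    hk.mdifferentiableAt hΦ
  have h2 : (k ∘ tangentChart x₀) =ᶠ[𝓝 v] K := by
    filter_upwards [((isOpen_extChartAt_source (I := 𝓘(ℝ, E)) x₀).preimage
      (FiberBundle.continuous_proj E (TangentSpace 𝓘(ℝ, E)))).mem_nhds hv] with w hw
    rw [Function.comp_apply, h, tangentChartSymm_tangentChart hw]
  rw [h2.mfderiv_eq, mfderiv_eq_fderiv] at h1
  exact (congrArg (fun L : TangentSpace 𝓘(ℝ, E).tangent v →L[ℝ] Y ↦ L ξ) h1).symm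

end TangentChart

/-! ## The geodesic equation in charts -/

section GeodesicDefect

variable {E : Type*} [NormedAddCommGroup E] [NormedSpace ℝ E]

local instance : NormedAddCommGroup (E →L[ℝ] E →L[ℝ] ℝ) :=
  ContinuousLinearMap.toNormedAddCommGroup

local instance : NormedSpace ℝ (E →L[ℝ] E →L[ℝ] ℝ) :=
  ContinuousLinearMap.toNormedSpace

/-- The left-hand side of the geodesic equation, with its index lowered. -/
def geodesicDefect (G : E → E →L[ℝ] E →L[ℝ] ℝ) (c : ℝ → E) (t : ℝ) : E →L[ℝ] ℝ :=
  G (c t) (deriv (deriv c) t) + christoffelForm G (c t) (deriv c t) (deriv c t)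

theorem fderiv_metric_apply {G : E → E →L[ℝ] E →L[ℝ] ℝ} {y : E} (hG : DifferentiableAt ℝ G y)
    (a b c : E) : fderiv ℝ (fun y ↦ G y b c) y a = fderiv ℝ G y a b c := by
  obtain ⟨L, hL, hL'⟩ := hasFDerivAt_metric_apply (f := id) (a := fun _ ↦ b) (b := fun _ ↦ c) hG
    (hasFDerivAt_id y) (hasFDerivAt_const b y) (hasFDerivAt_const c y)
  have h : HasFDerivAt (fun y ↦ G y b c) L y := hL
  rw [h.fderiv, hL']
  simp

theorem contDiffAt_deriv {c : ℝ → E} {t : ℝ} (hc : ContDiffAt ℝ ∞ c t) :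
    ContDiffAt ℝ ∞ (deriv c) t :=
  (hc.fderiv_right (m := ∞) (by simp)).clm_apply contDiffAt_const

/-- The lowered geodesic equation is a covector: the second derivative of `ψ` in the acceleration
cancels against the one that differentiating the pulled-back metric puts into the Christoffel
symbols. -/
theorem geodesicDefect_comp {G₀ G₁ : E → E →L[ℝ] E →L[ℝ] ℝ} {ψ : E → E} {c : ℝ → E} {t : ℝ}
    (hψ : ContDiffAt ℝ ∞ ψ (c t)) (hc : ContDiffAt ℝ ∞ c t)
    (hG₀ : DifferentiableAt ℝ G₀ (c t)) (hG₁ : DifferentiableAt ℝ G₁ (ψ (c t)))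
    (hsymm : ∀ y a b, G₁ y a b = G₁ y b a)
    (heq : ∀ᶠ y in 𝓝 (c t), ∀ a b, G₀ y a b = G₁ (ψ y) (fderiv ℝ ψ y a) (fderiv ℝ ψ y b)) (w : E) :
    geodesicDefect G₀ c t w
      = geodesicDefect G₁ (fun s ↦ ψ (c s)) t (fderiv ℝ ψ (c t) w) := by
  have hψ' : DifferentiableAt ℝ (fderiv ℝ ψ) (c t) :=
    (hψ.fderiv_right (m := ∞) (by simp)).differentiableAt (by simp)
  have hψd := (hψ.differentiableAt (by simp)).hasFDerivAt
  have hcd := (hc.differentiableAt (by simp)).hasDerivAt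
  have hcd' : HasDerivAt (deriv c) (deriv (deriv c) t) t :=
    ((contDiffAt_deriv hc).differentiableAt (by simp)).hasDerivAt
  have h1 : deriv (fun s ↦ ψ (c s)) =ᶠ[𝓝 t] fun s ↦ fderiv ℝ ψ (c s) (deriv c s) := by
    have h2 := hc.continuousAt.eventually ((hψ.of_le (m := 1) (by simp)).eventually (by simp))
    filter_upwards [h2, (hc.of_le (m := 1) (by simp)).eventually (by simp)] with s hs hs'
    exact ((hs.differentiableAt (by simp)).hasFDerivAt.comp_hasDerivAt s
      (hs'.differentiableAt (by simp)).hasDerivAt).deriv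
  have h3 : deriv (deriv fun s ↦ ψ (c s)) t
      = fderiv ℝ (fderiv ℝ ψ) (c t) (deriv c t) (deriv c t)
        + fderiv ℝ ψ (c t) (deriv (deriv c) t) := by
    rw [h1.deriv_eq]
    exact ((hψ'.hasFDerivAt.comp_hasDerivAt t hcd).clm_apply hcd').deriv
  have hsnd := fun a b ↦ hψ.isSymmSndFDerivAt minSmoothness_two_le_infty a b
  have key : ∀ a b d, fderiv ℝ G₀ (c t) a b d
      = fderiv ℝ G₁ (ψ (c t)) (fderiv ℝ ψ (c t) a) (fderiv ℝ ψ (c t) b) (fderiv ℝ ψ (c t) d)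
        + G₁ (ψ (c t)) (fderiv ℝ (fderiv ℝ ψ) (c t) a b) (fderiv ℝ ψ (c t) d)
        + G₁ (ψ (c t)) (fderiv ℝ ψ (c t) b) (fderiv ℝ (fderiv ℝ ψ) (c t) a d) := by
    intro a b d
    have hb : ∀ b, HasFDerivAt (fun y ↦ fderiv ℝ ψ y b) ((fderiv ℝ (fderiv ℝ ψ) (c t)).flip b)
        (c t) := fun b ↦ by
      convert! hψ'.hasFDerivAt.clm_apply (hasFDerivAt_const b (c t)) using 1
      ext; simp
    obtain ⟨L, hL, hL'⟩ := hasFDerivAt_metric_apply hG₁ hψd (hb b) (hb d)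
    have h4 : HasFDerivAt (fun y ↦ G₀ y b d) L (c t) :=
      hL.congr_of_eventuallyEq (heq.mono fun y hy ↦ hy b d)
    rw [← fderiv_metric_apply hG₀, h4.fderiv, hL']
    rfl
  simp only [geodesicDefect, add_apply, christoffelForm_apply, key, h3, map_add,
    heq.self_of_nhds, h1.self_of_nhds, hsnd w]
  rw [hsymm _ (fderiv ℝ (fderiv ℝ ψ) (c t) (deriv c t) w)]
  ring

end GeodesicDefect

/-! ### The Lorentzian metric in a chart. -/

section MetricInChart

variable {n : ℕ} {M : Type*} [TopologicalSpace M]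
  [ChartedSpace (EuclideanSpace ℝ (Fin (n + 2))) M] [IsManifold (𝓡 (n + 2)) ∞ M]
  (g : LorentzianMetric n M)

local notation "𝔼" => EuclideanSpace ℝ (Fin (n + 2))

local instance : NormedAddCommGroup (𝔼 →L[ℝ] 𝔼 →L[ℝ] ℝ) :=
  ContinuousLinearMap.toNormedAddCommGroup

local instance : NormedSpace ℝ (𝔼 →L[ℝ] 𝔼 →L[ℝ] ℝ) :=
  ContinuousLinearMap.toNormedSpace

namespace LorentzianMetric

/-- A vector orthogonal to everything is orthogonal to the timelike vector, so if nonzero it would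
be spacelike, contradicting that it is orthogonal to itself. -/
theorem form_nondegenerate {x : M} {a : TangentSpace (𝓡 (n + 2)) x}
    (ha : ∀ b, g.form x a b = 0) : a = 0 := by
  obtain ⟨t, -, ht⟩ := g.lorentzian x
  by_contra hne
  have h1 := ht a (by rw [g.symm]; exact ha t) hne
  rw [ha a] at h1
  exact lt_irrefl _ h1

theorem inChart_symm (x₀ : M) (y a b : 𝔼) : g.inChart x₀ y a b = g.inChart x₀ y b a :=
  g.symm _ _ _

variable {x₀ : M}

theorem inChart_nondegenerate {y : 𝔼} (hy : y ∈ (extChartAt (𝓡 (n + 2)) x₀).target) {a : 𝔼}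
    (ha : ∀ b, g.inChart x₀ y a b = 0) : a = 0 := by
  have h1 : mfderiv (𝓡 (n + 2)) (𝓡 (n + 2)) (extChartAt (𝓡 (n + 2)) x₀).symm y a = 0 := by
    refine g.form_nondegenerate fun b ↦ ?_
    have h2 := ha (mfderiv (𝓡 (n + 2)) (𝓡 (n + 2)) (extChartAt (𝓡 (n + 2)) x₀)
      ((extChartAt (𝓡 (n + 2)) x₀).symm y) b)
    have h3 := mfderiv_chart_comp ((extChartAt (𝓡 (n + 2)) x₀).map_target hy) b
    rw [(extChartAt (𝓡 (n + 2)) x₀).right_inv hy] at h3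
    rw [← h2]
    exact congrArg (g.form _ _) h3.symm
  have h2 := mfderiv_chart_symm_comp hy a
  rw [h1, map_zero] at h2
  exact h2.symm

/-- Tested on constant vectors, the components are the smooth metric evaluated on two smooth fields
along the inverse chart. -/
theorem contDiffAt_inChart {y : 𝔼} (hy : y ∈ (extChartAt (𝓡 (n + 2)) x₀).target) :
    ContDiffAt ℝ ∞ (g.inChart x₀) y := by
  refine contDiffAt_clm_of_apply fun a ↦ contDiffAt_clm_of_apply fun b ↦ ?_
  have hs : ∀ a : 𝔼, ContMDiffAt (𝓡 (n + 2)) (𝓡 (n + 2)).tangent ∞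
      (fun y ↦ tangentChartSymm x₀ (y, a)) y := fun a ↦
    (contMDiffAt_tangentChartSymm (z := (y, a)) hy).comp y
      (contMDiffAt_id.prodMk_space contMDiffAt_const)
  have h1 := ContMDiffAt.clm_bundle_apply₂ (E₃ := Bundle.Trivial M ℝ)
    ((g.contMDiff _).comp y (contMDiffAt_chart_symm hy)) (hs a) (hs b)
  exact (contMDiffAt_totalSpace.1 h1).2.contDiffAt

end LorentzianMetric

end MetricInChart

/-! ### Integral curves of the geodesic spray. -/

section IntegralCurve

variable {E : Type*} [NormedAddCommGroup E] [NormedSpace ℝ E]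

/-- Integral curves of a smooth vector field are smooth. -/
theorem contDiffOn_of_hasDerivAt {X : E → E} {c : ℝ → E} {J : Set ℝ} (hJ : IsOpen J)
    (hX : ∀ t ∈ J, ContDiffAt ℝ ∞ X (c t)) (hc : ∀ t ∈ J, HasDerivAt c (X (c t)) t) :
    ContDiffOn ℝ ∞ c J := by
  rw [contDiffOn_infty]
  intro k
  -- Bootstrapping: if c is of class C^k, then so is c' = X(c).
  induction k with
  | zero =>
    exact contDiffOn_zero.2 fun t ht ↦ (hc t ht).continuousAt.continuousWithinAt
  | succ k ih =>
    rw [Nat.cast_succ, contDiffOn_succ_iff_deriv_of_isOpen hJ]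
    refine ⟨fun t ht ↦ (hc t ht).differentiableAt.differentiableWithinAt,
      fun h ↦ absurd h (by exact WithTop.coe_ne_top (α := ℕ∞) (a := (k : ℕ∞))), ?_⟩
    have h1 : ContDiffOn ℝ k (fun t ↦ X (c t)) J := fun t ht ↦
      (((hX t ht).of_le (WithTop.coe_le_coe.2 le_top)).comp_contDiffWithinAt t (ih t ht))
    exact h1.congr fun t ht ↦ (hc t ht).deriv

/-- A metric whose geodesic spray is smooth at `z` has an integral curve of the spray through
`z`. -/
theorem exists_integralCurve [CompleteSpace E] {X : E → E} {W : Set E} {z : E} (hW : IsOpen W)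
    (hz : z ∈ W) (hX : ∀ w ∈ W, ContDiffAt ℝ ∞ X w) :
    ∃ c : ℝ → E, c 0 = z ∧ ∃ ε > 0, ContDiffOn ℝ ∞ c (Set.Ioo (-ε) ε) ∧
      ∀ t ∈ Set.Ioo (-ε) ε, c t ∈ W ∧ HasDerivAt c (X (c t)) t := by
  obtain ⟨c, hc0, ε, hε, hc⟩ :=
    ((hX z hz).of_le (by simp)).exists_forall_mem_closedBall_exists_eq_forall_mem_Ioo_hasDerivAt₀ 0
  simp only [zero_sub, zero_add] at hc
  have hct : ContinuousAt c 0 := (hc 0 ⟨by linarith, hε⟩).continuousAt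
  have h1 : ∀ᶠ t in 𝓝 0, c t ∈ W := hct.eventually (hc0.symm ▸ hW.mem_nhds hz)
  obtain ⟨δ, hδ, hball⟩ := Metric.eventually_nhds_iff_ball.1 h1
  rw [Real.ball_eq_Ioo] at hball
  simp only [zero_sub, zero_add] at hball
  have h2 : ∀ t ∈ Set.Ioo (-(min ε δ)) (min ε δ), c t ∈ W ∧ HasDerivAt c (X (c t)) t := by
    intro t ht
    have hε' := min_le_left ε δ
    have hδ' := min_le_right ε δ
    exact ⟨hball t ⟨by linarith [ht.1], by linarith [ht.2]⟩,
      hc t ⟨by linarith [ht.1], by linarith [ht.2]⟩⟩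
  exact ⟨c, hc0, min ε δ, lt_min hε hδ, contDiffOn_of_hasDerivAt isOpen_Ioo
    (fun t ht ↦ hX _ (h2 t ht).1) fun t ht ↦ (h2 t ht).2, h2⟩

local instance : NormedAddCommGroup (E →L[ℝ] E →L[ℝ] ℝ) :=
  ContinuousLinearMap.toNormedAddCommGroup

local instance : NormedSpace ℝ (E →L[ℝ] E →L[ℝ] ℝ) :=
  ContinuousLinearMap.toNormedSpace

/-- The geodesic equation says that the velocity is an integral curve of the geodesic spray. -/
theorem hasDerivAt_geodesicSpray {G : E → E →L[ℝ] E →L[ℝ] ℝ} {c : ℝ → E} {t : ℝ}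
    (hG : (G (c t)).IsInvertible) (hc : ContDiffAt ℝ ∞ c t) (h : geodesicDefect G c t = 0) :
    HasDerivAt (fun s ↦ (c s, deriv c s)) (geodesicSpray G (c t, deriv c t)) t := by
  have h1 := ((contDiffAt_deriv hc).differentiableAt (by simp)).hasDerivAt
  have h2 : deriv (deriv c) t = (geodesicSpray G (c t, deriv c t)).2 := by
    apply hG.injective
    ext w
    rw [metric_geodesicSpray (z := (c t, deriv c t)) hG]
    exact eq_neg_of_add_eq_zero_left (congrArg (fun L : E →L[ℝ] ℝ ↦ L w) h)
  rw [h2] at h1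
  exact (hc.differentiableAt (by simp)).hasDerivAt.prodMk h1

theorem geodesicDefect_eq_zero {G : E → E →L[ℝ] E →L[ℝ] ℝ} {c : ℝ → E × E} {t : ℝ}
    (hG : (G (c t).1).IsInvertible)
    (hc : ∀ᶠ s in 𝓝 t, HasDerivAt c (geodesicSpray G (c s)) s) :
    deriv (fun s ↦ (c s).1) t = (c t).2 ∧ geodesicDefect G (fun s ↦ (c s).1) t = 0 := by
  have h1 : deriv (fun s ↦ (c s).1) =ᶠ[𝓝 t] fun s ↦ (c s).2 := by
    filter_upwards [hc] with s hs
    exact ((ContinuousLinearMap.fst ℝ E E).hasFDerivAt.comp_hasDerivAt s hs).deriv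
  have h2 : deriv (deriv fun s ↦ (c s).1) t = (geodesicSpray G (c t)).2 := by
    rw [h1.deriv_eq]
    exact ((ContinuousLinearMap.snd ℝ E E).hasFDerivAt.comp_hasDerivAt t hc.self_of_nhds).deriv
  refine ⟨h1.self_of_nhds, ?_⟩
  ext w
  rw [geodesicDefect, h1.self_of_nhds, h2, add_apply, metric_geodesicSpray hG]
  simp

/-- The energy is constant along integral curves of the geodesic spray. -/
theorem metricEnergy_eq {G : E → E →L[ℝ] E →L[ℝ] ℝ} (hsymm : ∀ y a b, G y a b = G y b a)
    {c : ℝ → E × E} {J : Set ℝ} (hJ : IsOpen J) (hJ' : IsPreconnected J)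
    (hG : ∀ t ∈ J, ContDiffAt ℝ ∞ G (c t).1) (hi : ∀ t ∈ J, (G (c t).1).IsInvertible)
    (hc : ∀ t ∈ J, HasDerivAt c (geodesicSpray G (c t)) t) {s t : ℝ} (hs : s ∈ J) (ht : t ∈ J) :
    metricEnergy G (c s) = metricEnergy G (c t) := by
  have h1 : ∀ t ∈ J, HasDerivAt (fun t ↦ metricEnergy G (c t)) 0 t := fun t ht ↦ by
    have h2 := ((contDiffAt_metricEnergy (hG t ht)).differentiableAt
      (by simp)).hasFDerivAt.comp_hasDerivAt t (hc t ht)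
    rwa [fderiv_metricEnergy_geodesicSpray hsymm ((hG t ht).differentiableAt (by simp))
      (hi t ht)] at h2
  exact hJ.is_const_of_deriv_eq_zero hJ'
    (fun t ht ↦ (h1 t ht).differentiableAt.differentiableWithinAt)
    (fun t ht ↦ (h1 t ht).deriv) hs ht

end IntegralCurve

/-! ### Geodesics on the manifold as integral curves in charts. -/

section Geodesics

variable {n : ℕ} {M : Type*} [TopologicalSpace M]
  [ChartedSpace (EuclideanSpace ℝ (Fin (n + 2))) M] [IsManifold (𝓡 (n + 2)) ∞ M]
  (g : LorentzianMetric n M)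

local notation "𝔼" => EuclideanSpace ℝ (Fin (n + 2))

local instance : NormedAddCommGroup (𝔼 →L[ℝ] 𝔼 →L[ℝ] ℝ) :=
  ContinuousLinearMap.toNormedAddCommGroup

local instance : NormedSpace ℝ (𝔼 →L[ℝ] 𝔼 →L[ℝ] ℝ) :=
  ContinuousLinearMap.toNormedSpace

namespace LorentzianMetric

theorem isInvertible_inChart {x₀ : M} {y : 𝔼} (hy : y ∈ (extChartAt (𝓡 (n + 2)) x₀).target) :
    (g.inChart x₀ y).IsInvertible :=
  isInvertible_of_nondegenerate fun _ ha ↦ g.inChart_nondegenerate hy ha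

theorem inChart_mfderiv {x₀ x : M} (hx : x ∈ (extChartAt (𝓡 (n + 2)) x₀).source)
    (a b : TangentSpace (𝓡 (n + 2)) x) :
    g.inChart x₀ (extChartAt (𝓡 (n + 2)) x₀ x)
      (mfderiv (𝓡 (n + 2)) (𝓡 (n + 2)) (extChartAt (𝓡 (n + 2)) x₀) x a)
      (mfderiv (𝓡 (n + 2)) (𝓡 (n + 2)) (extChartAt (𝓡 (n + 2)) x₀) x b) = g.form x a b := by
  have h1 : ∀ (x' : M) (a' b' : 𝔼), x' = x → a' = (a : 𝔼) → b' = (b : 𝔼) →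
      g.form x' a' b' = g.form x a b := by
    rintro x' a' b' rfl rfl rfl
    rfl
  exact h1 _ _ _ ((extChartAt (𝓡 (n + 2)) x₀).left_inv hx) (mfderiv_chart_comp hx a)
    (mfderiv_chart_comp hx b)

/-- The geodesic equation does not depend on the chart. -/
theorem geodesicDefect_chart_eq_zero {x₀ x₁ : M} {γ : ℝ → M} {t : ℝ}
    (hγ : ContMDiffAt 𝓘(ℝ, ℝ) (𝓡 (n + 2)) ∞ γ t)
    (h₀ : γ t ∈ (extChartAt (𝓡 (n + 2)) x₀).source)
    (h₁ : γ t ∈ (extChartAt (𝓡 (n + 2)) x₁).source)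
    (h : geodesicDefect (g.inChart x₀) (fun s ↦ extChartAt (𝓡 (n + 2)) x₀ (γ s)) t = 0) :
    geodesicDefect (g.inChart x₁) (fun s ↦ extChartAt (𝓡 (n + 2)) x₁ (γ s)) t = 0 := by
  set κ₀ := extChartAt (𝓡 (n + 2)) x₀ with hκ₀
  set κ₁ := extChartAt (𝓡 (n + 2)) x₁ with hκ₁
  have hsrc : ∀ᶠ s in 𝓝 t, γ s ∈ κ₀.source :=
    hγ.continuousAt.eventually ((isOpen_extChartAt_source x₀).mem_nhds h₀)
  have hψ : ∀ y ∈ κ₀.target, κ₀.symm y ∈ κ₁.source →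
      ContMDiffAt (𝓡 (n + 2)) (𝓡 (n + 2)) ∞ (fun y ↦ κ₁ (κ₀.symm y)) y := fun y hy hy' ↦
    ContMDiffAt.comp y (contMDiffAt_chart hy') (contMDiffAt_chart_symm hy)
  have hψd : ∀ y ∈ κ₀.target, κ₀.symm y ∈ κ₁.source → ∀ a : 𝔼,
      fderiv ℝ (fun y ↦ κ₁ (κ₀.symm y)) y a
        = mfderiv (𝓡 (n + 2)) (𝓡 (n + 2)) κ₁ (κ₀.symm y)
          (mfderiv (𝓡 (n + 2)) (𝓡 (n + 2)) κ₀.symm y a) := by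
    intro y hy hy' a
    have h2 := mfderiv_comp y ((contMDiffAt_chart hy').mdifferentiableAt (by simp))
      ((contMDiffAt_chart_symm hy).mdifferentiableAt (by simp))
    rw [mfderiv_eq_fderiv] at h2
    exact congrArg (fun L : 𝔼 →L[ℝ] 𝔼 ↦ L a) h2
  have htgt := κ₀.map_source h₀
  have hleft := κ₀.left_inv h₀
  have hmem : κ₀.symm (κ₀ (γ t)) ∈ κ₁.source := hleft.symm ▸ h₁
  have hev : ∀ᶠ y in 𝓝 (κ₀ (γ t)), y ∈ κ₀.target ∧ κ₀.symm y ∈ κ₁.source :=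
    ((isOpen_extChartAt_target x₀).eventually_mem htgt).and
      ((contMDiffAt_chart_symm htgt).continuousAt.eventually
        ((isOpen_extChartAt_source x₁).mem_nhds hmem))
  have hc : ContDiffAt ℝ ∞ (fun s ↦ κ₀ (γ s)) t :=
    ((contMDiffAt_chart h₀).comp t hγ).contDiffAt
  have hright : κ₁ (κ₀.symm (κ₀ (γ t))) ∈ κ₁.target := κ₁.map_source hmem
  have key := geodesicDefect_comp (G₀ := g.inChart x₀) (G₁ := g.inChart x₁)
    (ψ := fun y ↦ κ₁ (κ₀.symm y)) (c := fun s ↦ κ₀ (γ s)) (hψ _ htgt hmem).contDiffAt hc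
    ((g.contDiffAt_inChart htgt).differentiableAt (by simp))
    ((g.contDiffAt_inChart hright).differentiableAt (by simp)) (g.inChart_symm x₁)
    (hev.mono fun y hy a b ↦ by
      rw [hψd y hy.1 hy.2, hψd y hy.1 hy.2, g.inChart_mfderiv hy.2]
      rfl)
  have hcongr : (fun s ↦ κ₁ (κ₀.symm (κ₀ (γ s)))) =ᶠ[𝓝 t] fun s ↦ κ₁ (γ s) :=
    hsrc.mono fun s hs ↦ congrArg κ₁ (κ₀.left_inv hs)
  have hdef : geodesicDefect (g.inChart x₁) (fun s ↦ κ₁ (κ₀.symm (κ₀ (γ s)))) t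
      = geodesicDefect (g.inChart x₁) (fun s ↦ κ₁ (γ s)) t := by
    simp only [geodesicDefect]
    rw [hcongr.deriv.deriv_eq, hcongr.deriv_eq, hleft]
  ext w
  -- Chart differentials are invertible, so every test vector w comes from a tangent vector, to
  -- which the transformation rule applies.
  obtain ⟨X, hX⟩ := (isInvertible_mfderiv_extChartAt (I := 𝓡 (n + 2)) h₁).surjective w
  have hw : fderiv ℝ (fun y ↦ κ₁ (κ₀.symm y)) (κ₀ (γ t))
      (mfderiv (𝓡 (n + 2)) (𝓡 (n + 2)) κ₀ (γ t) X) = w := by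
    refine (hψd _ htgt hmem _).trans (Eq.trans ?_ hX)
    have h3 := mfderiv_chart_comp h₀ X
    have h4 : ∀ x', x' = γ t → ∀ a : 𝔼, a = X →
        mfderiv (𝓡 (n + 2)) (𝓡 (n + 2)) κ₁ x' a
          = (mfderiv (𝓡 (n + 2)) (𝓡 (n + 2)) κ₁ (γ t) X : 𝔼) := by
      rintro x' rfl a rfl
      rfl
    exact h4 _ hleft _ h3
  have h5 := key (mfderiv (𝓡 (n + 2)) (𝓡 (n + 2)) κ₀ (γ t) X)
  rw [hw, hdef, h] at h5
  exact h5.symm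

/-- The definition uses a chart that moves with the parameter. Covariance of the equation allows one
fixed chart over an interval, as needed for ODE arguments. -/
theorem isGeodesicOn_iff {γ : ℝ → M} {J : Set ℝ} (hJ : IsOpen J) :
    g.IsGeodesicOn γ J ↔ ContMDiffOn 𝓘(ℝ, ℝ) (𝓡 (n + 2)) ∞ γ J ∧
      ∀ x₀ : M, ∀ t ∈ J, γ t ∈ (extChartAt (𝓡 (n + 2)) x₀).source →
        geodesicDefect (g.inChart x₀) (fun s ↦ extChartAt (𝓡 (n + 2)) x₀ (γ s)) t = 0 := by
  have h0 : ∀ t, (∀ w : 𝔼,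
      g.inChart (γ t) (extChartAt (𝓡 (n + 2)) (γ t) (γ t))
        (deriv (deriv fun s ↦ extChartAt (𝓡 (n + 2)) (γ t) (γ s)) t) w
      + g.christoffel (γ t) (extChartAt (𝓡 (n + 2)) (γ t) (γ t))
        (deriv (fun s ↦ extChartAt (𝓡 (n + 2)) (γ t) (γ s)) t)
        (deriv (fun s ↦ extChartAt (𝓡 (n + 2)) (γ t) (γ s)) t) w = 0) ↔
      geodesicDefect (g.inChart (γ t)) (fun s ↦ extChartAt (𝓡 (n + 2)) (γ t) (γ s)) t = 0 := by
    intro t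
    rw [ContinuousLinearMap.ext_iff]
    refine forall_congr' fun w ↦ ?_
    rw [geodesicDefect, add_apply, christoffelForm_apply]
    rfl
  refine ⟨fun h ↦ ⟨h.1, fun x₀ t ht hx ↦ ?_⟩, fun h ↦ ⟨h.1, fun t ht ↦ (h0 t).2 ?_⟩⟩
  · exact g.geodesicDefect_chart_eq_zero (h.1.contMDiffAt (hJ.mem_nhds ht))
      (mem_extChartAt_source _) hx ((h0 t).1 (h.2 t ht))
  · exact h.2 _ t ht (mem_extChartAt_source _)

/-- The velocity of a geodesic is an integral curve of the geodesic spray. -/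
theorem IsGeodesicOn.hasDerivAt {g : LorentzianMetric n M} {γ : ℝ → M} {J : Set ℝ}
    (h : g.IsGeodesicOn γ J) (hJ : IsOpen J) {x₀ : M} {t : ℝ} (ht : t ∈ J)
    (hx : γ t ∈ (extChartAt (𝓡 (n + 2)) x₀).source) :
    HasDerivAt (fun s ↦ tangentChart x₀ (tangentMap 𝓘(ℝ, ℝ) (𝓡 (n + 2)) γ ⟨s, (1 : ℝ)⟩))
      (geodesicSpray (g.inChart x₀)
        (tangentChart x₀ (tangentMap 𝓘(ℝ, ℝ) (𝓡 (n + 2)) γ ⟨t, (1 : ℝ)⟩))) t := by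
  have hγ : ∀ s ∈ J, ContMDiffAt 𝓘(ℝ, ℝ) (𝓡 (n + 2)) ∞ γ s := fun s hs ↦
    h.1.contMDiffAt (hJ.mem_nhds hs)
  have hev : ∀ᶠ s in 𝓝 t, tangentChart x₀ (tangentMap 𝓘(ℝ, ℝ) (𝓡 (n + 2)) γ ⟨s, (1 : ℝ)⟩)
      = (extChartAt (𝓡 (n + 2)) x₀ (γ s), deriv (fun s ↦ extChartAt (𝓡 (n + 2)) x₀ (γ s)) s) := by
    filter_upwards [hJ.mem_nhds ht, (hγ t ht).continuousAt.eventually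
      ((isOpen_extChartAt_source x₀).mem_nhds hx)] with s hs hs'
    exact tangentChart_tangentMap ((hγ s hs).mdifferentiableAt (by simp)) hs'
  rw [hev.self_of_nhds]
  refine HasDerivAt.congr_of_eventuallyEq ?_ hev
  exact hasDerivAt_geodesicSpray (c := fun s ↦ extChartAt (𝓡 (n + 2)) x₀ (γ s))
    (g.isInvertible_inChart ((extChartAt (𝓡 (n + 2)) x₀).map_source hx))
    ((contMDiffAt_chart hx).comp t (hγ t ht)).contDiffAt
    (((g.isGeodesicOn_iff hJ).1 h).2 x₀ t ht hx)

/-- Integral curves of the geodesic spray are velocities of geodesics. -/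
theorem isGeodesicOn_of_hasDerivAt {x₀ : M} {c : ℝ → 𝔼 × 𝔼} {J : Set ℝ} (hJ : IsOpen J)
    (hc : ∀ t ∈ J, (c t).1 ∈ (extChartAt (𝓡 (n + 2)) x₀).target ∧
      HasDerivAt c (geodesicSpray (g.inChart x₀) (c t)) t) :
    g.IsGeodesicOn (fun t ↦ (extChartAt (𝓡 (n + 2)) x₀).symm (c t).1) J ∧
      ∀ t ∈ J, tangentMap 𝓘(ℝ, ℝ) (𝓡 (n + 2))
        (fun t ↦ (extChartAt (𝓡 (n + 2)) x₀).symm (c t).1) ⟨t, (1 : ℝ)⟩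
          = tangentChartSymm x₀ (c t) := by
  have hsm : ContDiffOn ℝ ∞ c J := contDiffOn_of_hasDerivAt hJ
    (fun t ht ↦ contDiffAt_geodesicSpray (g.contDiffAt_inChart (hc t ht).1)
      (g.isInvertible_inChart (hc t ht).1)) fun t ht ↦ (hc t ht).2
  have hγ : ∀ t ∈ J, ContMDiffAt 𝓘(ℝ, ℝ) (𝓡 (n + 2)) ∞
      (fun t ↦ (extChartAt (𝓡 (n + 2)) x₀).symm (c t).1) t := fun t ht ↦
    (contMDiffAt_chart_symm (hc t ht).1).comp t
      (contDiffAt_fst.comp t (hsm.contDiffAt (hJ.mem_nhds ht))).contMDiffAt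
  have heq : ∀ t ∈ J, (fun s ↦ extChartAt (𝓡 (n + 2)) x₀
      ((extChartAt (𝓡 (n + 2)) x₀).symm (c s).1)) =ᶠ[𝓝 t] fun s ↦ (c s).1 := fun t ht ↦ by
    filter_upwards [hJ.mem_nhds ht] with s hs
    exact (extChartAt (𝓡 (n + 2)) x₀).right_inv (hc s hs).1
  have hdef : ∀ t ∈ J, deriv (fun s ↦ (c s).1) t = (c t).2 ∧
      geodesicDefect (g.inChart x₀) (fun s ↦ (c s).1) t = 0 := fun t ht ↦
    geodesicDefect_eq_zero (g.isInvertible_inChart (hc t ht).1)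
      ((hJ.eventually_mem ht).mono fun s hs ↦ (hc s hs).2)
  have hsrc : ∀ t ∈ J, (extChartAt (𝓡 (n + 2)) x₀).symm (c t).1
      ∈ (extChartAt (𝓡 (n + 2)) x₀).source := fun t ht ↦
    (extChartAt (𝓡 (n + 2)) x₀).map_target (hc t ht).1
  have hdef' : ∀ t ∈ J, geodesicDefect (g.inChart x₀) (fun s ↦ extChartAt (𝓡 (n + 2)) x₀
      ((extChartAt (𝓡 (n + 2)) x₀).symm (c s).1)) t = 0 := fun t ht ↦ by
    rw [← (hdef t ht).2]
    simp only [geodesicDefect]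
    rw [(heq t ht).deriv.deriv_eq, (heq t ht).deriv_eq,
      (extChartAt (𝓡 (n + 2)) x₀).right_inv (hc t ht).1]
  refine ⟨(g.isGeodesicOn_iff hJ).2 ⟨fun t ht ↦ (hγ t ht).contMDiffWithinAt,
    fun x₁ t ht hx ↦ g.geodesicDefect_chart_eq_zero (hγ t ht) (hsrc t ht) hx (hdef' t ht)⟩,
    fun t ht ↦ ?_⟩
  have h1 := tangentChart_tangentMap ((hγ t ht).mdifferentiableAt (by simp)) (hsrc t ht)
  rw [(heq t ht).deriv_eq, (hdef t ht).1, (extChartAt (𝓡 (n + 2)) x₀).right_inv (hc t ht).1] at h1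
  rw [← tangentChartSymm_tangentChart (x₀ := x₀) (v := tangentMap 𝓘(ℝ, ℝ) (𝓡 (n + 2))
    (fun t ↦ (extChartAt (𝓡 (n + 2)) x₀).symm (c t).1) ⟨t, (1 : ℝ)⟩) (hsrc t ht), h1]

end LorentzianMetric

end Geodesics

/-! ### Openness of the submersion condition. -/

section Submersion

/-- A right inverse R of the differential at x still makes the composite with R invertible at nearby
points. -/
theorem eventually_surjective_fderiv {X Y : Type*} [NormedAddCommGroup X] [NormedSpace ℝ X]
    [NormedAddCommGroup Y] [NormedSpace ℝ Y] [FiniteDimensional ℝ Y] {f : X → Y} {x : X}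
    (hf : ContDiffAt ℝ ∞ f x) (hs : Function.Surjective (fderiv ℝ f x)) :
    ∀ᶠ w in 𝓝 x, Function.Surjective (fderiv ℝ f w) := by
  have : CompleteSpace Y := FiniteDimensional.complete ℝ Y
  obtain ⟨R, hR⟩ := (fderiv ℝ f x).exists_comp_eq_id hs
  have h1 : ContinuousAt (fun w ↦ (fderiv ℝ f w).comp R) x :=
    ((hf.fderiv_right (m := ∞) (by simp)).clm_comp contDiffAt_const).continuousAt
  have h2 := (ContinuousLinearEquiv.refl ℝ Y).nhds
  have h3 : ((ContinuousLinearEquiv.refl ℝ Y : Y ≃L[ℝ] Y) : Y →L[ℝ] Y)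
      = (fderiv ℝ f x).comp R := hR.symm
  rw [h3] at h2
  filter_upwards [h1.eventually h2] with w hw
  obtain ⟨e, he⟩ := hw
  intro y
  refine ⟨R (e.symm y), ?_⟩
  have := congrArg (fun L : Y →L[ℝ] Y ↦ L (e.symm y)) he
  simpa using this.symm

variable {E : Type*} [NormedAddCommGroup E] [NormedSpace ℝ E]
  {B : Type*} [NormedAddCommGroup B] [NormedSpace ℝ B]

local instance : NormedAddCommGroup (E →L[ℝ] E →L[ℝ] ℝ) :=
  ContinuousLinearMap.toNormedAddCommGroup

local instance : NormedSpace ℝ (E →L[ℝ] E →L[ℝ] ℝ) :=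
  ContinuousLinearMap.toNormedSpace

/-- Only surjectivity has to be spread from `z₀` to a neighbourhood. On the cone alone it is not an
open condition in the ambient space, so it is replaced by surjectivity of (dE, dp). -/
theorem exists_isNullModel [FiniteDimensional ℝ B] {G : E → E →L[ℝ] E →L[ℝ] ℝ} {p : E × E → B}
    {W₀ : Set (E × E)} (hW₀ : IsOpen W₀) (hsymm : ∀ y a b, G y a b = G y b a)
    (hG : ∀ z ∈ W₀, ContDiffAt ℝ ∞ G z.1) (hnd : ∀ z ∈ W₀, ∀ a, (∀ b, G z.1 a b = 0) → a = 0)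
    (hne : ∀ z ∈ W₀, z.2 ≠ 0) (hp : ∀ z ∈ W₀, ContDiffAt ℝ ∞ p z)
    (hspray : ∀ z ∈ W₀, metricEnergy G z = 0 → fderiv ℝ p z (geodesicSpray G z) = 0)
    (heuler : ∀ z ∈ W₀, metricEnergy G z = 0 → fderiv ℝ p z (0, z.2) = 0)
    (hdim : Module.finrank ℝ B + 3 = 2 * Module.finrank ℝ E) {z₀ : E × E} (hz₀ : z₀ ∈ W₀)
    (hsurj : ∀ η, ∃ ξ, fderiv ℝ (metricEnergy G) z₀ ξ = 0 ∧ fderiv ℝ p z₀ ξ = η) :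
    ∃ W ⊆ W₀, z₀ ∈ W ∧ IsNullModel G p W := by
  have hE : ∀ z ∈ W₀, ContDiffAt ℝ ∞ (metricEnergy G) z := fun z hz ↦
    contDiffAt_metricEnergy (hG z hz)
  have hd : ∀ z ∈ W₀, fderiv ℝ (fun z ↦ (metricEnergy G z, p z)) z
      = (fderiv ℝ (metricEnergy G) z).prod (fderiv ℝ p z) := fun z hz ↦
    (((hE z hz).differentiableAt (by simp)).hasFDerivAt.prodMk
      ((hp z hz).differentiableAt (by simp)).hasFDerivAt).fderiv
  have hprod₀ : Function.Surjective (fderiv ℝ (fun z ↦ (metricEnergy G z, p z)) z₀) := by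
    rw [hd z₀ hz₀]
    obtain ⟨w, hw⟩ : ∃ w, G z₀.1 z₀.2 w ≠ 0 := by
      by_contra! hcon
      exact hne z₀ hz₀ (hnd z₀ hz₀ _ hcon)
    refine surjective_prod_of_ker (x := (0, w)) ?_ hsurj
    rw [fderiv_metricEnergy hsymm ((hG z₀ hz₀).differentiableAt (by simp))]
    simpa using hw
  obtain ⟨W, hW, hWo, hzW⟩ := eventually_nhds_iff.1 ((hW₀.eventually_mem hz₀).and
    (eventually_surjective_fderiv ((hE z₀ hz₀).prodMk (hp z₀ hz₀)) hprod₀))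
  exact ⟨W, fun z hz ↦ (hW z hz).1, hzW, {
    isOpen := hWo
    symm := hsymm
    contDiffAt_metric := fun z hz ↦ hG z (hW z hz).1
    nondegenerate := fun z hz ↦ hnd z (hW z hz).1
    ne_zero := fun z hz ↦ hne z (hW z hz).1
    contDiffAt := fun z hz ↦ hp z (hW z hz).1
    surjective := fun z hz _ η ↦ by
      obtain ⟨ξ, hξ⟩ := (hW z hz).2 (0, η)
      rw [hd z (hW z hz).1] at hξ
      exact ⟨ξ, congrArg Prod.fst hξ, congrArg Prod.snd hξ⟩
    spray := fun z hz ↦ hspray z (hW z hz).1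
    euler := fun z hz ↦ heuler z (hW z hz).1
    finrank := hdim }⟩

end Submersion

/-! ### The null cone and the projection to 𝒩 in charts. -/

section NullCone

variable {n : ℕ} {M : Type*} [TopologicalSpace M]
  [ChartedSpace (EuclideanSpace ℝ (Fin (n + 2))) M] [IsManifold (𝓡 (n + 2)) ∞ M]
  (g : LorentzianMetric n M)

local notation "𝔼" => EuclideanSpace ℝ (Fin (n + 2))

local instance : NormedAddCommGroup (𝔼 →L[ℝ] 𝔼 →L[ℝ] ℝ) :=
  ContinuousLinearMap.toNormedAddCommGroup

local instance : NormedSpace ℝ (𝔼 →L[ℝ] 𝔼 →L[ℝ] ℝ) :=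
  ContinuousLinearMap.toNormedSpace

namespace LorentzianMetric

theorem tangentChartSymm_mem_nullCone_iff {x₀ : M} {z : 𝔼 × 𝔼}
    (hz : z.1 ∈ (extChartAt (𝓡 (n + 2)) x₀).target) :
    tangentChartSymm x₀ z ∈ g.nullCone ↔ z.2 ≠ 0 ∧ metricEnergy (g.inChart x₀) z = 0 := by
  refine and_congr (not_congr ⟨fun h ↦ ?_, fun h ↦ ?_⟩) Iff.rfl
  · have h1 := mfderiv_chart_symm_comp hz z.2
    have h2 : mfderiv (𝓡 (n + 2)) (𝓡 (n + 2)) (extChartAt (𝓡 (n + 2)) x₀).symm z.1 z.2 = 0 := h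
    rw [h2, map_zero] at h1
    exact h1.symm
  · change mfderiv (𝓡 (n + 2)) (𝓡 (n + 2)) (extChartAt (𝓡 (n + 2)) x₀).symm z.1 z.2 = 0
    exact (congrArg (mfderiv (𝓡 (n + 2)) (𝓡 (n + 2)) (extChartAt (𝓡 (n + 2)) x₀).symm z.1) h).trans
      (map_zero _)

omit [IsManifold (𝓡 (n + 2)) ∞ M] in
theorem tangentChart_mem_target {x₀ : M} {v : TangentBundle (𝓡 (n + 2)) M}
    (hv : v.1 ∈ (extChartAt (𝓡 (n + 2)) x₀).source) :
    (tangentChart x₀ v).1 ∈ (extChartAt (𝓡 (n + 2)) x₀).target :=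
  (extChartAt (𝓡 (n + 2)) x₀).map_source hv

theorem mem_nullCone_iff {x₀ : M} {v : TangentBundle (𝓡 (n + 2)) M}
    (hv : v.1 ∈ (extChartAt (𝓡 (n + 2)) x₀).source) :
    v ∈ g.nullCone ↔
      (tangentChart x₀ v).2 ≠ 0 ∧ metricEnergy (g.inChart x₀) (tangentChart x₀ v) = 0 := by
  rw [← g.tangentChartSymm_mem_nullCone_iff (tangentChart_mem_target hv),
    tangentChartSymm_tangentChart hv]

theorem toNullGeodesic_eq {γ : ℝ → M} {J : Set ℝ} (hJ : IsOpen J) (hJ' : J.OrdConnected)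
    (hγ : g.IsGeodesicOn γ J) {s t : ℝ} (hs : s ∈ J) (ht : t ∈ J) (v w : g.nullCone) {b : ℝ}
    (hb : b ≠ 0) (hv : tangentMap 𝓘(ℝ, ℝ) (𝓡 (n + 2)) γ ⟨s, (1 : ℝ)⟩ = v.1)
    (hw : tangentMap 𝓘(ℝ, ℝ) (𝓡 (n + 2)) γ ⟨t, (1 : ℝ)⟩ = ⟨w.1.1, b • w.1.2⟩) :
    g.toNullGeodesic v = g.toNullGeodesic w :=
  Quot.sound ⟨γ, J, hJ, hJ', hγ, s, hs, t, ht, 1, b, one_ne_zero, hb,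
    by rw [hv, one_smul], hw⟩

/-- The geodesic flow near a null vector. -/
theorem exists_nullGeodesic {x₀ : M} {z : 𝔼 × 𝔼}
    (hz : z.1 ∈ (extChartAt (𝓡 (n + 2)) x₀).target) (hz0 : tangentChartSymm x₀ z ∈ g.nullCone) :
    ∃ c : ℝ → 𝔼 × 𝔼, c 0 = z ∧ HasDerivAt c (geodesicSpray (g.inChart x₀) z) 0 ∧
      (∀ᶠ t in 𝓝 0, ∃ h : tangentChartSymm x₀ (c t) ∈ g.nullCone,
        g.toNullGeodesic ⟨_, h⟩ = g.toNullGeodesic ⟨_, hz0⟩) ∧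
      ∀ (w : g.nullCone) (b : ℝ), b ≠ 0 → tangentChartSymm x₀ z = ⟨w.1.1, b • w.1.2⟩ →
        g.toNullGeodesic ⟨_, hz0⟩ = g.toNullGeodesic w := by
  obtain ⟨hz2, hzE⟩ := (g.tangentChartSymm_mem_nullCone_iff hz).1 hz0
  have hopen : IsOpen {w : 𝔼 × 𝔼 | w.1 ∈ (extChartAt (𝓡 (n + 2)) x₀).target ∧ w.2 ≠ 0} :=
    ((isOpen_extChartAt_target x₀).preimage continuous_fst).inter
      (isOpen_ne.preimage continuous_snd)
  obtain ⟨c, hc0, ε, hε, -, hc⟩ := exists_integralCurve (X := geodesicSpray (g.inChart x₀)) hopen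
    ⟨hz, hz2⟩ fun w hw ↦ contDiffAt_geodesicSpray (g.contDiffAt_inChart hw.1)
      (g.isInvertible_inChart hw.1)
  have h0 : (0 : ℝ) ∈ Set.Ioo (-ε) ε := ⟨by linarith, hε⟩
  obtain ⟨hγ, hT⟩ := g.isGeodesicOn_of_hasDerivAt isOpen_Ioo
    fun t ht ↦ ⟨(hc t ht).1.1, (hc t ht).2⟩
  have hE : ∀ t ∈ Set.Ioo (-ε) ε, tangentChartSymm x₀ (c t) ∈ g.nullCone := fun t ht ↦ by
    refine (g.tangentChartSymm_mem_nullCone_iff (hc t ht).1.1).2 ⟨(hc t ht).1.2, ?_⟩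
    rw [← hzE, ← hc0]
    exact metricEnergy_eq (g.inChart_symm x₀) isOpen_Ioo Set.ordConnected_Ioo.isPreconnected
      (fun t ht ↦ g.contDiffAt_inChart (hc t ht).1.1)
      (fun t ht ↦ g.isInvertible_inChart (hc t ht).1.1) (fun t ht ↦ (hc t ht).2) ht h0
  have hT0 : tangentMap 𝓘(ℝ, ℝ) (𝓡 (n + 2))
      (fun t ↦ (extChartAt (𝓡 (n + 2)) x₀).symm (c t).1) ⟨0, (1 : ℝ)⟩
        = tangentChartSymm x₀ z := by rw [hT 0 h0, hc0]
  refine ⟨c, hc0, hc0 ▸ (hc 0 h0).2, ?_, fun w b hb hw ↦ ?_⟩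
  · filter_upwards [isOpen_Ioo.mem_nhds h0] with t ht
    refine ⟨hE t ht, g.toNullGeodesic_eq isOpen_Ioo Set.ordConnected_Ioo hγ ht h0 _ _ one_ne_zero
      (hT t ht) ?_⟩
    rw [hT0, one_smul]
  · exact g.toNullGeodesic_eq isOpen_Ioo Set.ordConnected_Ioo hγ h0 h0 _ _ hb hT0 (hT0.trans hw)

theorem smul_mem_nullCone {v : TangentBundle (𝓡 (n + 2)) M} (hv : v ∈ g.nullCone) {b : ℝ}
    (hb : b ≠ 0) : (⟨v.1, b • v.2⟩ : TangentBundle (𝓡 (n + 2)) M) ∈ g.nullCone := by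
  refine ⟨smul_ne_zero hb hv.1, ?_⟩
  simp only [map_smul, smul_apply, hv.2, smul_zero]

/-- The relation requires an actual geodesic, so local existence is used: both vectors are multiples
of its velocity at parameter 0. -/
theorem toNullGeodesic_smul (v : g.nullCone) {b : ℝ} (hb : b ≠ 0) :
    g.toNullGeodesic ⟨_, g.smul_mem_nullCone v.2 hb⟩ = g.toNullGeodesic v := by
  have hsrc := mem_extChartAt_source (I := 𝓡 (n + 2)) v.1.1
  have hv := tangentChartSymm_tangentChart (x₀ := v.1.1) hsrc
  have hv0 : tangentChartSymm v.1.1 (tangentChart v.1.1 v.1) ∈ g.nullCone := by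
    rw [hv]
    exact v.2
  obtain ⟨c, -, -, -, h⟩ := g.exists_nullGeodesic (tangentChart_mem_target hsrc) hv0
  rw [← h v 1 one_ne_zero (by rw [one_smul]; exact hv)]
  refine (h _ b⁻¹ (inv_ne_zero hb) ?_).symm
  rw [smul_smul, inv_mul_cancel₀ hb, one_smul]
  exact hv

variable [ChartedSpace (EuclideanSpace ℝ (Fin (2 * n + 1))) g.NullGeodesicSpace]
  [IsManifold (𝓡 (2 * n + 1)) ∞ g.NullGeodesicSpace] {g}

local notation "𝔹" => EuclideanSpace ℝ (Fin (2 * n + 1))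

/-- The model `p`, `W` of the null cone represents the projection to the space of null geodesics
in the chart at `x₀` and the chart `φ`. -/
structure Represents (g : LorentzianMetric n M) (φ : OpenPartialHomeomorph g.NullGeodesicSpace 𝔹)
    (x₀ : M) (p : 𝔼 × 𝔼 → 𝔹) (W : Set (𝔼 × 𝔼)) : Prop extends
    IsNullModel (g.inChart x₀) p W where
  mem_target : ∀ z ∈ W, z.1 ∈ (extChartAt (𝓡 (n + 2)) x₀).target
  mem_source : ∀ z ∈ W, ∀ h : tangentChartSymm x₀ z ∈ g.nullCone,
    g.toNullGeodesic ⟨_, h⟩ ∈ φ.source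
  eq : ∀ z ∈ W, ∀ h : tangentChartSymm x₀ z ∈ g.nullCone, p z = φ (g.toNullGeodesic ⟨_, h⟩)

omit [IsManifold (𝓡 (2 * n + 1)) ∞ g.NullGeodesicSpace] in
-- The model is the extension P read in charts. Off the cone P is an arbitrary extension; on the
-- cone it is constant along the geodesic flow and along rescalings, so its differential kills the
-- spray and the Euler field.
theorem IsQuotientManifold.exists_represents (hg : g.IsQuotientManifold)
    {φ : OpenPartialHomeomorph g.NullGeodesicSpace 𝔹} (hφ : IsSmoothChart (F := 𝔹) φ)
    (v : g.nullCone) (hv : g.toNullGeodesic v ∈ φ.source) :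
    ∃ p W, g.Represents φ v.1.1 p W ∧ tangentChart v.1.1 v.1 ∈ W := by
  obtain ⟨U, P, hU, hvU, hP, hPv, hsurj⟩ := hg v
  set x₀ := v.1.1 with hx₀
  have hsrc := mem_extChartAt_source (I := 𝓡 (n + 2)) x₀
  set z₀ := tangentChart x₀ v.1 with hz₀
  have hΨz₀ : tangentChartSymm x₀ z₀ = v.1 := tangentChartSymm_tangentChart hsrc
  obtain ⟨hz₀2, hz₀E⟩ := (g.mem_nullCone_iff hsrc).1 v.2
  have hz₀t : z₀.1 ∈ (extChartAt (𝓡 (n + 2)) x₀).target := tangentChart_mem_target hsrc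
  let W₀ : Set (𝔼 × 𝔼) := {z | z.1 ∈ (extChartAt (𝓡 (n + 2)) x₀).target ∧ z.2 ≠ 0 ∧
    tangentChartSymm x₀ z ∈ U ∧ P (tangentChartSymm x₀ z) ∈ φ.source}
  let p : 𝔼 × 𝔼 → 𝔹 := fun z ↦ φ (P (tangentChartSymm x₀ z))
  have hPΨ : ∀ z ∈ W₀, ContMDiffAt 𝓘(ℝ, 𝔼 × 𝔼) (𝓡 (2 * n + 1)) ∞
      (fun z ↦ P (tangentChartSymm x₀ z)) z := fun z hz ↦
    (hP.contMDiffAt (hU.mem_nhds hz.2.2.1)).comp z (contMDiffAt_tangentChartSymm hz.1)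
  have hW₀ : IsOpen W₀ := by
    rw [isOpen_iff_mem_nhds]
    intro z hz
    filter_upwards [((isOpen_extChartAt_target x₀).preimage continuous_fst).mem_nhds hz.1,
      (isOpen_ne.preimage continuous_snd).mem_nhds hz.2.1,
      (contMDiffAt_tangentChartSymm hz.1).continuousAt.eventually (hU.mem_nhds hz.2.2.1),
      (hPΨ z hz).continuousAt.eventually (φ.open_source.mem_nhds hz.2.2.2)]
      with w h1 h2 h3 h4 using ⟨h1, h2, h3, h4⟩
  have hpd : ∀ z ∈ W₀, ContDiffAt ℝ ∞ p z := fun z hz ↦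
    ((hφ.contMDiffAt hz.2.2.2).comp z (hPΨ z hz)).contDiffAt
  have hPv0 : P v.1 = g.toNullGeodesic v := hPv v hvU
  have hz₀W : z₀ ∈ W₀ := ⟨hz₀t, hz₀2, hΨz₀.symm ▸ hvU, by rw [hΨz₀, hPv0]; exact hv⟩
  have hEd : ∀ z ∈ W₀, ContDiffAt ℝ ∞ (metricEnergy (g.inChart x₀)) z := fun z hz ↦
    contDiffAt_metricEnergy (g.contDiffAt_inChart hz.1)
  have hsurj₀ : ∀ η, ∃ ξ, fderiv ℝ (metricEnergy (g.inChart x₀)) z₀ ξ = 0 ∧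
      fderiv ℝ p z₀ ξ = η := by
    intro η
    obtain ⟨η', hη'⟩ := (hφ.isInvertible_chartDiff (hPv0.symm ▸ hv : P v.1 ∈ φ.source)).surjective η
    obtain ⟨ξ, hξ, hξ'⟩ := hsurj η'
    refine ⟨tangentChartDiff x₀ v.1 ξ, ?_, ?_⟩
    · rw [fderiv_tangentChartDiff hsrc ((hEd z₀ hz₀W).differentiableAt (by simp))
        (K := fun w : TangentBundle (𝓡 (n + 2)) M ↦ g.form w.1 w.2 w.2) (fun _ ↦ rfl)]
      exact hξ
    · rw [fderiv_tangentChartDiff hsrc ((hpd z₀ hz₀W).differentiableAt (by simp))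
        (K := fun w ↦ φ (P w)) (fun _ ↦ rfl)]
      have h3 := mfderiv_comp v.1 (I' := 𝓡 (2 * n + 1)) (g := φ) (f := P) (I'' := 𝓘(ℝ, 𝔹))
        ((hφ.contMDiffAt (hPv0.symm ▸ hv : P v.1 ∈ φ.source)).mdifferentiableAt (by simp))
        ((hP.contMDiffAt (hU.mem_nhds hvU)).mdifferentiableAt (by simp))
      rw [← hη', ← hξ']
      exact congrArg (fun L : TangentSpace (𝓡 (n + 2)).tangent v.1 →L[ℝ] 𝔹 ↦ L ξ) h3
  have hnd : ∀ z ∈ W₀, ∀ a, (∀ b, g.inChart x₀ z.1 a b = 0) → a = 0 := fun z hz a ha ↦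
    g.inChart_nondegenerate hz.1 ha
  have hnull : ∀ z ∈ W₀, metricEnergy (g.inChart x₀) z = 0 →
      tangentChartSymm x₀ z ∈ g.nullCone := fun z hz h0 ↦
    (g.tangentChartSymm_mem_nullCone_iff hz.1).2 ⟨hz.2.1, h0⟩
  have hpeq : ∀ z ∈ W₀, ∀ h : tangentChartSymm x₀ z ∈ g.nullCone,
      p z = φ (g.toNullGeodesic ⟨_, h⟩) := fun z hz h ↦ congrArg φ (hPv ⟨_, h⟩ hz.2.2.1)
  -- Along a curve of null vectors representing one geodesic the model map is constant, so its
  -- differential kills the initial velocity.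
  have hflow : ∀ z, ∀ hz : z ∈ W₀, ∀ h0 : metricEnergy (g.inChart x₀) z = 0,
      ∀ (c : ℝ → 𝔼 × 𝔼) (ξ : 𝔼 × 𝔼),
      c 0 = z → HasDerivAt c ξ 0 → (∀ᶠ t in 𝓝 0, ∃ h : tangentChartSymm x₀ (c t) ∈ g.nullCone,
        g.toNullGeodesic ⟨_, h⟩ = g.toNullGeodesic ⟨_, hnull z hz h0⟩) → fderiv ℝ p z ξ = 0 := by
    intro z hz h0 c ξ hc0 hc hev
    have h1 : HasDerivAt (fun t ↦ p (c t)) (fderiv ℝ p z ξ) 0 := by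
      have h2 : HasFDerivAt p (fderiv ℝ p z) (c 0) := by
        rw [hc0]
        exact ((hpd z hz).differentiableAt (by simp)).hasFDerivAt
      exact h2.comp_hasDerivAt 0 hc
    have h3 : (fun t ↦ p (c t)) =ᶠ[𝓝 0] fun _ ↦ p z := by
      have h4 : ∀ᶠ t in 𝓝 0, c t ∈ W₀ := hc.continuousAt.eventually
        (hc0.symm ▸ hW₀.mem_nhds hz)
      filter_upwards [h4, hev] with t h5 ⟨h6, h7⟩
      rw [hpeq _ h5 h6, h7, hpeq z hz (hnull z hz h0)]
    exact h1.unique ((hasDerivAt_const 0 (p z)).congr_of_eventuallyEq h3)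
  have hspray : ∀ z ∈ W₀, metricEnergy (g.inChart x₀) z = 0 →
      fderiv ℝ p z (geodesicSpray (g.inChart x₀) z) = 0 := fun z hz h0 ↦ by
    obtain ⟨c, hc0, hc, hev, -⟩ := g.exists_nullGeodesic hz.1 (hnull z hz h0)
    exact hflow z hz h0 c _ hc0 hc hev
  have heuler : ∀ z ∈ W₀, metricEnergy (g.inChart x₀) z = 0 → fderiv ℝ p z (0, z.2) = 0 :=
    fun z hz h0 ↦ by
      have hd : HasDerivAt (fun t : ℝ ↦ (z.1, (1 + t) • z.2)) ((0 : 𝔼), z.2) 0 := by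
        have h1 : HasDerivAt (fun t : ℝ ↦ (1 + t) • z.2) ((1 : ℝ) • z.2) 0 :=
          ((hasDerivAt_id (0 : ℝ)).const_add 1).smul_const z.2
        rw [one_smul] at h1
        exact (hasDerivAt_const (0 : ℝ) z.1).prodMk h1
      refine hflow z hz h0 _ _ (by simp) hd ?_
      have hne : ∀ᶠ t : ℝ in 𝓝 0, 1 + t ≠ 0 := by
        have : ContinuousAt (fun t : ℝ ↦ 1 + t) 0 := by fun_prop
        exact this.eventually_ne (by simp)
      filter_upwards [hne] with t ht
      have h1 : tangentChartSymm x₀ (z.1, (1 + t) • z.2)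
          = ⟨(tangentChartSymm x₀ z).1, (1 + t) • (tangentChartSymm x₀ z).2⟩ :=
        tangentBundle_ext rfl (map_smul _ _ _)
      have h2 := g.toNullGeodesic_smul ⟨_, hnull z hz h0⟩ ht
      have h3 := g.smul_mem_nullCone (hnull z hz h0) ht
      exact ⟨by rw [h1]; exact h3, by simp only [h1]; exact h2⟩
  obtain ⟨W, hW, hzW, hmodel⟩ := exists_isNullModel hW₀ (g.inChart_symm x₀)
    (fun z hz ↦ g.contDiffAt_inChart hz.1) hnd (fun z hz ↦ hz.2.1) hpd hspray heuler
    (by simp only [finrank_euclideanSpace, Fintype.card_fin]; ring) hz₀W hsurj₀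
  exact ⟨p, W, {
    toIsNullModel := hmodel
    mem_target := fun z hz ↦ (hW hz).1
    mem_source := fun z hz h ↦ by
      rw [← hPv ⟨_, h⟩ (hW hz).2.2.1]
      exact (hW hz).2.2.2
    eq := fun z hz h ↦ hpeq z (hW hz) h }, hzW⟩

end LorentzianMetric

end NullCone

/-! ### Velocities of abreast variations in a chart of 𝒩. -/

section ContactVelocities

variable {n : ℕ} {M : Type*} [TopologicalSpace M]
  [ChartedSpace (EuclideanSpace ℝ (Fin (n + 2))) M] [IsManifold (𝓡 (n + 2)) ∞ M]
  {g : LorentzianMetric n M}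

local notation "𝔼" => EuclideanSpace ℝ (Fin (n + 2))
local notation "𝔹" => EuclideanSpace ℝ (Fin (2 * n + 1))

local instance : NormedAddCommGroup (𝔼 →L[ℝ] 𝔼 →L[ℝ] ℝ) :=
  ContinuousLinearMap.toNormedAddCommGroup

local instance : NormedSpace ℝ (𝔼 →L[ℝ] 𝔼 →L[ℝ] ℝ) :=
  ContinuousLinearMap.toNormedSpace

namespace LorentzianMetric

/-- The velocities, in the chart `φ`, of the abreast variations of the null vector `v`. -/
def contactVelocities (φ : OpenPartialHomeomorph g.NullGeodesicSpace 𝔹)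
    (v : TangentBundle (𝓡 (n + 2)) M) : Set 𝔹 :=
  {a | ∃ (c : ℝ → g.nullCone) (ε : ℝ), 0 < ε ∧
    ContMDiffOn 𝓘(ℝ, ℝ) (𝓡 (n + 2)).tangent ∞
      (fun s ↦ (c s : TangentBundle (𝓡 (n + 2)) M)) (Set.Ioo (-ε) ε) ∧
    g.form (c 0).1.1 (mfderiv 𝓘(ℝ, ℝ) (𝓡 (n + 2)) (fun s ↦ (c s).1.1) 0 (1 : ℝ))
      (c 0).1.2 = 0 ∧ (c 0).1 = v ∧
    HasDerivAt (fun s ↦ φ (g.toNullGeodesic (c s))) a 0}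

theorem contactVelocities_eq_empty {φ : OpenPartialHomeomorph g.NullGeodesicSpace 𝔹}
    {v : TangentBundle (𝓡 (n + 2)) M} (hv : v ∉ g.nullCone) :
    contactVelocities φ v = ∅ := by
  refine Set.eq_empty_of_forall_notMem fun a ⟨c, ε, _, _, _, h, _⟩ ↦ hv ?_
  rw [← h]
  exact (c 0).2

/-- Multiply the whole variation by b: its foot points, and hence its Jacobi field, do not change,
nor do the geodesics it represents. -/
theorem contactVelocities_smul_subset {φ : OpenPartialHomeomorph g.NullGeodesicSpace 𝔹}
    {v : TangentBundle (𝓡 (n + 2)) M} {b : ℝ} (hb : b ≠ 0) :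
    contactVelocities φ v ⊆ contactVelocities φ ⟨v.1, b • v.2⟩ := by
  rintro a ⟨c, ε, hε, hc, habr, rfl, ha⟩
  refine ⟨fun s ↦ ⟨_, g.smul_mem_nullCone (c s).2 hb⟩, ε, hε, fun s hs ↦ ?_, ?_, rfl, ?_⟩
  · have hcs := hc.contMDiffAt (isOpen_Ioo.mem_nhds hs)
    have hsrc := mem_extChartAt_source (I := 𝓡 (n + 2)) (c s).1.1
    have hz := tangentChart_mem_target (v := (c s).1) hsrc
    have h1 := (contMDiffAt_tangentChart (x₀ := (c s).1.1) (v := (c s).1) hsrc).comp s hcs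
    let m : 𝔼 × 𝔼 → 𝔼 × 𝔼 := fun z ↦ (z.1, b • z.2)
    have hm : ContDiff ℝ ∞ m := contDiff_fst.prodMk (contDiff_snd.const_smul b)
    have h2 : ContMDiffAt 𝓘(ℝ, ℝ) (𝓡 (n + 2)).tangent ∞ (fun s' ↦ tangentChartSymm (c s).1.1
        (m (tangentChart (c s).1.1 (c s').1))) s :=
      (contMDiffAt_tangentChartSymm (z := m (tangentChart (c s).1.1 (c s).1)) hz).comp s
        (hm.contMDiff.contMDiffAt.comp s h1)
    refine (h2.congr_of_eventuallyEq ?_).contMDiffWithinAt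
    have h3 : ContinuousAt (fun s' ↦ (c s').1.1) s :=
      (FiberBundle.continuous_proj 𝔼 (TangentSpace (𝓡 (n + 2)))).continuousAt.comp
        hcs.continuousAt
    filter_upwards [h3.eventually ((isOpen_extChartAt_source (I := 𝓡 (n + 2)) _).mem_nhds hsrc)]
      with s' hs'
    have h4 := tangentChartSymm_tangentChart (x₀ := (c s).1.1) (v := (c s').1) hs'
    have h5 : tangentChartSymm (c s).1.1 (m (tangentChart (c s).1.1 (c s').1))
        = ⟨(tangentChartSymm (c s).1.1 (tangentChart (c s).1.1 (c s').1)).1,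
          b • (tangentChartSymm (c s).1.1 (tangentChart (c s).1.1 (c s').1)).2⟩ :=
      tangentBundle_ext rfl (map_smul _ _ _)
    rw [h5, h4]
  · simp only [map_smul, habr, smul_zero]
  · simp only [g.toNullGeodesic_smul _ hb]
    exact ha

theorem contactVelocities_smul {φ : OpenPartialHomeomorph g.NullGeodesicSpace 𝔹}
    {v : TangentBundle (𝓡 (n + 2)) M} {b : ℝ} (hb : b ≠ 0) :
    contactVelocities φ ⟨v.1, b • v.2⟩ = contactVelocities φ v := by
  refine (contactVelocities_smul_subset hb).antisymm' ?_
  have h := contactVelocities_smul_subset (φ := φ) (v := ⟨v.1, b • v.2⟩) (inv_ne_zero hb)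
  simp only [smul_smul, inv_mul_cancel₀ hb, one_smul] at h
  exact h

/-- A variation read in the tangent chart has initial velocity tangent to the cone, and abreastness
says that α vanishes on it. Conversely, a smooth section of the projection lifts a straight line in
the chart of 𝒩 to a variation. -/
theorem Represents.contactVelocities_eq {φ : OpenPartialHomeomorph g.NullGeodesicSpace 𝔹}
    {x₀ : M} {p : 𝔼 × 𝔼 → 𝔹} {W : Set (𝔼 × 𝔼)}
    (h : g.Represents φ x₀ p W) {z : 𝔼 × 𝔼} (hz : z ∈ W)
    (h0 : metricEnergy (g.inChart x₀) z = 0) :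
    contactVelocities φ (tangentChartSymm x₀ z) = abreastVelocities (g.inChart x₀) p z := by
  have hzt := h.mem_target z hz
  have hnull : ∀ w ∈ W, metricEnergy (g.inChart x₀) w = 0 → tangentChartSymm x₀ w ∈ g.nullCone :=
    fun w hw hw0 ↦ (g.tangentChartSymm_mem_nullCone_iff (h.mem_target w hw)).2
      ⟨h.ne_zero w hw, hw0⟩
  have hEd := ((h.contDiffAt_energy hz).differentiableAt (by simp)).hasFDerivAt
  have hpd := ((h.contDiffAt z hz).differentiableAt (by simp)).hasFDerivAt
  ext a
  constructor
  · rintro ⟨c, ε, hε, hc, habr, hc0, ha⟩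
    have hmem : (0 : ℝ) ∈ Set.Ioo (-ε) ε := ⟨by linarith, hε⟩
    have hc' := hc.contMDiffAt (isOpen_Ioo.mem_nhds hmem)
    have hsrc0 : (c 0).1.1 ∈ (extChartAt (𝓡 (n + 2)) x₀).source := by
      rw [hc0]
      exact (extChartAt (𝓡 (n + 2)) x₀).map_target hzt
    have hπ : ContMDiffAt 𝓘(ℝ, ℝ) (𝓡 (n + 2)) ∞ (fun s ↦ (c s).1.1) 0 :=
      (contMDiffAt_proj (TangentSpace (𝓡 (n + 2)))).comp 0 hc'
    have hζ' : ContMDiffAt 𝓘(ℝ, ℝ) 𝓘(ℝ, 𝔼 × 𝔼) ∞ (fun s ↦ tangentChart x₀ (c s).1) 0 :=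
      (contMDiffAt_tangentChart hsrc0).comp 0 hc'
    have hζ : ContDiffAt ℝ ∞ (fun s ↦ tangentChart x₀ (c s).1) 0 := hζ'.contDiffAt
    have hζ0 : tangentChart x₀ (c 0).1 = z := by rw [hc0, tangentChart_symm hzt]
    have hev : ∀ᶠ s in 𝓝 0, tangentChartSymm x₀ (tangentChart x₀ (c s).1) = (c s).1 ∧
        (c s).1.1 ∈ (extChartAt (𝓡 (n + 2)) x₀).source := by
      filter_upwards [hπ.continuousAt.eventually ((isOpen_extChartAt_source x₀).mem_nhds hsrc0)]
        with s hs using ⟨tangentChartSymm_tangentChart hs, hs⟩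
    have hζc : Tendsto (fun s ↦ tangentChart x₀ (c s).1) (𝓝 0) (𝓝 z) := by
      rw [← hζ0]
      exact hζ.continuousAt
    have hevW : ∀ᶠ s in 𝓝 0, tangentChart x₀ (c s).1 ∈ W :=
      hζc.eventually (h.isOpen.mem_nhds hz)
    obtain ⟨ξ, hξ⟩ : ∃ ξ, HasDerivAt (fun s ↦ tangentChart x₀ (c s).1) ξ 0 :=
      ⟨_, (hζ.differentiableAt (by simp)).hasDerivAt⟩
    refine ⟨ξ, ?_, ?_, ?_⟩
    · rw [← hζ0] at hEd
      have h1 := hEd.comp_hasDerivAt 0 hξ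
      rw [hζ0] at h1
      refine h1.unique ((hasDerivAt_const (0 : ℝ) (0 : ℝ)).congr_of_eventuallyEq ?_)
      filter_upwards [hev] with s hs
      exact ((g.mem_nullCone_iff hs.2).1 (c s).2).2
    · have h1 : HasDerivAt (fun s ↦ extChartAt (𝓡 (n + 2)) x₀ (c s).1.1) ξ.1 0 :=
        (ContinuousLinearMap.fst ℝ 𝔼 𝔼).hasFDerivAt.comp_hasDerivAt 0 hξ
      have h2 := tangentChart_tangentMap (x₀ := x₀) (hπ.mdifferentiableAt (by simp)) hsrc0
      have h3 : (mfderiv (𝓡 (n + 2)) (𝓡 (n + 2)) (extChartAt (𝓡 (n + 2)) x₀) (c 0).1.1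
          (mfderiv 𝓘(ℝ, ℝ) (𝓡 (n + 2)) (fun s ↦ (c s).1.1) 0 (1 : ℝ)) : 𝔼) = ξ.1 :=
        (congrArg Prod.snd h2).trans h1.deriv
      have h4 := g.inChart_mfderiv hsrc0
        (mfderiv 𝓘(ℝ, ℝ) (𝓡 (n + 2)) (fun s ↦ (c s).1.1) 0 (1 : ℝ)) (c 0).1.2
      rw [habr, h3] at h4
      rw [liouvilleForm_apply, h.symm, ← hζ0]
      exact h4
    · rw [← hζ0] at hpd
      have h1 := hpd.comp_hasDerivAt 0 hξ
      rw [hζ0] at h1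
      refine h1.unique (ha.congr_of_eventuallyEq ?_)
      filter_upwards [hev, hevW] with s hs hs'
      have h2 : tangentChartSymm x₀ (tangentChart x₀ (c s).1) ∈ g.nullCone := by
        rw [hs.1]
        exact (c s).2
      rw [Function.comp_apply, h.eq _ hs' h2]
      congr 2
      exact Subtype.ext hs.1
  · intro ha
    obtain ⟨s, hsz, hs⟩ := h.exists_section hz h0
    let b : ℝ → 𝔹 := fun t ↦ p z + t • a
    have hbd : ContDiff ℝ ∞ b := contDiff_const.add (contDiff_id.smul contDiff_const)
    have hb0 : b 0 = p z := by simp [b]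
    have hb : HasDerivAt b a 0 := by
      have := ((hasDerivAt_id (0 : ℝ)).smul_const a).const_add (p z)
      rw [one_smul] at this
      exact this
    have hbc : ContinuousAt b 0 := hbd.continuous.continuousAt
    rw [ContinuousAt, hb0] at hbc
    obtain ⟨ε, hε, hball⟩ := Metric.eventually_nhds_iff_ball.1 (hbc.eventually hs)
    rw [Real.ball_eq_Ioo, zero_sub, zero_add] at hball
    have hmem : (0 : ℝ) ∈ Set.Ioo (-ε) ε := ⟨by linarith, hε⟩
    classical
    -- Away from the interval around 0 the values do not matter; the default only makes the curve
    -- total.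
    let c : ℝ → g.nullCone := fun t ↦
      if ht : tangentChartSymm x₀ (s (b t)) ∈ g.nullCone then ⟨_, ht⟩ else ⟨_, hnull z hz h0⟩
    have hct : ∀ t ∈ Set.Ioo (-ε) ε, (c t).1 = tangentChartSymm x₀ (s (b t)) := fun t ht ↦ by
      have h1 := hnull _ (hball t ht).2.1 (hball t ht).2.2.1
      simp only [c, dif_pos h1]
    have hsb : ∀ t ∈ Set.Ioo (-ε) ε, ContDiffAt ℝ ∞ (fun t ↦ s (b t)) t := fun t ht ↦
      (hball t ht).1.comp t hbd.contDiffAt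
    have hc0 : (c 0).1 = tangentChartSymm x₀ z := by rw [hct 0 hmem, hb0, hsz]
    have hds := fderiv_of_section (G := g.inChart x₀) (p := p) hs
      (hsz.symm ▸ h.contDiffAt_energy hz)
      (hsz.symm ▸ h.contDiffAt z hz) a
    -- The velocity of the lifted line is one particular lift of a, and any lift decides
    -- abreastness.
    have hα : liouvilleForm (g.inChart x₀) z (fderiv ℝ s (p z) a) = 0 := by
      rw [hsz] at hds
      refine (h.mem_abreastVelocities_iff hz h0 hds.1).1 ?_
      rwa [hds.2]
    refine ⟨c, ε, hε, fun t ht ↦ ?_, ?_, hc0, ?_⟩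
    · have h1 : ContMDiffAt 𝓘(ℝ, ℝ) (𝓡 (n + 2)).tangent ∞
          (fun t ↦ tangentChartSymm x₀ (s (b t))) t :=
        (contMDiffAt_tangentChartSymm (h.mem_target _ (hball t ht).2.1)).comp t
          (hsb t ht).contMDiffAt
      refine (h1.congr_of_eventuallyEq ?_).contMDiffWithinAt
      filter_upwards [isOpen_Ioo.mem_nhds ht] with t' ht' using hct t' ht'
    · have h1 : HasDerivAt (fun t ↦ (s (b t)).1) (fderiv ℝ s (p z) a).1 0 := by
        have h2 : HasFDerivAt s (fderiv ℝ s (p z)) (b 0) := by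
          rw [hb0]
          exact (hs.self_of_nhds.1.differentiableAt (by simp)).hasFDerivAt
        exact (ContinuousLinearMap.fst ℝ 𝔼 𝔼).hasFDerivAt.comp_hasDerivAt 0
          (h2.comp_hasDerivAt 0 hb)
      have h2 : (fun t ↦ (c t).1.1) =ᶠ[𝓝 0]
          (extChartAt (𝓡 (n + 2)) x₀).symm ∘ fun t ↦ (s (b t)).1 := by
        filter_upwards [isOpen_Ioo.mem_nhds hmem] with t ht
        exact congrArg TotalSpace.proj (hct t ht)
      have h3 : (fun t ↦ (s (b t)).1) 0 = z.1 := by simp only [hb0, hsz]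
      have h4 : MDifferentiableAt (𝓡 (n + 2)) (𝓡 (n + 2)) (extChartAt (𝓡 (n + 2)) x₀).symm
          ((fun t ↦ (s (b t)).1) 0) := by
        rw [h3]
        exact (contMDiffAt_chart_symm hzt).mdifferentiableAt (by simp)
      have h5 := mfderiv_comp 0 h4 h1.differentiableAt.mdifferentiableAt
      rw [mfderiv_eq_fderiv] at h5
      have h6 : (mfderiv 𝓘(ℝ, ℝ) (𝓡 (n + 2)) (fun t ↦ (c t).1.1) 0 (1 : ℝ) : 𝔼)
          = mfderiv (𝓡 (n + 2)) (𝓡 (n + 2)) (extChartAt (𝓡 (n + 2)) x₀).symm z.1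
            (fderiv ℝ s (p z) a).1 := by
        rw [h2.mfderiv_eq]
        refine (congrArg (fun L : ℝ →L[ℝ] 𝔼 ↦ L 1) h5).trans ?_
        have h7 : fderiv ℝ (fun t ↦ (s (b t)).1) 0 1 = (fderiv ℝ s (p z) a).1 := h1.deriv
        have h8 : ∀ (y y' u u' : 𝔼), y = y' → u = u' →
            (mfderiv (𝓡 (n + 2)) (𝓡 (n + 2)) (extChartAt (𝓡 (n + 2)) x₀).symm y u : 𝔼)
              = mfderiv (𝓡 (n + 2)) (𝓡 (n + 2)) (extChartAt (𝓡 (n + 2)) x₀).symm y' u' := by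
          rintro y y' u u' rfl rfl
          rfl
        exact h8 _ _ _ _ h3 h7
      have h9 : ∀ (v : TangentBundle (𝓡 (n + 2)) M) (J : 𝔼), v = tangentChartSymm x₀ z →
          J = mfderiv (𝓡 (n + 2)) (𝓡 (n + 2)) (extChartAt (𝓡 (n + 2)) x₀).symm z.1
            (fderiv ℝ s (p z) a).1 → g.form v.1 J v.2 = 0 := by
        rintro v J rfl rfl
        rw [← hα, liouvilleForm_apply, h.symm]
        rfl
      exact h9 _ _ hc0 h6
    · refine hb.congr_of_eventuallyEq ?_
      filter_upwards [isOpen_Ioo.mem_nhds hmem] with t ht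
      have h1 := hnull _ (hball t ht).2.1 (hball t ht).2.2.1
      have h2 : c t = ⟨_, h1⟩ := Subtype.ext (hct t ht)
      rw [h2, ← h.eq _ (hball t ht).2.1 h1, (hball t ht).2.2.2]

end LorentzianMetric

end ContactVelocities

/-! ### Independence of the null vector representing a geodesic. -/

section GeodesicInvariance

variable {n : ℕ} {M : Type*} [TopologicalSpace M]
  [ChartedSpace (EuclideanSpace ℝ (Fin (n + 2))) M] [IsManifold (𝓡 (n + 2)) ∞ M]
  {g : LorentzianMetric n M}

local notation "𝔼" => EuclideanSpace ℝ (Fin (n + 2))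
local notation "𝔹" => EuclideanSpace ℝ (Fin (2 * n + 1))

local instance : NormedAddCommGroup (𝔼 →L[ℝ] 𝔼 →L[ℝ] ℝ) :=
  ContinuousLinearMap.toNormedAddCommGroup

local instance : NormedSpace ℝ (𝔼 →L[ℝ] 𝔼 →L[ℝ] ℝ) :=
  ContinuousLinearMap.toNormedSpace

theorem geodesicSpray_of_snd_eq_zero {G : 𝔼 → 𝔼 →L[ℝ] 𝔼 →L[ℝ] ℝ} {z : 𝔼 × 𝔼} (hz : z.2 = 0) :
    geodesicSpray G z = 0 := by
  have h : christoffelForm G z.1 0 0 = 0 := by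
    ext w
    simp [christoffelForm_apply]
  simp [geodesicSpray, hz, h]

namespace LorentzianMetric

theorem IsGeodesicOn.eventually_hasDerivAt {γ : ℝ → M} {J : Set ℝ} (h : g.IsGeodesicOn γ J)
    (hJ : IsOpen J) {t : ℝ} (ht : t ∈ J) :
    ∃ ε > 0, ∀ r ∈ Set.Ioo (t - ε) (t + ε), r ∈ J ∧
      γ r ∈ (extChartAt (𝓡 (n + 2)) (γ t)).source ∧
      HasDerivAt
        (fun s ↦ tangentChart (γ t) (tangentMap 𝓘(ℝ, ℝ) (𝓡 (n + 2)) γ ⟨s, (1 : ℝ)⟩))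
        (geodesicSpray (g.inChart (γ t))
          (tangentChart (γ t) (tangentMap 𝓘(ℝ, ℝ) (𝓡 (n + 2)) γ ⟨r, (1 : ℝ)⟩))) r := by
  have h1 := (h.1.contMDiffAt (hJ.mem_nhds ht)).continuousAt.eventually
    (extChartAt_source_mem_nhds (I := 𝓡 (n + 2)) (γ t))
  obtain ⟨ε, hε, hball⟩ := Metric.eventually_nhds_iff_ball.1 ((hJ.eventually_mem ht).and h1)
  rw [Real.ball_eq_Ioo] at hball
  exact ⟨ε, hε, fun r hr ↦ ⟨(hball r hr).1, (hball r hr).2,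
    h.hasDerivAt hJ (hball r hr).1 (hball r hr).2⟩⟩

/-- Energy is conserved, and a vanishing velocity is an equilibrium of the spray, so uniqueness for
ODEs prevents a nonconstant geodesic from stopping. -/
theorem IsGeodesicOn.eventually_mem_nullCone_iff {γ : ℝ → M} {J : Set ℝ}
    (h : g.IsGeodesicOn γ J) (hJ : IsOpen J) {t : ℝ} (ht : t ∈ J) :
    ∀ᶠ r in 𝓝 t, tangentMap 𝓘(ℝ, ℝ) (𝓡 (n + 2)) γ ⟨r, (1 : ℝ)⟩ ∈ g.nullCone ↔
      tangentMap 𝓘(ℝ, ℝ) (𝓡 (n + 2)) γ ⟨t, (1 : ℝ)⟩ ∈ g.nullCone := by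
  obtain ⟨ε, hε, hε'⟩ := h.eventually_hasDerivAt hJ ht
  have hmem : t ∈ Set.Ioo (t - ε) (t + ε) := ⟨by linarith, by linarith⟩
  set c : ℝ → 𝔼 × 𝔼 :=
    fun r ↦ tangentChart (γ t) (tangentMap 𝓘(ℝ, ℝ) (𝓡 (n + 2)) γ ⟨r, (1 : ℝ)⟩) with hc
  have hct : ∀ r ∈ Set.Ioo (t - ε) (t + ε),
      (c r).1 ∈ (extChartAt (𝓡 (n + 2)) (γ t)).target := fun r hr ↦
    tangentChart_mem_target (v := tangentMap 𝓘(ℝ, ℝ) (𝓡 (n + 2)) γ ⟨r, (1 : ℝ)⟩) (hε' r hr).2.1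
  have hE : ∀ r ∈ Set.Ioo (t - ε) (t + ε), metricEnergy (g.inChart (γ t)) (c r)
      = metricEnergy (g.inChart (γ t)) (c t) := fun r hr ↦
    metricEnergy_eq (g.inChart_symm (γ t)) isOpen_Ioo Set.ordConnected_Ioo.isPreconnected
      (fun r hr ↦ g.contDiffAt_inChart (hct r hr)) (fun r hr ↦ g.isInvertible_inChart (hct r hr))
      (fun r hr ↦ (hε' r hr).2.2) hr hmem
  have hne : ∀ᶠ r in 𝓝 t, (c r).2 ≠ 0 ↔ (c t).2 ≠ 0 := by
    by_cases h0 : (c t).2 = 0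
    · have hX : ContDiffAt ℝ ∞ (geodesicSpray (g.inChart (γ t))) (c t) :=
        contDiffAt_geodesicSpray (g.contDiffAt_inChart (hct t hmem))
          (g.isInvertible_inChart (hct t hmem))
      obtain ⟨K, S, hS, hK⟩ := (hX.of_le (m := 1) (by simp)).exists_lipschitzOnWith
      have hX0 : geodesicSpray (g.inChart (γ t)) (c t) = 0 :=
        geodesicSpray_of_snd_eq_zero h0
      have heq : c =ᶠ[𝓝 t] fun _ ↦ c t := by
        refine ODE_solution_unique_of_eventually
          (v := fun _ ↦ geodesicSpray (g.inChart (γ t))) (s := fun _ ↦ S)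
          (.of_forall fun _ ↦ hK) ?_ (.of_forall fun r ↦ ⟨?_, mem_of_mem_nhds hS⟩) rfl
        · filter_upwards [isOpen_Ioo.mem_nhds hmem,
            (hε' t hmem).2.2.continuousAt.eventually hS] with r hr hr' using
            ⟨(hε' r hr).2.2, hr'⟩
        · rw [hX0]
          exact hasDerivAt_const r (c t)
      filter_upwards [heq] with r hr
      rw [hr]
    · have h1 : ContinuousAt (fun r ↦ (c r).2) t := (hε' t hmem).2.2.continuousAt.snd
      filter_upwards [h1.eventually_ne h0] with r hr using iff_of_true hr h0
  filter_upwards [hne, isOpen_Ioo.mem_nhds hmem] with r hr hr'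
  rw [g.mem_nullCone_iff (x₀ := γ t) (v := tangentMap 𝓘(ℝ, ℝ) (𝓡 (n + 2)) γ ⟨r, (1 : ℝ)⟩)
      (hε' r hr').2.1,
    g.mem_nullCone_iff (x₀ := γ t) (v := tangentMap 𝓘(ℝ, ℝ) (𝓡 (n + 2)) γ ⟨t, (1 : ℝ)⟩)
      (hε' t hmem).2.1]
  exact and_congr hr (iff_of_eq (congrArg (· = 0) (hE r hr')))

variable [ChartedSpace (EuclideanSpace ℝ (Fin (2 * n + 1))) g.NullGeodesicSpace]

/-- If the velocity is null at t, flow invariance of abreastness applies in a model around it.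
Otherwise it is not in the null cone nearby and both sets are empty. -/
theorem IsGeodesicOn.eventually_contactVelocities_eq {γ : ℝ → M} {J : Set ℝ}
    (h : g.IsGeodesicOn γ J) (hJ : IsOpen J) (hg : g.IsQuotientManifold)
    {φ : OpenPartialHomeomorph g.NullGeodesicSpace 𝔹} (hφ : IsSmoothChart (F := 𝔹) φ)
    {t : ℝ} (ht : t ∈ J)
    (hmem : ∀ h0 : tangentMap 𝓘(ℝ, ℝ) (𝓡 (n + 2)) γ ⟨t, (1 : ℝ)⟩ ∈ g.nullCone,
      g.toNullGeodesic ⟨_, h0⟩ ∈ φ.source) :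
    ∀ᶠ r in 𝓝 t, contactVelocities φ (tangentMap 𝓘(ℝ, ℝ) (𝓡 (n + 2)) γ ⟨r, (1 : ℝ)⟩)
      = contactVelocities φ (tangentMap 𝓘(ℝ, ℝ) (𝓡 (n + 2)) γ ⟨t, (1 : ℝ)⟩) := by
  have hnull := h.eventually_mem_nullCone_iff hJ ht
  by_cases h0 : tangentMap 𝓘(ℝ, ℝ) (𝓡 (n + 2)) γ ⟨t, (1 : ℝ)⟩ ∈ g.nullCone
  · obtain ⟨p, W, hW, htW⟩ := hg.exists_represents hφ ⟨_, h0⟩ (hmem h0)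
    obtain ⟨ε, hε, hε'⟩ := h.eventually_hasDerivAt hJ ht
    have hI : Set.Ioo (t - ε) (t + ε) ∈ 𝓝 t := isOpen_Ioo.mem_nhds ⟨by linarith, by linarith⟩
    have hWev := (hε' t (mem_of_mem_nhds hI)).2.2.continuousAt.eventually
      (hW.isOpen.mem_nhds htW)
    have hE : ∀ᶠ r in 𝓝 t, metricEnergy (g.inChart (γ t))
        (tangentChart (γ t) (tangentMap 𝓘(ℝ, ℝ) (𝓡 (n + 2)) γ ⟨r, (1 : ℝ)⟩)) = 0 := by
      filter_upwards [hnull, hI] with r hr hr'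
      exact ((g.mem_nullCone_iff (x₀ := γ t)
        (v := tangentMap 𝓘(ℝ, ℝ) (𝓡 (n + 2)) γ ⟨r, (1 : ℝ)⟩) (hε' r hr').2.1).1 (hr.2 h0)).2
    have hCV : ∀ᶠ r in 𝓝 t,
        contactVelocities φ (tangentMap 𝓘(ℝ, ℝ) (𝓡 (n + 2)) γ ⟨r, (1 : ℝ)⟩)
          = abreastVelocities (g.inChart (γ t)) p
            (tangentChart (γ t) (tangentMap 𝓘(ℝ, ℝ) (𝓡 (n + 2)) γ ⟨r, (1 : ℝ)⟩)) := by
      filter_upwards [hE, hWev, hI] with r h1 h2 h3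
      have h4 := hW.contactVelocities_eq h2 h1
      have h5 := tangentChartSymm_tangentChart (x₀ := γ t)
        (v := tangentMap 𝓘(ℝ, ℝ) (𝓡 (n + 2)) γ ⟨r, (1 : ℝ)⟩) (hε' r h3).2.1
      exact (congrArg (contactVelocities φ) h5.symm).trans h4
    have habr := hW.eventually_abreastVelocities_eq hWev hE (by
      filter_upwards [hI] with r hr using (hε' r hr).2.2)
    filter_upwards [hCV, habr] with r h1 h2
    rw [h1, hCV.self_of_nhds]
    exact h2
  · filter_upwards [hnull] with r hr
    rw [contactVelocities_eq_empty h0, contactVelocities_eq_empty (hr.not.2 h0)]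

/-- Local constancy along the geodesic and connectedness of its interval compare the two velocities;
rescaling invariance passes to v and w. -/
theorem TangentToSameGeodesic.contactVelocities_eq {v w : g.nullCone}
    (h : g.TangentToSameGeodesic v w) (hg : g.IsQuotientManifold)
    {φ : OpenPartialHomeomorph g.NullGeodesicSpace 𝔹} (hφ : IsSmoothChart (F := 𝔹) φ)
    (hv : g.toNullGeodesic v ∈ φ.source) :
    contactVelocities φ v.1 = contactVelocities φ w.1 := by
  obtain ⟨γ, J, hJ, hJ', hγ, s, hs, t, ht, a, b, ha, hb, hsv, htw⟩ := h
  have key := hJ'.isPreconnected.induction₂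
    (fun r r' ↦ contactVelocities φ (tangentMap 𝓘(ℝ, ℝ) (𝓡 (n + 2)) γ ⟨r, (1 : ℝ)⟩)
      = contactVelocities φ (tangentMap 𝓘(ℝ, ℝ) (𝓡 (n + 2)) γ ⟨r', (1 : ℝ)⟩))
    (fun r hr ↦ ?_) (fun _ _ _ _ _ _ h1 h2 ↦ h1.trans h2) (fun _ _ _ _ h1 ↦ h1.symm) hs ht
  · rw [hsv, htw] at key
    exact (contactVelocities_smul ha).symm.trans (key.trans (contactVelocities_smul hb))
  · refine nhdsWithin_le_nhds ?_
    -- Each null velocity of γ represents the same point of 𝒩 as v, so the chart φ remains usable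
    -- along the whole geodesic.
    filter_upwards [hγ.eventually_contactVelocities_eq hJ hg hφ hr fun h0 ↦ by
      rwa [g.toNullGeodesic_eq hJ hJ' hγ hr hs ⟨_, h0⟩ v ha rfl hsv]] with r' hr' using hr'.symm

/-- Equality in the quotient means the equivalence relation generated by tangency to a common
geodesic, so the proof is an induction over chains. -/
theorem contactVelocities_eq_of_toNullGeodesic_eq (hg : g.IsQuotientManifold)
    {φ : OpenPartialHomeomorph g.NullGeodesicSpace 𝔹} (hφ : IsSmoothChart (F := 𝔹) φ)
    {v w : g.nullCone} (hvw : g.toNullGeodesic v = g.toNullGeodesic w)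
    (hv : g.toNullGeodesic v ∈ φ.source) :
    contactVelocities φ v.1 = contactVelocities φ w.1 := by
  have h := Quot.eqvGen_exact hvw
  induction h with
  | rel x y hxy => exact hxy.contactVelocities_eq hg hφ hv
  | refl x => rfl
  | symm x y hxy ih =>
    have h1 : g.toNullGeodesic x = g.toNullGeodesic y := Quot.eqvGen_sound hxy
    exact (ih h1 (h1 ▸ hv)).symm
  | trans x y z hxy hyz ih1 ih2 =>
    have h1 : g.toNullGeodesic x = g.toNullGeodesic y := Quot.eqvGen_sound hxy
    have h2 : g.toNullGeodesic y = g.toNullGeodesic z := Quot.eqvGen_sound hyz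
    exact (ih1 h1 hv).trans (ih2 h2 (h1 ▸ hv))

end LorentzianMetric

end GeodesicInvariance

/-! ### The canonical distribution as the kernel of a contact form. -/

section ContactDistribution

variable {n : ℕ} {M : Type*} [TopologicalSpace M]
  [ChartedSpace (EuclideanSpace ℝ (Fin (n + 2))) M] [IsManifold (𝓡 (n + 2)) ∞ M]
  {g : LorentzianMetric n M}
  [ChartedSpace (EuclideanSpace ℝ (Fin (2 * n + 1))) g.NullGeodesicSpace]

local notation "𝔼" => EuclideanSpace ℝ (Fin (n + 2))
local notation "𝔹" => EuclideanSpace ℝ (Fin (2 * n + 1))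

local instance : NormedAddCommGroup (𝔼 →L[ℝ] 𝔼 →L[ℝ] ℝ) :=
  ContinuousLinearMap.toNormedAddCommGroup

local instance : NormedSpace ℝ (𝔼 →L[ℝ] 𝔼 →L[ℝ] ℝ) :=
  ContinuousLinearMap.toNormedSpace

namespace LorentzianMetric

theorem IsQuotientManifold.mdifferentiableAt (hg : g.IsQuotientManifold) {c : ℝ → g.nullCone}
    {t : ℝ} (hc : ContMDiffAt 𝓘(ℝ, ℝ) (𝓡 (n + 2)).tangent ∞
      (fun s ↦ (c s : TangentBundle (𝓡 (n + 2)) M)) t) :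
    MDifferentiableAt 𝓘(ℝ, ℝ) (𝓡 (2 * n + 1)) (fun s ↦ g.toNullGeodesic (c s)) t := by
  obtain ⟨U, P, hU, hcU, hP, hPc, -⟩ := hg (c t)
  have h1 := ((hP.contMDiffAt (hU.mem_nhds hcU)).comp t hc).mdifferentiableAt (by simp)
  refine h1.congr_of_eventuallyEq ?_
  filter_upwards [hc.continuousAt.eventually (hU.mem_nhds hcU)] with s hs
  exact (hPc (c s) hs).symm

theorem IsQuotientManifold.hasDerivAt (hg : g.IsQuotientManifold)
    {φ : OpenPartialHomeomorph g.NullGeodesicSpace 𝔹} (hφ : IsSmoothChart (F := 𝔹) φ)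
    {c : ℝ → g.nullCone} {t : ℝ} (hc : ContMDiffAt 𝓘(ℝ, ℝ) (𝓡 (n + 2)).tangent ∞
      (fun s ↦ (c s : TangentBundle (𝓡 (n + 2)) M)) t)
    (ht : g.toNullGeodesic (c t) ∈ φ.source) :
    HasDerivAt (fun s ↦ φ (g.toNullGeodesic (c s)))
      (chartDiff φ (g.toNullGeodesic (c t))
        (mfderiv 𝓘(ℝ, ℝ) (𝓡 (2 * n + 1)) (fun s ↦ g.toNullGeodesic (c s)) t (1 : ℝ))) t := by
  have h1 := hg.mdifferentiableAt hc
  have h2 := (hφ.contMDiffAt ht).mdifferentiableAt (n := ∞) (by simp)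
  have h3 := mfderiv_comp (I' := 𝓡 (2 * n + 1)) (I'' := 𝓘(ℝ, 𝔹)) t h2 h1
  have h4 : DifferentiableAt ℝ (fun s ↦ φ (g.toNullGeodesic (c s))) t :=
    (MDifferentiableAt.comp (I' := 𝓡 (2 * n + 1)) t h2 h1).differentiableAt
  have h5 := h4.hasDerivAt
  have h6 : deriv (fun s ↦ φ (g.toNullGeodesic (c s))) t = chartDiff φ (g.toNullGeodesic (c t))
      (mfderiv 𝓘(ℝ, ℝ) (𝓡 (2 * n + 1)) (fun s ↦ g.toNullGeodesic (c s)) t (1 : ℝ)) :=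
    congrArg (fun L : ℝ →L[ℝ] 𝔹 ↦ L 1) (mfderiv_eq_fderiv.symm.trans h3)
  rwa [h6] at h5

/-- Once all representatives give the same hyperplane of velocities, the span defining the
distribution adds nothing to it. -/
theorem mem_contactDistribution_iff (hg : g.IsQuotientManifold)
    {φ : OpenPartialHomeomorph g.NullGeodesicSpace 𝔹} (hφ : IsSmoothChart (F := 𝔹) φ)
    {y : g.NullGeodesicSpace} (hy : y ∈ φ.source) {L : 𝔹 →L[ℝ] ℝ}
    (hL : ∀ v : g.nullCone, g.toNullGeodesic v = y → contactVelocities φ v.1 = {a | L a = 0})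
    (ξ : TangentSpace (𝓡 (2 * n + 1)) y) :
    ξ ∈ g.contactDistribution y ↔ L (chartDiff φ y ξ) = 0 := by
  constructor
  · have hle : g.contactDistribution y
        ≤ LinearMap.ker ((L.comp (chartDiff (F := 𝔹) φ y)).toLinearMap) := by
      refine Submodule.span_le.2 ?_
      rintro η ⟨c, ε, hε, hc, habr, h⟩
      have h1 : g.toNullGeodesic (c 0) = y := congrArg TotalSpace.proj h
      subst h1
      obtain rfl := eq_of_heq (TotalSpace.mk.inj h).2
      have h2 := hg.hasDerivAt hφ (hc.contMDiffAt (isOpen_Ioo.mem_nhds ⟨by linarith, hε⟩)) hy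
      have h3 := (hL _ rfl).subset ⟨c, ε, hε, hc, habr, rfl, h2⟩
      exact h3
    exact fun h ↦ hle h
  · intro h
    obtain ⟨v, hv⟩ : ∃ v, g.toNullGeodesic v = y := Quot.exists_rep y
    obtain ⟨c, ε, hε, hc, habr, hcv, ha⟩ := (hL v hv).superset h
    obtain rfl : c 0 = v := Subtype.ext hcv
    subst hv
    have h2 := hg.hasDerivAt hφ (hc.contMDiffAt (isOpen_Ioo.mem_nhds ⟨by linarith, hε⟩)) hy
    have h3 := (hφ.isInvertible_chartDiff hy).injective (ha.unique h2)
    exact Submodule.subset_span ⟨c, ε, hε, hc, habr, h3 ▸ rfl⟩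

/-- The form is the Liouville form pulled back by a section s. For y near `q` the vector s(φ y)
represents y and computes its abreast velocities, and all other representatives give the same set.
-/
theorem exists_isPfaffChart [IsManifold (𝓡 (2 * n + 1)) ∞ g.NullGeodesicSpace]
    (hg : g.IsQuotientManifold) (q : g.NullGeodesicSpace) :
    ∃ ϑ : 𝔹 → 𝔹 →L[ℝ] ℝ,
      IsPfaffChart g.contactDistribution q (chartAt (𝔹) q) ϑ ∧
      ϑ (chartAt (𝔹) q q) ≠ 0 ∧
      ∀ a, ϑ (chartAt (𝔹) q q) a = 0 →
        (∀ b, ϑ (chartAt (𝔹) q q) b = 0 →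
          exteriorDerivative ϑ (chartAt (𝔹) q q) a b = 0) →
        a = 0 := by
  set φ := chartAt 𝔹 q with hφdef
  have hφ : IsSmoothChart (F := 𝔹) φ :=
    ⟨contMDiffOn_chart (I := 𝓡 (2 * n + 1)), contMDiffOn_chart_symm (I := 𝓡 (2 * n + 1))⟩
  have hqs : q ∈ φ.source := mem_chart_source 𝔹 q
  obtain ⟨v₀, hv₀⟩ : ∃ v₀, g.toNullGeodesic v₀ = q := Quot.exists_rep q
  obtain ⟨p, W, hW, hz₀⟩ := hg.exists_represents hφ v₀ (hv₀ ▸ hqs)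
  set x₀ := v₀.1.1
  set z₀ := tangentChart x₀ v₀.1
  have hsrc := mem_extChartAt_source (I := 𝓡 (n + 2)) x₀
  have hΨ : tangentChartSymm x₀ z₀ = v₀.1 := tangentChartSymm_tangentChart hsrc
  have hE : metricEnergy (g.inChart x₀) z₀ = 0 := ((g.mem_nullCone_iff hsrc).1 v₀.2).2
  have hnull : tangentChartSymm x₀ z₀ ∈ g.nullCone := hΨ ▸ v₀.2
  have hpz : p z₀ = φ q := by
    rw [hW.eq z₀ hz₀ hnull, ← hv₀]
    congr 2
    exact Subtype.ext hΨ
  obtain ⟨s, -, hs⟩ := hW.exists_section hz₀ hE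
  rw [hpz] at hs
  obtain ⟨-, -, hne, hnd⟩ := hW.pulledBackForm_spec hs
  refine ⟨pulledBackForm (g.inChart x₀) s, ⟨hφ, hqs, ?_, ?_⟩, hne, fun a ha hb ↦ hnd a ha hb⟩
  · filter_upwards [eventually_eventually_nhds.2 hs] with b hb using (hW.pulledBackForm_spec hb).1
  · filter_upwards [φ.open_source.mem_nhds hqs, (φ.continuousAt hqs).eventually
      (eventually_eventually_nhds.2 hs)] with y hy hys
    obtain ⟨-, hsW, hs0, hps⟩ := hys.self_of_nhds
    have hsn : tangentChartSymm x₀ (s (φ y)) ∈ g.nullCone :=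
      (g.tangentChartSymm_mem_nullCone_iff (hW.mem_target _ hsW)).2 ⟨hW.ne_zero _ hsW, hs0⟩
    -- The model map is the projection read in φ, and φ is injective on its source.
    have hsy : g.toNullGeodesic ⟨_, hsn⟩ = y :=
      φ.injOn (hW.mem_source _ hsW hsn) hy ((hW.eq _ hsW hsn).symm.trans hps)
    refine fun ξ ↦ mem_contactDistribution_iff hg hφ hy (fun v hv ↦ ?_) ξ
    rw [contactVelocities_eq_of_toNullGeodesic_eq hg hφ (w := ⟨_, hsn⟩) (hv.trans hsy.symm)
      (hv ▸ hy), hW.contactVelocities_eq hsW hs0]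
    ext a
    exact ((hW.pulledBackForm_spec hys).2.1 a).symm

end LorentzianMetric

end ContactDistribution

theorem mainTheorem5 {n : ℕ} (hn : 1 ≤ n) {M : Type*} [TopologicalSpace M] [T2Space M]
    [ChartedSpace (EuclideanSpace ℝ (Fin (n + 2))) M] [IsManifold (𝓡 (n + 2)) ∞ M]
    (g : LorentzianMetric n M)
    [ChartedSpace (EuclideanSpace ℝ (Fin (2 * n + 1))) g.NullGeodesicSpace]
    [IsManifold (𝓡 (2 * n + 1)) ∞ g.NullGeodesicSpace]
    (hg : g.IsQuotientManifold) (q : g.NullGeodesicSpace) :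
    -- the nilpotent approximation of the contact structure is the Heisenberg algebra
    (derivedLayer g.contactDistribution q = ⊤ ∧
      LeviBracketWellDefined g.contactDistribution q ∧
      ∃ e : OsculatingSpace g.contactDistribution q ≃ₗ[ℝ] HeisenbergAlgebra n,
        IsGradedLieIso g.contactDistribution q e) ∧
    -- the grading in Darboux coordinates
    ∀ (θ : (y : g.NullGeodesicSpace) → TangentSpace (𝓡 (2 * n + 1)) y →L[ℝ] ℝ)
      (φ : OpenPartialHomeomorph g.NullGeodesicSpace (DarbouxSpace n)),
      IsContactFormOn g.contactDistribution θ φ.source → IsDarbouxChart θ q φ →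
      -- the coordinate directions `x`, `p` and `v` give the graded identification
      (∃ e : OsculatingSpace g.contactDistribution q ≃ₗ[ℝ] HeisenbergAlgebra n,
        IsGradedLieIso g.contactDistribution q e ∧
        (∀ ξ : g.contactDistribution q, e (ξ, 0) =
          ⟨(mfderiv (𝓡 (2 * n + 1)) 𝓘(ℝ, DarbouxSpace n) φ q ξ : DarbouxSpace n).2.1,
            (mfderiv (𝓡 (2 * n + 1)) 𝓘(ℝ, DarbouxSpace n) φ q ξ : DarbouxSpace n).2.2, 0⟩) ∧
        (∀ η : TangentSpace (𝓡 (2 * n + 1)) q, e (0, Submodule.Quotient.mk η) =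
          ⟨0, 0, (mfderiv (𝓡 (2 * n + 1)) 𝓘(ℝ, DarbouxSpace n) φ q η : DarbouxSpace n).1⟩) ∧
        ∀ a, e (osculatingGradingDerivation g.contactDistribution q a)
          = HeisenbergAlgebra.gradingDerivation n (e a)) ∧
      -- the coordinates have weights one, one and two
      (∀ i, HasWeight g.contactDistribution q 1 (fun y ↦ (φ y).2.1 i)) ∧
      (∀ i, HasWeight g.contactDistribution q 1 (fun y ↦ (φ y).2.2 i)) ∧
      HasWeight g.contactDistribution q 2 (fun y ↦ (φ y).1) ∧
      -- the grading derivation is induced by `2v ∂_v + x^i ∂_{x^i} + p_i ∂_{p_i}`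
      InducesOnOsculating g.contactDistribution q
        (VectorField.mpullback (𝓡 (2 * n + 1)) 𝓘(ℝ, DarbouxSpace n) φ (darbouxEuler n))
        (osculatingGradingDerivation g.contactDistribution q) := by
  refine ⟨?_, fun θ φ hθ hφ ↦ ?_⟩
  · obtain ⟨ϑ, h, hne, hnd⟩ := LorentzianMetric.exists_isPfaffChart hg q
    exact h.nilpotentApproximation hne hn (by simp) hnd
  · have h := hφ.isPfaffChart hθ
    obtain ⟨hx, hp, hv⟩ := h.hasWeight_darboux hφ.centred hn
    exact ⟨h.exists_darboux_isGradedLieIso hφ.centred, hx, hp, hv,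
      h.inducesOnOsculating_darbouxEuler hφ.centred⟩

end
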